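/- A permutation $\sigma=\sigma_1\sigma_2\cdots\sigma_n$ of size $|\sigma|=n$ is \emph{simple} if the only blocks $\sigma_i\sigma_{i+1}\cdots\sigma_j$ of consecutive letters whose set of values is an interval of integers are the single letters and the whole permutation. Write $\pi\preceq\sigma$ if $\pi$ is order-isomorphic to a subword of $\sigma$, and $\pi\prec\sigma$ if moreover $\pi\neq\sigma$. The \emph{exceptional} permutations are, for $m\ge 2$, $$2\,4\,6\cdots(2m)\,1\,3\,5\cdots(2m-1),\qquad (2m-1)(2m-3)\cdots 1\,(2m)(2m-2)\cdots 2,$$ $$(m+1)\,1\,(m+2)\,2\cdots(2m)\,m,\qquad m\,(2m)\,(m-1)\,(2m-1)\cdots 1\,(m+1).$$ Let $G$ be the directed graph whose vertices are the simple permutations of size at least $4$, with an edge from $\sigma$ to $\pi$ if and only if $\pi\prec\sigma$ and there is no simple permutation $\tau$ with $\pi\prec\tau\prec\sigma$. Let $G_1$ be obtained from $G$ by deleting all edges between two exceptional permutations. For $n\ge 4$ let $D_n$ be the average outdegree in $G_1$ of the simple permutations of size $n$. Then, for every simple permutation $\sigma$ of size $n\ge 4$, the outdegree of $\sigma$ in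 $G_1$ equals the number of points of $\sigma$ whose deletion (followed by renormalization) leaves a simple permutation; so $D_n$ is the average number of single-point deletions that leave a simple permutation. Moreover, as $n\to\infty$, $$D_n = n-4-\frac{4}{n}+O\!\left(\frac{1}{n^2}\right).$$ -/

import Mathlib

open Filter Asymptotics

namespace SimplePoset

/-- A permutation of arbitrary finite size; `σ.1` is its size. Positions and values are numbered
from `0`, so the one-line word is `σ.2 0 + 1, σ.2 1 + 1, …`. -/
abbrev AnyPerm : Type := Σ n : ℕ, Equiv.Perm (Fin n)

/-- `IsPattern π σ`: the word of `π` is order-isomorphic to a subword of the word of `σ`. -/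
def IsPattern (π σ : AnyPerm) : Prop :=
  ∃ f : Fin π.1 ↪o Fin σ.1, ∀ a b : Fin π.1, π.2 a < π.2 b ↔ σ.2 (f a) < σ.2 (f b)

/-- Strict pattern containment. -/
def IsStrictPattern (π σ : AnyPerm) : Prop :=
  IsPattern π σ ∧ π ≠ σ

/-- A permutation is simple if its only intervals (blocks of consecutive positions whose values
form an interval) are the singletons and the whole permutation. -/
def IsSimple {n : ℕ} (σ : Equiv.Perm (Fin n)) : Prop :=
  ∀ i j : Fin n, i ≤ j → (∃ a b : Fin n, σ '' Set.Icc i j = Set.Icc a b) →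
    i = j ∨ Set.Icc i j = Set.univ

/-- Letter at position `p` (counted from `1`) of `2 4 6 … (2m) 1 3 5 … (2m-1)`. -/
def exceptionalWord₁ (m p : ℕ) : ℕ :=
  if p ≤ m then 2 * p else 2 * (p - m) - 1

/-- Letter at position `p` (counted from `1`) of `(2m-1) (2m-3) … 1 (2m) (2m-2) … 2`. -/
def exceptionalWord₂ (m p : ℕ) : ℕ :=
  if p ≤ m then 2 * (m - p) + 1 else 2 * (2 * m - p) + 2

/-- Letter at position `p` (counted from `1`) of `(m+1) 1 (m+2) 2 … (2m) m`. -/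
def exceptionalWord₃ (m p : ℕ) : ℕ :=
  if p % 2 = 1 then m + (p + 1) / 2 else p / 2

/-- Letter at position `p` (counted from `1`) of `m (2m) (m-1) (2m-1) … 1 (m+1)`. -/
def exceptionalWord₄ (m p : ℕ) : ℕ :=
  if p % 2 = 1 then m + 1 - (p + 1) / 2 else 2 * m + 1 - p / 2

/-- `σ` has size `2m` for some `m ≥ 2` and is of one of the four exceptional types. -/
def IsExceptional (σ : AnyPerm) : Prop :=
  ∃ m : ℕ, 2 ≤ m ∧ σ.1 = 2 * m ∧
    ((∀ i : Fin σ.1, (σ.2 i : ℕ) + 1 = exceptionalWord₁ m ((i : ℕ) + 1)) ∨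
     (∀ i : Fin σ.1, (σ.2 i : ℕ) + 1 = exceptionalWord₂ m ((i : ℕ) + 1)) ∨
     (∀ i : Fin σ.1, (σ.2 i : ℕ) + 1 = exceptionalWord₃ m ((i : ℕ) + 1)) ∨
     (∀ i : Fin σ.1, (σ.2 i : ℕ) + 1 = exceptionalWord₄ m ((i : ℕ) + 1)))

/-- The simple permutations of size at least `4`. -/
abbrev Vertex : Type := {σ : AnyPerm // 4 ≤ σ.1 ∧ IsSimple σ.2}

/-- The graph `G` of the poset of simple permutations: an edge from `σ` to `π` when `π` is a strict
pattern of `σ` with no simple permutation strictly in between. -/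
def graphG : Digraph Vertex where
  Adj σ π := IsStrictPattern π.1 σ.1 ∧
    ¬ ∃ τ : Vertex, IsStrictPattern π.1 τ.1 ∧ IsStrictPattern τ.1 σ.1

/-- The graph `G₁`: delete from `G` the edges between two exceptional permutations. -/
def graphG₁ : Digraph Vertex where
  Adj σ π := graphG.Adj σ π ∧ ¬ (IsExceptional σ.1 ∧ IsExceptional π.1)

/-- Outdegree in `G₁`. -/
noncomputable def outdegree (σ : Vertex) : ℕ :=
  Set.ncard {π : Vertex | graphG₁.Adj σ π}

/-- The vertices of size `n`. -/
def verticesOfSize (n : ℕ) : Set Vertex :=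
  {σ | σ.1.1 = n}

/-- There are finitely many vertices of size less than `n`. -/
theorem finite_vertices_lt (n : ℕ) : {σ : Vertex | σ.1.1 < n}.Finite := by
  refine Set.Finite.of_finite_image (f := Subtype.val) ?_ Subtype.val_injective.injOn
  refine Set.Finite.subset
    (Set.finite_range (fun x : (Σ k : Fin n, Equiv.Perm (Fin (k : ℕ))) => (⟨x.1, x.2⟩ : AnyPerm))) ?_
  rintro _ ⟨⟨⟨k, s⟩, h⟩, hk, rfl⟩
  exact ⟨⟨⟨k, hk⟩, s⟩, rfl⟩

theorem finite_verticesOfSize (n : ℕ) : (verticesOfSize n).Finite :=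
  (finite_vertices_lt (n + 1)).subset fun σ (h : σ.1.1 = n) => by
    change σ.1.1 < n + 1
    omega

/-- So `outdegree` counts a finite set. -/
theorem finite_outNeighbors (σ : Vertex) : {π : Vertex | graphG₁.Adj σ π}.Finite := by
  refine (finite_vertices_lt (σ.1.1 + 1)).subset ?_
  rintro π ⟨⟨⟨⟨f, -⟩, -⟩, -⟩, -⟩
  have h := Fintype.card_le_of_injective f f.injective
  simp only [Fintype.card_fin] at h
  exact Nat.lt_succ_of_le h

/-- `D n`, the average outdegree in `G₁` of the simple permutations of size `n` (for `n ≥ 4`). -/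
noncomputable def averageOutdegree (n : ℕ) : ℝ :=
  (∑ᶠ σ ∈ verticesOfSize n, (outdegree σ : ℝ)) / (verticesOfSize n).ncard

/-- Delete the point at position `i` and renormalize. -/
def deletePoint {n : ℕ} (σ : Equiv.Perm (Fin (n + 1))) (i : Fin (n + 1)) : Equiv.Perm (Fin n) :=
  (finSuccAboveEquiv i).trans
    ((σ.subtypeEquiv (p := fun x => x ≠ i) (q := fun y => y ≠ σ i)
      (fun _ => σ.injective.ne_iff.symm)).trans (finSuccAboveEquiv (σ i)).symm)

end SimplePoset

/-! Two independent facts carry the theorem. The first is structural. Colour each ordered pair of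
positions by its relative order in position and in value: intervals become modules and simple
permutations become primitive structures. By the Ehrenfeucht–Rozenberg theorem
(`exists_isPrimitive_insert`), a simple proper pattern `π` of a simple `σ` (size of `π` at least 4)
can be enlarged by one or two points of `σ` to a simple pattern, so an edge of `graphG` drops one or
two points. An edge that drops two is rigid (`IsCriticalPair`): the two points are adjacent in
position or in value, the removable pair slides along the whole word, and `σ` and `π` are both
exceptional. Those edges are absent from `graphG₁`. What remains is the single-point deletions, and
these are pairwise distinct when `σ` is simple.

The second is enumerative. A simple permutation of size n + 1 with a point whose deletion is simple
is the same as a simple τ of size n with a good cell for a new point. Of the (n+1)² cells the bad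
ones are the four around each point and the four corners, all distinct, so (n+1)(n-3) are good. With
s_n the number of simple permutations this gives D_n = n(n-4) s_{n-1}/s_n.

To estimate the ratio, note that a permutation of size at least 2 is exactly one of: sum
decomposable, skew decomposable, an inflation of a unique simple permutation of size at least 4.
Hence F = Σ_{n≥1} n! Xⁿ satisfies F = X + 2F²/(1+F) + S(F), and its compositional inverse is G = X -
2X²/(1+X) - S. The differential equation F = X + XF + X²F' turns into one for G. For u_n = -[Xⁿ]G,
which is s_n + 2(-1)ⁿ for n ≥ 4, it reads u_n = n u_{n-1} + 2u_{n-2} + 2n u_{n-3} + (lower order).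
As u_n is of order n!, dividing by u_n gives n u_{n-1}/u_n = 1 - 4/n² + O(1/n³), and the factor n -
4 yields the expansion. -/

namespace SimplePoset

/-! ### Primitive structures and the Ehrenfeucht–Rozenberg theorem -/

section Structure

variable {V C : Type*}

/-- `I ⊆ X` is a module of `X` for the coloring `c` of pairs if no element of `X` outside `I`
distinguishes two elements of `I`. -/
def IsModule (c : V → V → C) (X I : Set V) : Prop :=
  I ⊆ X ∧ ∀ y ∈ X, y ∉ I → ∀ a ∈ I, ∀ b ∈ I, c y a = c y b

/-- `X` is primitive if it has only trivial modules. -/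
def IsPrimitive (c : V → V → C) (X : Set V) : Prop :=
  ∀ I, IsModule c X I → I.Subsingleton ∨ I = X

/-- `u` and `x` are not distinguished by the other elements of `X`. -/
def IsTwin (c : V → V → C) (X : Set V) (u x : V) : Prop :=
  ∀ y ∈ X, y ≠ x → c y u = c y x

/-- `u` does not distinguish elements of `X`. -/
def IsCorner (c : V → V → C) (X : Set V) (u : V) : Prop :=
  ∀ x ∈ X, ∀ y ∈ X, c u x = c u y

theorem IsModule.inter {c : V → V → C} {X Y I : Set V} (h : IsModule c Y I) (hXY : X ⊆ Y) :
    IsModule c X (I ∩ X) :=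
  ⟨Set.inter_subset_right, fun y hy hyI a ha b hb =>
    h.2 y (hXY hy) (fun hyI' => hyI ⟨hyI', hy⟩) a ha.1 b hb.1⟩

/-- A nontrivial module of `insert u X` meets `X` in a module of `X`. If the trace is at most a
point, the module is `u` with that point, its twin; if the trace is `X`, the module is `X` itself
and `u` is a corner. -/
theorem isTwin_or_isCorner_of_not_isPrimitive {c : V → V → C} {X : Set V} {u : V}
    (hX : IsPrimitive c X) (h : ¬ IsPrimitive c (insert u X)) :
    (∃ x ∈ X, IsTwin c X u x) ∨ IsCorner c X u := by
  simp only [IsPrimitive, not_forall, not_or] at h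
  obtain ⟨I, hI, hns, hne⟩ := h
  rcases hX _ (hI.inter (Set.subset_insert u X)) with hs | he
  · left
    rw [Set.not_subsingleton_iff] at hns
    have huI : u ∈ I := by
      by_contra huI
      have : I ⊆ X := fun z hz => (hI.1 hz).resolve_left (fun e => huI (e ▸ hz))
      rw [Set.inter_eq_left.mpr this] at hs
      exact (Set.not_subsingleton_iff.mpr hns) hs
    obtain ⟨x, hx, hxu⟩ := hns.exists_ne u
    have hxX : x ∈ X := (hI.1 hx).resolve_left hxu
    refine ⟨x, hxX, fun y hy hyx => hI.2 y (Set.mem_insert_of_mem u hy) (fun hyI => ?_) u huI x hx⟩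
    exact hyx (hs ⟨hyI, hy⟩ ⟨hx, hxX⟩)
  · right
    have hXI : X ⊆ I := Set.inter_eq_right.mp he
    have huI : u ∉ I := fun huI => hne (hI.1.antisymm (Set.insert_subset huI hXI))
    exact fun x hx y hy => hI.2 u (Set.mem_insert u X) huI x (hXI hx) y (hXI hy)

theorem not_isPrimitive_insert_of_isTwin {c : V → V → C} {X : Set V} {u x : V}
    (hX : ∀ a, ∃ z ∈ X, z ≠ a) (hu : u ∉ X) (hx : x ∈ X) (h : IsTwin c X u x) :
    ¬ IsPrimitive c (insert u X) := by
  intro hp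
  refine Or.elim (hp {u, x} ⟨?_, ?_⟩) (fun hs => ?_) (fun he => ?_)
  rotate_left 2
  · have := hs (Set.mem_insert u _) (Set.mem_insert_of_mem u rfl)
    exact hu (this ▸ hx)
  · obtain ⟨z, hz, hzx⟩ := hX x
    have : z ∈ ({u, x} : Set V) := he ▸ Set.mem_insert_of_mem u hz
    rcases this with rfl | rfl
    · exact hu hz
    · exact hzx rfl
  · rintro z (rfl | rfl)
    · exact Set.mem_insert _ _
    · exact Set.mem_insert_of_mem u hx
  · rintro y (rfl | hy) hy'
    · exact absurd (Set.mem_insert _ _) hy'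
    · have hyx : y ≠ x := fun e => hy' (Set.mem_insert_of_mem u e)
      have := h y hy hyx
      rintro a (rfl | rfl) b (rfl | rfl) <;> simp [this]

theorem not_isPrimitive_insert_of_isCorner {c : V → V → C} {X : Set V} {u : V}
    (hX : X.Nontrivial) (hu : u ∉ X) (h : IsCorner c X u) :
    ¬ IsPrimitive c (insert u X) := by
  intro hp
  refine Or.elim (hp X ⟨Set.subset_insert u X, ?_⟩) (fun hs => ?_) (fun he => ?_)
  rotate_left 1
  · exact (Set.not_subsingleton_iff.mpr hX) hs
  · exact hu (he ▸ Set.mem_insert u X)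
  · rintro y (rfl | hy) hy'
    · exact fun a ha b hb => h a ha b hb
    · exact absurd hy hy'

variable {c : V → V → C} {X : Set V}

/-- Two twins of `u` are seen alike by every other element of `X`, so they form a module; a third
element makes it proper. -/
theorem IsTwin.unique (hX : IsPrimitive c X) (h3 : ∀ a b, ∃ z ∈ X, z ≠ a ∧ z ≠ b) {u x x' : V}
    (hx : x ∈ X) (hx' : x' ∈ X) (h : IsTwin c X u x) (h' : IsTwin c X u x') : x = x' := by
  refine Or.elim (hX {x, x'} ⟨?_, ?_⟩) (fun hs => ?_) (fun he => ?_)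
  rotate_left 2
  · exact hs (Set.mem_insert _ _) (Set.mem_insert_of_mem _ rfl)
  · obtain ⟨z, hz, h1, h2⟩ := h3 x x'
    have : z ∈ ({x, x'} : Set V) := he ▸ hz
    rcases this with rfl | rfl
    · exact absurd rfl h1
    · exact absurd rfl h2
  · rintro z (rfl | rfl) <;> assumption
  · intro y hy hy'
    have h1 : y ≠ x := fun e => hy' (e ▸ Set.mem_insert _ _)
    have h2 : y ≠ x' := fun e => hy' (e ▸ Set.mem_insert_of_mem _ rfl)
    have e := (h y hy h1).symm.trans (h' y hy h2)
    rintro a (rfl | rfl) b (rfl | rfl) <;> simp [e]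

/-- The twin `x` sees the rest of `X` as `u` does, so if `u` were a corner then `X \ {x}` would be a
module. -/
theorem IsTwin.not_isCorner
    (hs : ∀ a b a' b', a ≠ b → a' ≠ b' → c a b = c a' b' → c b a = c b' a')
    (hX : IsPrimitive c X) (h3 : ∀ a b, ∃ z ∈ X, z ≠ a ∧ z ≠ b) {u x : V}
    (hu : u ∉ X) (hx : x ∈ X) (h : IsTwin c X u x) : ¬ IsCorner c X u := by
  intro hc
  have key : ∀ y ∈ X, y ≠ x → c u y = c x y := fun y hy hyx =>
    hs y u y x (fun e => hu (e ▸ hy)) hyx (h y hy hyx)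
  refine Or.elim (hX (X \ {x}) ⟨Set.sdiff_subset, ?_⟩) (fun hs' => ?_) (fun he => ?_)
  rotate_left 1
  · obtain ⟨z, hz, h1, -⟩ := h3 x x
    obtain ⟨w, hw, h2, h3⟩ := h3 x z
    exact h3 (hs' ⟨hw, h2⟩ ⟨hz, h1⟩)
  · have : x ∈ X \ {x} := by rwa [he]
    exact this.2 rfl
  · intro y hy hy' a ha b hb
    have : y = x := by
      by_contra e
      exact hy' ⟨hy, e⟩
    subst this
    rw [← key a ha.1 ha.2, ← key b hb.1 hb.2]
    exact hc a ha.1 b hb.1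

/-- A nontrivial module of `X ∪ {u, v}` contains `X` or meets it in at most a point. When it
contains `u` and `x` but not `v`, the equality is immediate. When it is `v` with some `y ∈ X`, the
equality follows by passing through `y`. The remaining cases contradict nontriviality, `hvx`, or the
fact that the twin `u` is not a corner. -/
theorem color_eq_of_isTwin
    (hs : ∀ a b a' b', a ≠ b → a' ≠ b' → c a b = c a' b' → c b a = c b' a')
    (hX : IsPrimitive c X) (h3 : ∀ a b, ∃ z ∈ X, z ≠ a ∧ z ≠ b) {u v x : V}
    (hu : u ∉ X) (hv : v ∉ X) (hx : x ∈ X) (h : IsTwin c X u x) (hvx : ¬ IsTwin c X v x)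
    (hp : ¬ IsPrimitive c (insert u (insert v X))) : c v u = c v x := by
  have huv : u ≠ v := fun e => hvx (e ▸ h)
  simp only [IsPrimitive, not_forall, not_or] at hp
  obtain ⟨I, hI, hns, hne⟩ := hp
  have hXs : X ⊆ insert u (insert v X) :=
    (Set.subset_insert v X).trans (Set.subset_insert u _)
  have hvY : v ∈ insert u (insert v X) := Set.mem_insert_of_mem u (Set.mem_insert v X)
  have huY : u ∈ insert u (insert v X) := Set.mem_insert u _
  rcases hX _ (hI.inter hXs) with hsub | he
  · have htw : ∀ y ∈ X, y ∈ I → ∀ w ∈ I, IsTwin c X w y := fun y hy hyI w hw z hz hzy =>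
      hI.2 z (hXs hz) (fun hzI => hzy (hsub ⟨hzI, hz⟩ ⟨hyI, hy⟩)) w hw y hyI
    by_cases hJ : ∃ y ∈ X, y ∈ I
    · obtain ⟨y, hy, hyI⟩ := hJ
      by_cases huI : u ∈ I
      · have hyx : y = x := IsTwin.unique hX h3 hy hx (htw y hy hyI u huI) h
        subst hyx
        by_cases hvI : v ∈ I
        · exact absurd (htw y hy hyI v hvI) hvx
        · exact hI.2 v hvY hvI u huI y hyI
      · by_cases hvI : v ∈ I
        · have htv := htw y hy hyI v hvI
          have hyx : y ≠ x := fun e => hvx (e ▸ htv)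
          have e1 := hs u v u y huv (fun e => hu (e ▸ hy)) (hI.2 u huY huI v hvI y hyI)
          have e2 := h y hy hyx
          have e3 := hs x v x y (fun e => hv (e ▸ hx)) hyx.symm (htv x hx hyx.symm)
          rw [e1, e2, e3]
        · exfalso
          apply hns
          intro a ha b hb
          have hm : ∀ a ∈ I, a ∈ X := fun a ha => by
            rcases hI.1 ha with rfl | rfl | h
            · exact absurd ha huI
            · exact absurd ha hvI
            · exact h
          exact hsub ⟨ha, hm a ha⟩ ⟨hb, hm b hb⟩
    · push Not at hJ
      have hm : ∀ a ∈ I, a = u ∨ a = v := fun a ha => by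
        rcases hI.1 ha with rfl | rfl | h
        · exact Or.inl rfl
        · exact Or.inr rfl
        · exact absurd ha (hJ a h)
      have huvI : u ∈ I ∧ v ∈ I := by
        rw [Set.not_subsingleton_iff] at hns
        obtain ⟨a, ha, b, hb, hab⟩ := hns
        rcases hm a ha with rfl | rfl <;> rcases hm b hb with rfl | rfl
        · exact absurd rfl hab
        · exact ⟨ha, hb⟩
        · exact ⟨hb, ha⟩
        · exact absurd rfl hab
      refine absurd (fun y hy hyx => ?_) hvx
      rw [← h y hy hyx]
      exact hI.2 y (hXs hy) (hJ y hy) v huvI.2 u huvI.1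
  · have hXI : X ⊆ I := Set.inter_eq_right.mp he
    by_cases huI : u ∈ I
    · have hvI : v ∉ I := fun hvI =>
        hne (hI.1.antisymm (Set.insert_subset huI (Set.insert_subset hvI hXI)))
      exact hI.2 v hvY hvI u huI x (hXI hx)
    · exact absurd (fun a ha b hb => hI.2 u huY huI a (hXI ha) b (hXI hb))
        (h.not_isCorner hs hX h3 hu hx)

/-- Ehrenfeucht–Rozenberg: a primitive proper substructure of a primitive structure extends by one
or two elements to a primitive substructure. -/
theorem exists_isPrimitive_insert
    (hs : ∀ a b a' b', a ≠ b → a' ≠ b' → c a b = c a' b' → c b a = c b' a')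
    (hV : IsPrimitive c Set.univ) (hX : IsPrimitive c X)
    (h3 : ∀ a b, ∃ z ∈ X, z ≠ a ∧ z ≠ b) (hne : X ≠ Set.univ) :
    ∃ u v, u ∉ X ∧ v ∉ X ∧ IsPrimitive c (insert u (insert v X)) := by
  by_contra hcon
  push Not at hcon
  have h1 : ∀ u ∉ X, (∃ x ∈ X, IsTwin c X u x) ∨ IsCorner c X u := fun u hu =>
    isTwin_or_isCorner_of_not_isPrimitive hX (by simpa using hcon u u hu hu)
  by_cases hT : ∃ u, u ∉ X ∧ ∃ x ∈ X, IsTwin c X u x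
  · obtain ⟨u, hu, x, hx, hux⟩ := hT
    -- If no extension is primitive, `x` together with all its outside twins is a module of the
    -- whole structure.
    refine Or.elim (hV (insert x {v | v ∉ X ∧ IsTwin c X v x}) ⟨Set.subset_univ _, ?_⟩)
      (fun h => ?_) (fun h => ?_)
    rotate_left 1
    · have := h (Set.mem_insert x _) (Set.mem_insert_of_mem x ⟨hu, hux⟩)
      exact hu (this ▸ hx)
    · obtain ⟨z, hz, hzx, -⟩ := h3 x x
      have : z ∈ insert x {v | v ∉ X ∧ IsTwin c X v x} := h ▸ Set.mem_univ z
      rcases this with rfl | h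
      · exact hzx rfl
      · exact h.1 hz
    · intro y _ hy
      have hyx : y ≠ x := fun e => hy (e ▸ Set.mem_insert _ _)
      have key : ∀ v ∈ insert x {v | v ∉ X ∧ IsTwin c X v x}, c y v = c y x := by
        rintro v (rfl | ⟨hv, hvx⟩)
        · rfl
        · by_cases hyX : y ∈ X
          · exact hvx y hyX hyx
          · exact color_eq_of_isTwin hs hX h3 hv hyX hx hvx
              (fun hh => hy (Set.mem_insert_of_mem x ⟨hyX, hh⟩)) (hcon v y hv hyX)
      intro a ha b hb
      rw [key a ha, key b hb]
  · push Not at hT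
    -- Without twins every outside element is a corner, so `X` itself is a proper nontrivial module.
    refine Or.elim (hV X ⟨Set.subset_univ _, ?_⟩) (fun h => ?_) (fun h => ?_)
    rotate_left 1
    · obtain ⟨v, -⟩ := Set.nonempty_compl.mpr hne
      obtain ⟨z, hz, -⟩ := h3 v v
      obtain ⟨w, hw, hwz, -⟩ := h3 z z
      exact hwz (h hw hz)
    · exact hne h
    · intro y _ hy a ha b hb
      rcases h1 y hy with ⟨x, hx, hyx⟩ | hc
      · exact absurd hyx (hT y hy x hx)
      · exact hc a ha b hb

theorem isPrimitive_range_iff {W : Type*} {f : W → V} (hf : Function.Injective f) :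
    IsPrimitive c (Set.range f) ↔ IsPrimitive (fun a b => c (f a) (f b)) Set.univ := by
  constructor
  · intro h I hI
    refine Or.elim (h (f '' I) ⟨Set.image_subset_range _ _, ?_⟩) (fun h => ?_) (fun h => ?_)
    rotate_left 1
    · exact Or.inl (fun a ha b hb => hf (h (Set.mem_image_of_mem f ha) (Set.mem_image_of_mem f hb)))
    · right
      rw [← Set.image_univ] at h
      exact hf.image_injective h
    · rintro _ ⟨y, rfl⟩ hy _ ⟨a, ha, rfl⟩ _ ⟨b, hb, rfl⟩
      exact hI.2 y trivial (fun hyI => hy ⟨y, hyI, rfl⟩) a ha b hb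
  · intro h I hI
    have hI' : f '' (f ⁻¹' I) = I := Set.image_preimage_eq_of_subset hI.1
    rcases h (f ⁻¹' I) ⟨Set.subset_univ _, fun y _ hy a ha b hb =>
      hI.2 (f y) ⟨y, rfl⟩ hy _ ha _ hb⟩ with h | h
    · left
      rw [← hI']
      exact h.image f
    · right
      rw [← hI', h, Set.image_univ]

end Structure

/-! ### Permutations as coloured structures, and patterns -/

/-- The relative position of `a` with respect to `y` in `σ`. -/
def color {n : ℕ} (σ : Equiv.Perm (Fin n)) (y a : Fin n) : Prop × Prop :=
  (a < y, σ a < σ y)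

theorem color_eq_iff {n m : ℕ} {σ : Equiv.Perm (Fin n)} {τ : Equiv.Perm (Fin m)}
    {y a : Fin n} {z b : Fin m} :
    color σ y a = color τ z b ↔ (a < y ↔ b < z) ∧ (σ a < σ y ↔ τ b < τ z) := by
  simp [color]

theorem color_symm {n : ℕ} (σ : Equiv.Perm (Fin n)) (a b a' b' : Fin n) (h : a ≠ b)
    (h' : a' ≠ b') (e : color σ a b = color σ a' b') : color σ b a = color σ b' a' := by
  rw [color_eq_iff] at e ⊢
  have h1 : σ a ≠ σ b := σ.injective.ne h
  have h2 : σ a' ≠ σ b' := σ.injective.ne h'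
  omega

theorem Icc_min_max_eq {n : ℕ} {I : Set (Fin n)} (hI : I.Nonempty)
    (hc : ∀ y, y ∉ I → ∀ a ∈ I, ∀ b ∈ I, (a < y ↔ b < y)) :
    ∃ i j, i ∈ I ∧ j ∈ I ∧ i ≤ j ∧ I = Set.Icc i j := by
  classical
  obtain ⟨i, hi, hi'⟩ := Set.exists_min_image I id I.toFinite hI
  obtain ⟨j, hj, hj'⟩ := Set.exists_max_image I id I.toFinite hI
  refine ⟨i, j, hi, hj, hi' j hj, Set.Subset.antisymm (fun x hx => ⟨hi' x hx, hj' x hx⟩) ?_⟩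
  rintro x ⟨h1, h2⟩
  by_contra hx
  have := hc x hx i hi j hj
  have h3 : i ≠ x := fun e => hx (e ▸ hi)
  have h4 : j ≠ x := fun e => hx (e ▸ hj)
  omega

/-- Modules of `color σ` are exactly intervals: a set not split by an outside position is a block of
positions, and one not split by an outside value has an interval of values. -/
theorem isSimple_iff {n : ℕ} (σ : Equiv.Perm (Fin n)) :
    IsSimple σ ↔ IsPrimitive (color σ) Set.univ := by
  constructor
  · intro h I hI
    by_cases hne : I.Nontrivial
    · right
      have hc := hI.2
      simp only [Set.mem_univ, color_eq_iff, true_implies] at hc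
      obtain ⟨i, j, hi, hj, hij, hIc⟩ := Icc_min_max_eq hne.nonempty
        (fun y hy a ha b hb => (hc y hy a ha b hb).1)
      obtain ⟨a, b, -, -, -, hab⟩ := Icc_min_max_eq (I := σ '' I) (hne.nonempty.image σ) (by
        rintro y hy _ ⟨a, ha, rfl⟩ _ ⟨b, hb, rfl⟩
        have := (hc (σ.symm y) (fun h => hy ⟨_, h, by simp⟩) a ha b hb).2
        simpa using this)
      rcases h i j hij ⟨a, b, by rw [← hIc, hab]⟩ with rfl | h
      · rw [Set.Icc_self] at hIc
        exact absurd hne (by simp [hIc])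
      · rw [hIc, h]
    · exact Or.inl (Set.not_nontrivial_iff.mp hne)
  · rintro h i j hij ⟨a, b, hab⟩
    refine Or.elim (h (Set.Icc i j) ⟨Set.subset_univ _, ?_⟩) (fun h => ?_) (fun h => ?_)
    rotate_left 1
    · exact Or.inl (h ⟨le_rfl, hij⟩ ⟨hij, le_rfl⟩)
    · exact Or.inr h
    · intro y _ hy x hx z hz
      have hm : ∀ w ∈ Set.Icc i j, σ w ∈ Set.Icc a b := fun w hw => hab ▸ ⟨w, hw, rfl⟩
      have hy' : σ y ∉ Set.Icc a b := by
        rw [← hab]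
        rintro ⟨w, hw, e⟩
        exact hy (σ.injective e ▸ hw)
      have h1 := hm x hx
      have h2 := hm z hz
      rw [color_eq_iff]
      simp only [Set.mem_Icc] at *
      constructor <;> omega

theorem isSimple_iff_of_pattern {k n : ℕ} {π : Equiv.Perm (Fin k)} {σ : Equiv.Perm (Fin n)}
    (f : Fin k ↪o Fin n) (hf : ∀ a b, π a < π b ↔ σ (f a) < σ (f b)) :
    IsSimple π ↔ IsPrimitive (color σ) (Set.range f) := by
  rw [isPrimitive_range_iff f.injective, isSimple_iff]
  have : color π = fun a b => color σ (f a) (f b) := by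
    funext a b
    rw [color_eq_iff]
    exact ⟨f.lt_iff_lt.symm, hf b a⟩
  rw [this]

/-- The standardization of an injective word. -/
theorem exists_perm_lt_iff {k : ℕ} {α : Type*} [LinearOrder α] {g : Fin k → α}
    (hg : Function.Injective g) : ∃ π : Equiv.Perm (Fin k), ∀ a b, π a < π b ↔ g a < g b := by
  refine ⟨(Tuple.sort g)⁻¹, fun a b => ?_⟩
  have hm : StrictMono (g ∘ Tuple.sort g) :=
    (Tuple.monotone_sort g).strictMono_of_injective (hg.comp (Tuple.sort g).injective)
  rw [← hm.lt_iff_lt]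
  simp

/-- `π' * π⁻¹` is strictly monotone, and `Fin k` has no order automorphism but the identity. -/
theorem perm_eq_of_lt_iff {k : ℕ} {π π' : Equiv.Perm (Fin k)}
    (h : ∀ a b, π a < π b ↔ π' a < π' b) : π = π' := by
  have hm : StrictMono (π' * π⁻¹ : Equiv.Perm (Fin k)) := fun a b hab => by
    simpa using (h (π⁻¹ a) (π⁻¹ b)).mp (by simpa using hab)
  have h1 : (π' * π⁻¹ : Equiv.Perm (Fin k)) = 1 := by
    ext x
    have := hm.monotone
    have := Subsingleton.elim (StrictMono.orderIsoOfSurjective _ hm (Equiv.surjective _))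
      (OrderIso.refl _)
    have := congrArg (fun e : Fin k ≃o Fin k => ((e x : Fin k) : ℕ)) this
    simpa using this
  exact (mul_inv_eq_one.mp h1).symm

theorem IsPattern.le {π σ : AnyPerm} (h : IsPattern π σ) : π.1 ≤ σ.1 := by
  obtain ⟨f, -⟩ := h
  simpa using Fintype.card_le_of_injective f f.injective

theorem IsPattern.eq_of_size {π σ : AnyPerm} (h : IsPattern π σ) (hs : π.1 = σ.1) : π = σ := by
  obtain ⟨n, π⟩ := π
  obtain ⟨m, σ⟩ := σ
  obtain rfl : n = m := hs
  obtain ⟨f, hf⟩ := h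
  have : f = RelEmbedding.refl _ := by
    ext x
    have hb := (Finite.injective_iff_bijective.mp f.injective).2
    have := Subsingleton.elim (StrictMono.orderIsoOfSurjective _ f.strictMono hb) (OrderIso.refl _)
    have := congrArg (fun e : Fin n ≃o Fin n => ((e x : Fin n) : ℕ)) this
    simpa using this
  subst this
  congr 1
  exact perm_eq_of_lt_iff (by simpa using hf)

theorem IsStrictPattern.lt {π σ : AnyPerm} (h : IsStrictPattern π σ) : π.1 < σ.1 :=
  lt_of_le_of_ne h.1.le fun e => h.2 (h.1.eq_of_size e)

theorem IsPattern.isStrictPattern {π σ : AnyPerm} (h : IsPattern π σ) (hs : π.1 < σ.1) :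
    IsStrictPattern π σ :=
  ⟨h, fun e => by rw [e] at hs; exact lt_irrefl _ hs⟩

theorem lt_iff_lt_of_adjacent {n : ℕ} {p q z : Fin n}
    (h : (p : ℕ) + 1 = q ∨ (q : ℕ) + 1 = p) (hp : z ≠ p) (hq : z ≠ q) : p < z ↔ q < z := by
  omega

theorem lt_iff_lt_of_between {n : ℕ} {a b c d : Fin n} (hc : ¬ (a < c ↔ b < c))
    (hd : a < d ↔ b < d) : a < d ↔ c < d := by
  omega

/-! ### Points separating a pair, a triple, or the complement of a point -/

section Separation

variable {n : ℕ} {σ : Equiv.Perm (Fin n)}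

theorem exists_separating (hσ : IsPrimitive (color σ) Set.univ) {I : Set (Fin n)}
    (h2 : I.Nontrivial) (hne : I ≠ Set.univ) :
    ∃ y ∉ I, ∃ a ∈ I, ∃ b ∈ I, ¬ ((a < y ↔ b < y) ∧ (σ a < σ y ↔ σ b < σ y)) := by
  by_contra hcon
  push Not at hcon
  rcases hσ I ⟨Set.subset_univ _, fun y _ hy a ha b hb =>
    color_eq_iff.mpr (hcon y hy a ha b hb)⟩ with h | h
  · exact (Set.not_subsingleton_iff.mpr h2) h
  · exact hne h

theorem ne_univ_of_ncard_lt {I : Set (Fin n)} (h : I.ncard < n) : I ≠ Set.univ := by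
  rintro rfl
  simp [Set.ncard_univ] at h

theorem exists_separating_pair (hσ : IsPrimitive (color σ) Set.univ) (hn : 3 ≤ n) {p x : Fin n}
    (hpx : p ≠ x) :
    ∃ y, y ≠ p ∧ y ≠ x ∧ ¬ ((p < y ↔ x < y) ∧ (σ p < σ y ↔ σ x < σ y)) := by
  obtain ⟨y, hy, a, ha, b, hb, h⟩ := exists_separating hσ (Set.nontrivial_pair hpx)
    (ne_univ_of_ncard_lt (by rw [Set.ncard_pair hpx]; omega))
  simp only [Set.mem_insert_iff, Set.mem_singleton_iff, not_or] at hy ha hb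
  refine ⟨y, hy.1, hy.2, ?_⟩
  rcases ha with rfl | rfl <;> rcases hb with rfl | rfl <;> tauto

theorem exists_separating_triple (hσ : IsPrimitive (color σ) Set.univ) (hn : 4 ≤ n)
    {p q x : Fin n} (hpx : p ≠ x) :
    ∃ y, y ≠ p ∧ y ≠ q ∧ y ≠ x ∧ ¬ (((p < y ↔ q < y) ∧ (σ p < σ y ↔ σ q < σ y)) ∧
      ((p < y ↔ x < y) ∧ (σ p < σ y ↔ σ x < σ y))) := by
  have h3 : ({p, q, x} : Set (Fin n)).ncard ≤ 3 := by
    refine (Set.ncard_insert_le _ _).trans ?_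
    have := Set.ncard_insert_le q {x}
    simp only [Set.ncard_singleton] at this
    omega
  obtain ⟨y, hy, a, ha, b, hb, h⟩ := exists_separating (I := {p, q, x}) hσ
    ⟨p, by simp, x, by simp, hpx⟩ (ne_univ_of_ncard_lt (by omega))
  simp only [Set.mem_insert_iff, Set.mem_singleton_iff, not_or] at hy ha hb
  refine ⟨y, hy.1, hy.2.1, hy.2.2, ?_⟩
  rcases ha with rfl | rfl | rfl <;> rcases hb with rfl | rfl | rfl <;> tauto

theorem exists_separated_by (hσ : IsPrimitive (color σ) Set.univ) (hn : 4 ≤ n) (p : Fin n) :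
    ∃ x y, x ≠ p ∧ y ≠ p ∧ ¬ ((x < p ↔ y < p) ∧ (σ x < σ p ↔ σ y < σ p)) := by
  have hnt : ({p}ᶜ : Set (Fin n)).Nontrivial := by
    rw [← Set.one_lt_ncard_iff_nontrivial, Set.ncard_compl, Set.ncard_singleton, Nat.card_fin]
    omega
  obtain ⟨y, hy, a, ha, b, hb, h⟩ := exists_separating hσ hnt (by simp)
  simp only [Set.mem_compl_iff, Set.mem_singleton_iff, not_not] at hy ha hb
  subst hy
  exact ⟨a, b, ha, hb, h⟩

end Separation

/-! ### Critical pairs: two-point deletions with no simple intermediate -/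

/-- `π` is the pattern of `σ` left after the removal of the points at `p` and `q`. -/
def IsResidual {k n : ℕ} (π : Equiv.Perm (Fin k)) (σ : Equiv.Perm (Fin n)) (p q : Fin n) : Prop :=
  p ≠ q ∧ ∃ f : Fin k ↪o Fin n, Set.range f = {p, q}ᶜ ∧ ∀ a b, π a < π b ↔ σ (f a) < σ (f b)

/-- `π` and `σ` are simple, and no deletion of a single point of `σ` that is removed along with
another one to obtain `π` leaves a simple permutation. -/
structure IsCriticalPair {k n : ℕ} (π : Equiv.Perm (Fin k)) (σ : Equiv.Perm (Fin n)) : Prop where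
  simple : IsPrimitive (color σ) Set.univ
  simple' : IsSimple π
  four_le : 4 ≤ k
  size : n = k + 2
  not_simple : ∀ p q, IsResidual π σ p q → ¬ IsPrimitive (color σ) {q}ᶜ

section Critical

variable {k n : ℕ} {π : Equiv.Perm (Fin k)} {σ : Equiv.Perm (Fin n)} {p q x : Fin n}

theorem IsResidual.symm (h : IsResidual π σ p q) : IsResidual π σ q p := by
  rwa [IsResidual, Set.pair_comm, ne_comm]

/-- A twin `x` of `p` can be removed in its place: wherever the embedding used `x`, let it use `p`.
-/
theorem IsResidual.replace (h : IsResidual π σ p q) (hxp : x ≠ p) (hxq : x ≠ q)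
    (ht : ∀ y, y ≠ p → y ≠ q → y ≠ x → (p < y ↔ x < y) ∧ (σ p < σ y ↔ σ x < σ y)) :
    IsResidual π σ x q := by
  classical
  obtain ⟨hpq, f, hf, hfπ⟩ := h
  have hr : ∀ a, f a ≠ p ∧ f a ≠ q := fun a => by
    have : f a ∈ ({p, q}ᶜ : Set (Fin n)) := hf ▸ ⟨a, rfl⟩
    simpa using this
  set g : Fin k → Fin n := fun a => if f a = x then p else f a with hg
  have key : ∀ a b, (g a < g b ↔ f a < f b) ∧ (σ (g a) < σ (g b) ↔ σ (f a) < σ (f b)) := by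
    intro a b
    simp only [hg]
    have ha := ht _ (hr a).1 (hr a).2
    have hb := ht _ (hr b).1 (hr b).2
    have ha' := hr a
    have hb' := hr b
    split_ifs with h1 h2 h2
    · rw [h1, h2]
      simp
    · rw [h1]
      exact hb h2
    · rw [h2]
      have h3 := ha h1
      have h4 := σ.injective.ne h1
      have h5 := σ.injective.ne ha'.1
      omega
    · simp
  refine ⟨hxq, OrderEmbedding.ofStrictMono g (fun a b hab => (key a b).1.mpr (f.strictMono hab)),
    ?_, fun a b => (hfπ a b).trans (key a b).2.symm⟩
  ext y
  have hfy : y ∈ Set.range f ↔ y ≠ p ∧ y ≠ q := by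
    rw [hf]
    simp
  simp only [Set.mem_range, Set.mem_compl_iff, Set.mem_insert_iff, Set.mem_singleton_iff, not_or]
  constructor
  · rintro ⟨a, rfl⟩
    change ¬ g a = x ∧ ¬ g a = q
    simp only [hg]
    split_ifs with h1
    · exact ⟨hxp.symm, hpq⟩
    · exact ⟨h1, (hr a).2⟩
  · rintro ⟨h1, h2⟩
    by_cases h3 : y = p
    · obtain ⟨a, ha⟩ : x ∈ Set.range f := by
        rw [hf]
        simp [hxp, hxq]
      exact ⟨a, by simp [hg, ha, h3]⟩
    · obtain ⟨a, ha⟩ := hfy.mpr ⟨h3, h2⟩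
      exact ⟨a, by simp [hg, ha, h1]⟩

/-- The points other than `p`, `q` form a primitive set, and by criticality adding `p` back destroys
primitivity. -/
theorem IsCriticalPair.isTwin_or_isCorner (hc : IsCriticalPair π σ) (h : IsResidual π σ p q) :
    (∃ x, x ≠ p ∧ x ≠ q ∧ IsResidual π σ x q ∧
      ∀ y, y ≠ p → y ≠ q → y ≠ x → (p < y ↔ x < y) ∧ (σ p < σ y ↔ σ x < σ y)) ∨
    (∀ x y, x ≠ p → x ≠ q → y ≠ p → y ≠ q → (x < p ↔ y < p) ∧ (σ x < σ p ↔ σ y < σ p)) := by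
  obtain ⟨hpq, f, hf, hfπ⟩ := id h
  have hX : IsPrimitive (color σ) {p, q}ᶜ := hf ▸ (isSimple_iff_of_pattern f hfπ).mp hc.simple'
  have hins : ({q}ᶜ : Set (Fin n)) = insert p {p, q}ᶜ := by
    ext y
    by_cases hy : y = p <;> simp [hy, hpq]
  have hns := hc.not_simple p q h
  rw [hins] at hns
  rcases isTwin_or_isCorner_of_not_isPrimitive hX hns with ⟨x, hx, ht⟩ | hcor
  · left
    simp only [Set.mem_compl_iff, Set.mem_insert_iff, Set.mem_singleton_iff, not_or] at hx
    have ht' : ∀ y, y ≠ p → y ≠ q → y ≠ x → (p < y ↔ x < y) ∧ (σ p < σ y ↔ σ x < σ y) :=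
      fun y h1 h2 h3 => color_eq_iff.mp (ht y (by simp [h1, h2]) h3)
    exact ⟨x, hx.1, hx.2, h.replace hx.1 hx.2 ht', ht'⟩
  · right
    exact fun x y h1 h2 h3 h4 => color_eq_iff.mp (hcor x (by simp [h1, h2]) y (by simp [h3, h4]))

/-- Otherwise some `y1` lies between `p` and `q` in position and some `y2` in value. If `p` has a
twin `x`, simplicity of `σ` makes `q` separate `p` from `x`, and then `y1` or `y2` separates them
too. If `p` is a corner away from `q`, then `q` is on the same side of `p` as `y1` in position and
as `y2` in value, so `p` is a corner of all of `σ`. -/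
theorem IsCriticalPair.adjacent (hc : IsCriticalPair π σ) (h : IsResidual π σ p q) :
    ((p : ℕ) + 1 = q ∨ (q : ℕ) + 1 = p) ∨ ((σ p : ℕ) + 1 = σ q ∨ (σ q : ℕ) + 1 = σ p) := by
  have hn : 4 ≤ n := by have := hc.size; have := hc.four_le; omega
  have hpq : p ≠ q := h.1
  have hσpq := σ.injective.ne hpq
  by_contra hcon
  push Not at hcon
  have h1 : ∃ y : Fin n, y ≠ p ∧ y ≠ q ∧ (p < y ↔ y < q) := by
    by_cases hlt : p < q
    · exact ⟨⟨p + 1, by omega⟩, by simp [Fin.ext_iff], by simp [Fin.ext_iff]; omega, by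
        simp only [Fin.lt_def]; omega⟩
    · exact ⟨⟨q + 1, by omega⟩, by simp [Fin.ext_iff]; omega, by simp [Fin.ext_iff], by
        simp only [Fin.lt_def]; omega⟩
  have h2 : ∃ y : Fin n, y ≠ p ∧ y ≠ q ∧ (σ p < σ y ↔ σ y < σ q) := by
    by_cases hlt : σ p < σ q
    · refine ⟨σ.symm ⟨σ p + 1, by omega⟩, ?_, ?_, ?_⟩
      · rw [Ne, Equiv.symm_apply_eq]; simp [Fin.ext_iff]
      · rw [Ne, Equiv.symm_apply_eq]; simp [Fin.ext_iff]; omega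
      · simp only [Equiv.apply_symm_apply, Fin.lt_def]; omega
    · refine ⟨σ.symm ⟨σ q + 1, by omega⟩, ?_, ?_, ?_⟩
      · rw [Ne, Equiv.symm_apply_eq]; simp [Fin.ext_iff]; omega
      · rw [Ne, Equiv.symm_apply_eq]; simp [Fin.ext_iff]
      · simp only [Equiv.apply_symm_apply, Fin.lt_def]; omega
  obtain ⟨y1, h1p, h1q, h1⟩ := h1
  obtain ⟨y2, h2p, h2q, h2⟩ := h2
  have e1 := σ.injective.ne h2p
  have e2 := σ.injective.ne h2q
  rcases hc.isTwin_or_isCorner h with ⟨x, hxp, hxq, -, ht⟩ | hcor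
  · have hσx := σ.injective.ne hxq
    have hσx' := σ.injective.ne hxp
    obtain ⟨y, hyp, hyx, hy⟩ := exists_separating_pair hc.simple (by omega) hxp.symm
    have hyq : y = q := by
      by_contra hyq
      exact hy (ht y hyp hyq hyx)
    subst hyq
    have t1 := ht y1 h1p h1q
    have t2 := ht y2 h2p h2q
    by_cases hh : (p < y ↔ x < y)
    · have : y2 ≠ x := by rintro rfl; omega
      have := t2 this
      omega
    · have : y1 ≠ x := by rintro rfl; omega
      have := t1 this
      omega
  · obtain ⟨a, b, hap, hbp, hab⟩ := exists_separated_by hc.simple hn p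
    by_cases haq : a = q
    · subst haq
      by_cases hbq : b = a
      · subst hbq; simp at hab
      · have t1 := hcor b y1 hbp hbq h1p h1q
        have t2 := hcor b y2 hbp hbq h2p h2q
        omega
    · by_cases hbq : b = q
      · subst hbq
        have t1 := hcor a y1 hap haq h1p h1q
        have t2 := hcor a y2 hap haq h2p h2q
        omega
      · exact hab (hcor a b hap haq hbp hbq)

/-- If two neighbouring positions `p`, `q` can be removed from `σ` to obtain `π`, then so can `q`
and its other neighbour, unless `q` is the first or the last position. -/
theorem IsCriticalPair.step (hc : IsCriticalPair π σ) (h : IsResidual π σ p q)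
    (hadj : (p : ℕ) + 1 = q ∨ (q : ℕ) + 1 = p) :
    (∃ x : Fin n, (x : ℕ) + p = 2 * q ∧ IsResidual π σ x q ∧
      ((σ p : ℕ) + 1 = σ x ∨ (σ x : ℕ) + 1 = σ p)) ∨
    (((q : ℕ) = 0 ∨ (q : ℕ) + 1 = n) ∧ ((σ p : ℕ) = 0 ∨ (σ p : ℕ) + 1 = n)) := by
  have hn : 4 ≤ n := by have := hc.size; have := hc.four_le; omega
  have hpq : p ≠ q := h.1
  rcases hc.isTwin_or_isCorner h with ⟨x, hxp, hxq, hres, ht⟩ | hcor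
  · left
    have hσx := σ.injective.ne hxq
    have hσx' := σ.injective.ne hxp
    have hσpq := σ.injective.ne hpq
    obtain ⟨y, hyp, hyx, hy⟩ := exists_separating_pair hc.simple (by omega) hxp.symm
    have hyq : y = q := by
      by_contra hyq
      exact hy (ht y hyp hyq hyx)
    subst hyq
    have hv : σ p < σ y ↔ σ x < σ y := by
      by_contra hv
      -- If `q` lay between `p` and `x` in value, then, being next to `p` in position, it would make
      -- `{p, q, x}` a proper module.
      obtain ⟨z, hzp, hzq, hzx, hz⟩ := exists_separating_triple (q := y) hc.simple hn hxp.symm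
      have htz := ht z hzp hzq hzx
      exact hz ⟨⟨lt_iff_lt_of_adjacent hadj hzp hzq, lt_iff_lt_of_between hv htz.2⟩, htz⟩
    have hh : ¬ (p < y ↔ x < y) := fun hh => hy ⟨hh, hv⟩
    -- So `q` separates `p` from `x` by position only. The neighbour of `q` away from `p`, if not
    -- `x`, and any point with value strictly between those of `p` and `x` would separate them as
    -- well, against the twin property.
    refine ⟨x, ?_, hres, ?_⟩
    · by_contra hne
      rcases hadj with hadj | hadj
      · have := ht ⟨y + 1, by omega⟩ (by simp [Fin.ext_iff]; omega) (by simp [Fin.ext_iff])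
          (by simp [Fin.ext_iff]; omega)
        simp only [Fin.lt_def] at this
        omega
      · have := ht ⟨y - 1, by omega⟩ (by simp [Fin.ext_iff]; omega)
          (by simp [Fin.ext_iff]; omega) (by simp [Fin.ext_iff]; omega)
        simp only [Fin.lt_def] at this
        omega
    · by_contra hne
      have hw : ∃ w : Fin n, w ≠ p ∧ w ≠ x ∧ (σ p < σ w ↔ σ w < σ x) := by
        by_cases hlt : σ p < σ x
        · refine ⟨σ.symm ⟨σ p + 1, by omega⟩, ?_, ?_, ?_⟩
          · rw [Ne, Equiv.symm_apply_eq]; simp [Fin.ext_iff]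
          · rw [Ne, Equiv.symm_apply_eq]; simp [Fin.ext_iff]; omega
          · simp only [Equiv.apply_symm_apply, Fin.lt_def]; omega
        · refine ⟨σ.symm ⟨σ x + 1, by omega⟩, ?_, ?_, ?_⟩
          · rw [Ne, Equiv.symm_apply_eq]; simp [Fin.ext_iff]; omega
          · rw [Ne, Equiv.symm_apply_eq]; simp [Fin.ext_iff]
          · simp only [Equiv.apply_symm_apply, Fin.lt_def]; omega
      obtain ⟨w, hwp, hwx, hw⟩ := hw
      have f1 := σ.injective.ne hwp
      have f2 := σ.injective.ne hwx
      have hwq : w ≠ y := by rintro rfl; omega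
      have := ht w hwp hwq hwx
      omega
  · right
    -- Here `p` sees all points but `q` alike. Some `y` lies between `p` and `q` in value, so all
    -- points are on one side of `p` in value, which makes `σ p` extreme. As `p` is no corner of
    -- `σ`, `q` is alone on its side of `p` in position, hence at an end.
    obtain ⟨y, hyp, hyq, hy⟩ := exists_separating_pair hc.simple (by omega) hpq
    have hσy := σ.injective.ne hyp
    have hσy' := σ.injective.ne hyq
    have hv : ¬ (σ p < σ y ↔ σ q < σ y) := by omega
    have hall : ∀ z, z ≠ p → (σ z < σ p ↔ σ y < σ p) := by
      intro z hz
      by_cases hzq : z = q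
      · subst hzq; omega
      · exact (hcor z y hz hzq hyp hyq).2
    constructor
    · obtain ⟨a, b, hap, hbp, hab⟩ := exists_separated_by hc.simple hn p
      have ha := hall a hap
      have hb := hall b hbp
      have hq : ¬ (q < p ↔ y < p) := by
        by_cases haq : a = q
        · subst haq
          by_cases hbq : b = a
          · subst hbq; simp at hab
          · have t1 := hcor b y hbp hbq hyp hyq
            omega
        · have t1 := hcor a y hap haq hyp hyq
          by_cases hbq : b = q
          · subst hbq
            omega
          · have t2 := hcor b y hbp hbq hyp hyq
            omega
      by_contra hne
      rcases hadj with hadj | hadj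
      · have := hcor ⟨q + 1, by omega⟩ y (by simp [Fin.ext_iff]; omega) (by simp [Fin.ext_iff])
          hyp hyq
        simp only [Fin.lt_def] at this
        omega
      · have := hcor ⟨q - 1, by omega⟩ y (by simp [Fin.ext_iff]; omega)
          (by simp [Fin.ext_iff]; omega) hyp hyq
        simp only [Fin.lt_def] at this
        omega
    · by_contra hne
      have h0 := hall (σ.symm ⟨0, by omega⟩)
        (by rw [Ne, Equiv.symm_apply_eq]; simp [Fin.ext_iff]; omega)
      have h1 := hall (σ.symm ⟨n - 1, by omega⟩)
        (by rw [Ne, Equiv.symm_apply_eq]; simp [Fin.ext_iff]; omega)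
      simp only [Equiv.apply_symm_apply, Fin.lt_def] at h0 h1
      omega

end Critical

/-! ### Words whose letters two places apart are consecutive -/

section Sequences

/-- Odd indices start at an extreme value and move by one without repetition, so they run
monotonically; even indices do the same, read backwards from `n - 2` at the opposite extreme. -/
theorem zigzag_of_steps {n : ℕ} {s : ℕ → ℕ} (hn : 6 ≤ n)
    (hstep : ∀ j, j + 2 < n → s j + 1 = s (j + 2) ∨ s (j + 2) + 1 = s j)
    (hinj : ∀ i j, i < n → j < n → s i = s j → i = j) (hlt : ∀ j, j < n → s j < n)
    (h1 : s 1 = 0 ∨ s 1 + 1 = n) (h2 : s (n - 2) = 0 ∨ s (n - 2) + 1 = n) :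
    ∃ m, n = 2 * m ∧ ((∀ j, j < n → s j + 1 = exceptionalWord₃ m (j + 1)) ∨
      (∀ j, j < n → s j + 1 = exceptionalWord₄ m (j + 1))) := by
  have hne : s 1 ≠ s (n - 2) := fun e => by
    have := hinj 1 (n - 2) (by omega) (by omega) e
    omega
  rcases h1 with h1 | h1
  · have hodd : ∀ i, 2 * i + 1 < n → s (2 * i + 1) = i := by
      intro i
      induction i using Nat.strong_induction_on with
      | _ i ih =>
        intro hi
        match i with
        | 0 => exact h1
        | 1 =>
          have := hstep 1 (by omega)
          simp only [Nat.reduceAdd, Nat.reduceMul] at *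
          omega
        | i + 2 =>
          have e1 := ih i (by omega) (by omega)
          have e2 := ih (i + 1) (by omega) (by omega)
          have e3 := hstep (2 * (i + 1) + 1) (by omega)
          rw [show 2 * (i + 1) + 1 + 2 = 2 * (i + 2) + 1 by ring] at e3
          have e4 : s (2 * (i + 2) + 1) ≠ s (2 * i + 1) := fun e => by
            have := hinj _ _ (by omega) (by omega) e
            omega
          omega
    -- For odd `n` the index `n - 2` is odd and carries the value `(n - 3) / 2`, which is not
    -- extreme.
    obtain ⟨m, rfl⟩ : ∃ m, n = 2 * m := by
      by_contra hcon
      have hn2 : n % 2 = 1 := by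
        by_contra h0
        exact hcon ⟨n / 2, by omega⟩
      have e := hodd ((n - 3) / 2) (by omega)
      rw [show 2 * ((n - 3) / 2) + 1 = n - 2 by omega] at e
      omega
    refine ⟨m, rfl, Or.inl ?_⟩
    have hev : ∀ i, i < m → s (2 * (m - 1 - i)) + i + 1 = 2 * m := by
      intro i
      induction i using Nat.strong_induction_on with
      | _ i ih =>
        intro hi
        match i with
        | 0 =>
          rw [show 2 * (m - 1 - 0) = 2 * m - 2 by omega]
          omega
        | 1 =>
          have e1 := ih 0 (by omega) (by omega)
          have e2 := hstep (2 * (m - 1 - 1)) (by omega)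
          rw [show 2 * (m - 1 - 1) + 2 = 2 * (m - 1 - 0) by omega] at e2
          have e3 := hlt (2 * (m - 1 - 1)) (by omega)
          omega
        | i + 2 =>
          have e1 := ih i (by omega) (by omega)
          have e2 := ih (i + 1) (by omega) (by omega)
          have e3 := hstep (2 * (m - 1 - (i + 2))) (by omega)
          rw [show 2 * (m - 1 - (i + 2)) + 2 = 2 * (m - 1 - (i + 1)) by omega] at e3
          have e4 : s (2 * (m - 1 - (i + 2))) ≠ s (2 * (m - 1 - i)) := fun e => by
            have := hinj _ _ (by omega) (by omega) e
            omega
          omega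
    intro j hj
    rcases Nat.even_or_odd' j with ⟨i, rfl | rfl⟩
    · have := hev (m - 1 - i) (by omega)
      rw [show 2 * (m - 1 - (m - 1 - i)) = 2 * i by omega] at this
      rw [exceptionalWord₃, if_pos (by omega)]
      omega
    · have := hodd i hj
      rw [exceptionalWord₃, if_neg (by omega)]
      omega
  · have hodd : ∀ i, 2 * i + 1 < n → s (2 * i + 1) + i + 1 = n := by
      intro i
      induction i using Nat.strong_induction_on with
      | _ i ih =>
        intro hi
        match i with
        | 0 => exact h1
        | 1 =>
          have := hstep 1 (by omega)
          have := hlt 3 (by omega)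
          simp only [Nat.reduceAdd, Nat.reduceMul] at *
          omega
        | i + 2 =>
          have e1 := ih i (by omega) (by omega)
          have e2 := ih (i + 1) (by omega) (by omega)
          have e3 := hstep (2 * (i + 1) + 1) (by omega)
          rw [show 2 * (i + 1) + 1 + 2 = 2 * (i + 2) + 1 by ring] at e3
          have e4 : s (2 * (i + 2) + 1) ≠ s (2 * i + 1) := fun e => by
            have := hinj _ _ (by omega) (by omega) e
            omega
          omega
    obtain ⟨m, rfl⟩ : ∃ m, n = 2 * m := by
      by_contra hcon
      have hn2 : n % 2 = 1 := by
        by_contra h0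
        exact hcon ⟨n / 2, by omega⟩
      have e := hodd ((n - 3) / 2) (by omega)
      rw [show 2 * ((n - 3) / 2) + 1 = n - 2 by omega] at e
      omega
    refine ⟨m, rfl, Or.inr ?_⟩
    have hev : ∀ i, i < m → s (2 * (m - 1 - i)) = i := by
      intro i
      induction i using Nat.strong_induction_on with
      | _ i ih =>
        intro hi
        match i with
        | 0 =>
          rw [show 2 * (m - 1 - 0) = 2 * m - 2 by omega]
          omega
        | 1 =>
          have e1 := ih 0 (by omega) (by omega)
          have e2 := hstep (2 * (m - 1 - 1)) (by omega)
          rw [show 2 * (m - 1 - 1) + 2 = 2 * (m - 1 - 0) by omega] at e2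
          omega
        | i + 2 =>
          have e1 := ih i (by omega) (by omega)
          have e2 := ih (i + 1) (by omega) (by omega)
          have e3 := hstep (2 * (m - 1 - (i + 2))) (by omega)
          rw [show 2 * (m - 1 - (i + 2)) + 2 = 2 * (m - 1 - (i + 1)) by omega] at e3
          have e4 : s (2 * (m - 1 - (i + 2))) ≠ s (2 * (m - 1 - i)) := fun e => by
            have := hinj _ _ (by omega) (by omega) e
            omega
          omega
    intro j hj
    rcases Nat.even_or_odd' j with ⟨i, rfl | rfl⟩
    · have := hev (m - 1 - i) (by omega)
      rw [show 2 * (m - 1 - (m - 1 - i)) = 2 * i by omega] at this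
      rw [exceptionalWord₄, if_pos (by omega)]
      omega
    · have := hodd i hj
      rw [exceptionalWord₄, if_neg (by omega)]
      omega

theorem perm_apply_eq_of_lt_iff {k : ℕ} {π : Equiv.Perm (Fin k)} {g : Fin k → ℕ}
    (hlt : ∀ a, g a < k) (h : ∀ a b, π a < π b ↔ g a < g b) (a : Fin k) : (π a : ℕ) = g a := by
  have hinj : Function.Injective fun a => (⟨g a, hlt a⟩ : Fin k) := fun a b e => by
    have e' : g a = g b := congrArg Fin.val e
    have h1 := h a b
    have h2 := h b a
    exact π.injective (by omega)
  have : π = Equiv.ofBijective _ (Finite.injective_iff_bijective.mp hinj) :=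
    perm_eq_of_lt_iff fun a b => by simpa using h a b
  rw [this]
  rfl

end Sequences

/-! ### Critical pairs of adjacent positions are exceptional -/

section Critical

variable {k n : ℕ} {π : Equiv.Perm (Fin k)} {σ : Equiv.Perm (Fin n)}

/-- `IsCriticalPair.step` slides the removable pair one place at a time in either direction, and can
only stop at an end of the word. -/
theorem IsCriticalPair.residual_succ (hc : IsCriticalPair π σ) {p q : Fin n}
    (h : IsResidual π σ p q) (hadj : (p : ℕ) + 1 = q) (j : ℕ) (hj : j + 1 < n) :
    IsResidual π σ ⟨j, by omega⟩ ⟨j + 1, hj⟩ := by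
  have hn : 4 ≤ n := by have := hc.size; have := hc.four_le; omega
  have hup : ∀ d : ℕ, (hd : p + d + 1 < n) → IsResidual π σ ⟨p + d, by omega⟩ ⟨p + d + 1, hd⟩ := by
    intro d
    induction d with
    | zero =>
      intro hd
      have : q = ⟨p + 0 + 1, hd⟩ := Fin.ext (by simp [← hadj])
      rw [← this]
      exact h
    | succ d ih =>
      intro hd
      rcases hc.step (ih (by omega)) (Or.inl rfl) with ⟨x, hx, hr, -⟩ | ⟨h0, -⟩
      · have : x = ⟨p + (d + 1) + 1, hd⟩ := Fin.ext (by simp only at hx ⊢; omega)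
        rw [← this]
        exact hr.symm
      · simp only at h0
        omega
  have hdown : ∀ d : ℕ, (hd : d ≤ p) → IsResidual π σ ⟨p - d, by omega⟩ ⟨p - d + 1, by omega⟩ := by
    intro d
    induction d with
    | zero =>
      intro hd
      exact hup 0 (by omega)
    | succ d ih =>
      intro hd
      rcases hc.step (ih (by omega)).symm (Or.inr rfl) with ⟨x, hx, hr, -⟩ | ⟨h0, -⟩
      · have h1 : x = ⟨p - (d + 1), by omega⟩ := Fin.ext (by simp only at hx ⊢; omega)
        have h2 : (⟨p - d, by omega⟩ : Fin n) = ⟨p - (d + 1) + 1, by omega⟩ :=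
          Fin.ext (by simp only; omega)
        rw [← h1, ← h2]
        exact hr
      · simp only at h0
        omega
  by_cases hjp : (p : ℕ) ≤ j
  · have := hup (j - p) (by omega)
    simpa only [show (p : ℕ) + (j - p) = j by omega] using this
  · have := hdown (p - j) (by omega)
    simpa only [show (p : ℕ) - (p - j) = j by omega] using this

/-- Sliding the pair also shows that letters two places apart are consecutive; at either end it
cannot slide on, which makes the letters at `1` and `n - 2` extreme. The zigzag lemma then
determines `σ`. -/
theorem IsCriticalPair.exceptional_of_adjacent (hc : IsCriticalPair π σ) {p q : Fin n}
    (h : IsResidual π σ p q) (hadj : (p : ℕ) + 1 = q) :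
    IsExceptional ⟨n, σ⟩ ∧ IsExceptional ⟨k, π⟩ := by
  have hk := hc.four_le
  have hsize := hc.size
  have hres := hc.residual_succ h hadj
  set s : ℕ → ℕ := fun j => if hj : j < n then σ ⟨j, hj⟩ else 0 with hs
  have hsv : ∀ j (hj : j < n), s j = σ ⟨j, hj⟩ := fun j hj => by simp [hs, hj]
  obtain ⟨m, hm, hw⟩ := zigzag_of_steps (n := n) (s := s) (by omega) (by
      intro j hj
      rw [hsv j (by omega), hsv (j + 2) hj]
      rcases hc.step (hres j (by omega)) (Or.inl rfl) with ⟨x, hx, -, hd⟩ | ⟨h0, -⟩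
      · have : x = ⟨j + 2, hj⟩ := Fin.ext (by simp only at hx ⊢; omega)
        rwa [this] at hd
      · simp only at h0
        omega) (by
      intro i j hi hj e
      rw [hsv i hi, hsv j hj] at e
      simpa using σ.injective (Fin.ext e)) (fun j hj => by
      rw [hsv j hj]
      exact (σ _).2) (by
      rw [hsv 1 (by omega)]
      rcases hc.step (hres 0 (by omega)).symm (Or.inr rfl) with ⟨x, hx, -⟩ | ⟨-, h0⟩
      · simp only at hx
        omega
      · exact h0) (by
      rw [hsv (n - 2) (by omega)]
      rcases hc.step (hres (n - 2) (by omega)) (Or.inl rfl) with ⟨x, hx, -⟩ | ⟨-, h0⟩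
      · simp only at hx
        omega
      · exact h0)
  -- Remove the first two positions, so that the embedding is `a ↦ a + 2`. Dropping the first two
  -- letters of a word of the third or fourth type leaves, after renormalization, the same type for
  -- `m - 1`.
  obtain ⟨-, f, hf, hfπ⟩ := hres 0 (by omega)
  have hfa : ∀ a, (f a : ℕ) = a + 2 := by
    intro a
    have h2 : ∀ a, 2 ≤ (f a : ℕ) := fun a => by
      have : f a ∈ Set.range f := ⟨a, rfl⟩
      rw [hf] at this
      simp only [Set.mem_compl_iff, Set.mem_insert_iff, Set.mem_singleton_iff, Fin.ext_iff] at this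
      omega
    have hg : StrictMono fun a : Fin k => (⟨f a - 2, by have := (f a).2; have := h2 a; omega⟩ :
        Fin k) := fun a b hab => by
      have := f.strictMono hab
      have := h2 a
      simp only [Fin.lt_def] at *
      omega
    have hb := (Finite.injective_iff_bijective.mp hg.injective).2
    have := Subsingleton.elim (StrictMono.orderIsoOfSurjective _ hg hb) (OrderIso.refl _)
    have := congrArg (fun e : Fin k ≃o Fin k => ((e a : Fin k) : ℕ)) this
    simp only [StrictMono.coe_orderIsoOfSurjective, OrderIso.refl_apply] at this
    have := h2 a
    omega
  have hσf : ∀ a : Fin k, (σ (f a) : ℕ) = s (a + 2) := fun a => by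
    rw [hsv (a + 2) (by omega)]
    congr 2
    exact Fin.ext (hfa a)
  have hπs : ∀ a b, π a < π b ↔ s (a + 2) < s (b + 2) := fun a b => by
    rw [hfπ, Fin.lt_def, hσf, hσf]
  rcases hw with hw | hw
  · refine ⟨⟨m, by omega, hm, Or.inr (Or.inr (Or.inl fun i => ?_))⟩,
      ⟨m - 1, by omega, by simp only; omega, Or.inr (Or.inr (Or.inl fun i => ?_))⟩⟩
    · rw [← hw i i.2, hsv i i.2]
    · have := perm_apply_eq_of_lt_iff (π := π)
        (g := fun a => exceptionalWord₃ (m - 1) (a + 1) - 1) (fun a => by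
          have := a.2
          simp only [exceptionalWord₃]
          split_ifs <;> omega) (fun a b => by
          have ha := hw (a + 2) (by omega)
          have hb := hw (b + 2) (by omega)
          rw [hπs]
          simp only [exceptionalWord₃] at *
          split_ifs at * <;> omega) i
      simp only at this ⊢
      rw [this]
      simp only [exceptionalWord₃]
      split_ifs <;> omega
  · refine ⟨⟨m, by omega, hm, Or.inr (Or.inr (Or.inr fun i => ?_))⟩,
      ⟨m - 1, by omega, by simp only; omega, Or.inr (Or.inr (Or.inr fun i => ?_))⟩⟩
    · rw [← hw i i.2, hsv i i.2]
    · have := perm_apply_eq_of_lt_iff (π := π)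
        (g := fun a => exceptionalWord₄ (m - 1) (a + 1) - 1) (fun a => by
          have := a.2
          simp only [exceptionalWord₄]
          split_ifs <;> omega) (fun a b => by
          have ha := hw (a + 2) (by omega)
          have hb := hw (b + 2) (by omega)
          have := a.2
          have := b.2
          rw [hπs]
          simp only [exceptionalWord₄] at *
          split_ifs at * <;> omega) i
      have hi : (i : ℕ) < k := i.2
      simp only at this ⊢
      rw [this]
      simp only [exceptionalWord₄]
      split_ifs <;> omega

end Critical

/-! ### Inversion exchanges positions and values -/

section Inverse

theorem isPattern_inv {k n : ℕ} {π : Equiv.Perm (Fin k)} {σ : Equiv.Perm (Fin n)}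
    (f : Fin k ↪o Fin n) (hf : ∀ a b, π a < π b ↔ σ (f a) < σ (f b)) :
    ∃ g : Fin k ↪o Fin n, (∀ v, g v = σ (f (π⁻¹ v))) ∧
      ∀ a b, π⁻¹ a < π⁻¹ b ↔ σ⁻¹ (g a) < σ⁻¹ (g b) := by
  refine ⟨OrderEmbedding.ofStrictMono (fun v => σ (f (π⁻¹ v))) (fun a b hab => ?_),
    fun v => rfl, fun a b => ?_⟩
  · rw [← hf]
    simpa using hab
  · simp

theorem color_inv {n : ℕ} (σ : Equiv.Perm (Fin n)) (a b : Fin n) :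
    color σ⁻¹ (σ a) (σ b) = (color σ a b).swap := by
  simp [color]

theorem isPrimitive_color_inv {n : ℕ} {σ : Equiv.Perm (Fin n)} {X : Set (Fin n)} :
    IsPrimitive (color σ⁻¹) (σ '' X) ↔ IsPrimitive (color σ) X := by
  constructor
  · intro h I hI
    rcases h (σ '' I) ⟨Set.image_mono hI.1, by
        rintro _ ⟨y, hy, rfl⟩ hyI _ ⟨a, ha, rfl⟩ _ ⟨b, hb, rfl⟩
        rw [color_inv, color_inv, hI.2 y hy (fun h => hyI ⟨y, h, rfl⟩) a ha b hb]⟩ with h | h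
    · exact Or.inl fun a ha b hb => σ.injective (h ⟨a, ha, rfl⟩ ⟨b, hb, rfl⟩)
    · exact Or.inr (σ.injective.image_injective h)
  · intro h I hI
    have hI' : σ '' (σ ⁻¹' I) = I := Set.image_preimage_eq I σ.surjective
    rcases h (σ ⁻¹' I) ⟨by rw [← Set.image_subset_image_iff σ.injective, hI']; exact hI.1, by
        intro y hy hyI a ha b hb
        have := hI.2 (σ y) ⟨y, hy, rfl⟩ hyI (σ a) ha (σ b) hb
        rw [color_inv, color_inv] at this
        exact Prod.swap_injective this⟩ with h | h
    · left
      rw [← hI']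
      exact h.image σ
    · right
      rw [← hI', h]

theorem isSimple_inv {n : ℕ} {σ : Equiv.Perm (Fin n)} : IsSimple σ⁻¹ ↔ IsSimple σ := by
  rw [isSimple_iff, isSimple_iff, ← isPrimitive_color_inv (σ := σ),
    Set.image_univ_of_surjective σ.surjective]

/-- Inversion exchanges the first type with the third and the second with the fourth. -/
theorem IsExceptional.inv {σ : AnyPerm} (h : IsExceptional σ) : IsExceptional ⟨σ.1, σ.2⁻¹⟩ := by
  obtain ⟨n, σ⟩ := σ
  obtain ⟨m, hm, hn, h⟩ := h
  simp only at hn h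
  have key : ∀ (w w' : ℕ → ℕ), (∀ i, 1 ≤ i → i ≤ 2 * m → 1 ≤ w i ∧ w i ≤ 2 * m ∧ w' (w i) = i) →
      (∀ i : Fin n, (σ i : ℕ) + 1 = w (i + 1)) → ∀ i : Fin n, (σ⁻¹ i : ℕ) + 1 = w' (i + 1) := by
    intro w w' hw h i
    have h1 := h (σ⁻¹ i)
    have h2 := hw (σ⁻¹ i + 1) (by omega) (by omega)
    rw [← h1, show σ (σ⁻¹ i) = i by simp] at h2
    exact h2.2.2.symm
  refine ⟨m, hm, hn, ?_⟩
  rcases h with h | h | h | h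
  · refine Or.inr (Or.inr (Or.inl (key _ _ (fun i h1 h2 => ?_) h)))
    simp only [exceptionalWord₁, exceptionalWord₃]
    split_ifs <;> omega
  · refine Or.inr (Or.inr (Or.inr (key _ _ (fun i h1 h2 => ?_) h)))
    simp only [exceptionalWord₂, exceptionalWord₄]
    split_ifs <;> omega
  · refine Or.inl (key _ _ (fun i h1 h2 => ?_) h)
    simp only [exceptionalWord₁, exceptionalWord₃]
    split_ifs <;> omega
  · refine Or.inr (Or.inl (key _ _ (fun i h1 h2 => ?_) h))
    simp only [exceptionalWord₂, exceptionalWord₄]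
    split_ifs <;> omega

theorem IsResidual.inv {k n : ℕ} {π : Equiv.Perm (Fin k)} {σ : Equiv.Perm (Fin n)} {p q : Fin n}
    (h : IsResidual π σ p q) : IsResidual π⁻¹ σ⁻¹ (σ p) (σ q) := by
  obtain ⟨hpq, f, hf, hfπ⟩ := h
  obtain ⟨g, hg, hgπ⟩ := isPattern_inv f hfπ
  refine ⟨σ.injective.ne hpq, g, ?_, hgπ⟩
  have : (g : Fin k → Fin n) = σ ∘ f ∘ (π⁻¹ : Equiv.Perm (Fin k)) := funext hg
  rw [this, Set.range_comp, Set.range_comp, Set.range_eq_univ.mpr (π⁻¹).surjective, Set.image_univ,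
    hf, Set.image_compl_eq σ.bijective, Set.image_pair]

theorem IsCriticalPair.inv {k n : ℕ} {π : Equiv.Perm (Fin k)} {σ : Equiv.Perm (Fin n)}
    (h : IsCriticalPair π σ) : IsCriticalPair π⁻¹ σ⁻¹ where
  simple := by
    rw [← isSimple_iff, isSimple_inv, isSimple_iff]
    exact h.simple
  simple' := isSimple_inv.mpr h.simple'
  four_le := h.four_le
  size := h.size
  not_simple := fun p q hpq hp => by
    have h1 := hpq.inv
    rw [inv_inv, inv_inv] at h1
    refine h.not_simple _ _ h1 ?_
    rw [← isPrimitive_color_inv, Set.image_compl_eq σ.bijective]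
    simpa using hp

/-- Adjacency in value becomes adjacency in position for the inverses. -/
theorem IsCriticalPair.exceptional {k n : ℕ} {π : Equiv.Perm (Fin k)} {σ : Equiv.Perm (Fin n)}
    (hc : IsCriticalPair π σ) {p q : Fin n} (h : IsResidual π σ p q) :
    IsExceptional ⟨n, σ⟩ ∧ IsExceptional ⟨k, π⟩ := by
  rcases hc.adjacent h with (h1 | h1) | h1
  · exact hc.exceptional_of_adjacent h h1
  · exact hc.exceptional_of_adjacent h.symm h1
  · have key : IsExceptional ⟨n, σ⁻¹⟩ ∧ IsExceptional ⟨k, π⁻¹⟩ := by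
      rcases h1 with h1 | h1
      · exact hc.inv.exceptional_of_adjacent h.inv h1
      · exact hc.inv.exceptional_of_adjacent h.inv.symm h1
    simpa using And.intro key.1.inv key.2.inv

end Inverse

/-! ### Edges that drop more than one point -/

section Between

variable {k n : ℕ} {π : Equiv.Perm (Fin k)} {σ : Equiv.Perm (Fin n)}

theorem exists_simple_between (f : Fin k ↪o Fin n) (hf : ∀ a b, π a < π b ↔ σ (f a) < σ (f b))
    {Y : Set (Fin n)} (hY : IsPrimitive (color σ) Y) (hfY : Set.range f ⊂ Y)
    (hne : Y ≠ Set.univ) :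
    ∃ τ : AnyPerm, IsSimple τ.2 ∧ IsStrictPattern ⟨k, π⟩ τ ∧ IsStrictPattern τ ⟨n, σ⟩ := by
  classical
  set g : Fin Y.toFinset.card ↪o Fin n := Y.toFinset.orderEmbOfFin rfl with hg
  have hgr : Set.range g = Y := by simp [hg]
  obtain ⟨τ, hτ⟩ := exists_perm_lt_iff (σ.injective.comp g.injective)
  have hl : ∀ a, ∃ b, g b = f a := fun a => by
    have : f a ∈ Set.range g := by
      rw [hgr]
      exact hfY.1 ⟨a, rfl⟩
    exact this
  choose h hh using hl
  have hk : k < Y.toFinset.card := by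
    have h1 : (Set.range f).ncard = k := by simp [Set.ncard_range_of_injective f.injective]
    rw [← Set.ncard_eq_toFinset_card', ← h1]
    exact Set.ncard_lt_ncard hfY
  have hn : Y.toFinset.card < n := by
    rw [← Set.ncard_eq_toFinset_card']
    have := Set.ncard_lt_ncard (Set.ssubset_univ_iff.mpr hne)
    simpa [Set.ncard_univ] using this
  refine ⟨⟨_, τ⟩, ?_, IsPattern.isStrictPattern ?_ hk, IsPattern.isStrictPattern ⟨g, hτ⟩ hn⟩
  · exact (isSimple_iff_of_pattern g hτ).mpr (by rwa [hgr])
  · refine ⟨OrderEmbedding.ofStrictMono h (fun a b hab => ?_), fun a b => ?_⟩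
    · rw [← g.lt_iff_lt, hh, hh]
      exact f.strictMono hab
    · change π a < π b ↔ τ (h a) < τ (h b)
      rw [hτ, hf]
      simp [hh]

/-- The primitive extension by one or two points cannot lie strictly between, so it is everything.
Hence exactly two points are missing, and any simple one-point deletion containing `π` is excluded
for the same reason. -/
theorem exceptional_of_no_simple_between (hσ : IsSimple σ) (hπ : IsSimple π) (hk : 4 ≤ k)
    (f : Fin k ↪o Fin n) (hf : ∀ a b, π a < π b ↔ σ (f a) < σ (f b)) (hkn : k + 1 < n)
    (hno : ¬ ∃ τ : AnyPerm, IsSimple τ.2 ∧ IsStrictPattern ⟨k, π⟩ τ ∧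
      IsStrictPattern τ ⟨n, σ⟩) :
    IsExceptional ⟨n, σ⟩ ∧ IsExceptional ⟨k, π⟩ := by
  have hV := (isSimple_iff σ).mp hσ
  have hX := (isSimple_iff_of_pattern f hf).mp hπ
  have hcard : (Set.range f).ncard = k := by simp [Set.ncard_range_of_injective f.injective]
  have h3 : ∀ a b, ∃ z ∈ Set.range f, z ≠ a ∧ z ≠ b := by
    intro a b
    by_contra hcon
    push Not at hcon
    have : Set.range f ⊆ {a, b} := fun z hz => by
      by_cases h : z = a
      · exact Or.inl h
      · exact Or.inr (hcon z hz h)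
    have := Set.ncard_le_ncard this
    have := Set.ncard_insert_le a {b}
    simp only [Set.ncard_singleton] at this
    omega
  obtain ⟨u, v, hu, hv, hp⟩ := exists_isPrimitive_insert (color_symm σ) hV hX h3 (by
    intro h
    rw [h, Set.ncard_univ, Nat.card_fin] at hcard
    omega)
  have huniv : insert u (insert v (Set.range f)) = Set.univ := by
    by_contra hne
    refine hno (exists_simple_between f hf hp ⟨?_, ?_⟩ hne)
    · exact (Set.subset_insert v _).trans (Set.subset_insert u _)
    · exact fun h => hu (h (Set.mem_insert u _))
  have huv : u ≠ v := by
    rintro rfl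
    have h1 := Set.ncard_insert_le u (Set.range f)
    rw [Set.insert_idem] at huniv
    rw [huniv, hcard, Set.ncard_univ, Nat.card_fin] at h1
    omega
  have hr : Set.range f = {u, v}ᶜ := by
    ext z
    simp only [Set.mem_compl_iff, Set.mem_insert_iff, Set.mem_singleton_iff, not_or]
    constructor
    · exact fun hz => ⟨fun e => hu (e ▸ hz), fun e => hv (e ▸ hz)⟩
    · rintro ⟨h1, h2⟩
      have : z ∈ insert u (insert v (Set.range f)) := huniv ▸ Set.mem_univ z
      rcases this with h | h | h
      · exact absurd h h1
      · exact absurd h h2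
      · exact h
  have hn : n = k + 2 := by
    have := Set.ncard_compl ({u, v} : Set (Fin n))
    rw [← hr, hcard, Set.ncard_pair huv, Nat.card_fin] at this
    omega
  have hc : IsCriticalPair π σ :=
    { simple := hV
      simple' := hπ
      four_le := hk
      size := hn
      not_simple := fun p q ⟨hpq, f', hr', hf'⟩ hp' => by
        refine hno (exists_simple_between f' hf' hp' ⟨?_, ?_⟩ ?_)
        · rw [hr']
          simp
        · intro h
          have : p ∈ Set.range f' := h (by simpa using hpq)
          rw [hr'] at this
          simp at this
        · simp }
  exact hc.exceptional ⟨huv, f, hr, hf⟩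

end Between

/-! ### Single-point deletions and the outdegree -/

theorem IsSimple.not_adjacent {n : ℕ} {σ : Equiv.Perm (Fin n)} (hσ : IsSimple σ) (hn : 3 ≤ n)
    {p q : Fin n} (hpq : (p : ℕ) + 1 = q) :
    ¬ ((σ p : ℕ) + 1 = σ q ∨ (σ q : ℕ) + 1 = σ p) := by
  intro h
  obtain ⟨y, hyp, hyq, hy⟩ := exists_separating_pair ((isSimple_iff σ).mp hσ) hn
    (p := p) (x := q) (by rintro rfl; omega)
  exact hy ⟨lt_iff_lt_of_adjacent (Or.inl hpq) hyp hyq,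
    lt_iff_lt_of_adjacent h (σ.injective.ne hyp) (σ.injective.ne hyq)⟩

theorem not_isSimple_three (σ : Equiv.Perm (Fin 3)) : ¬ IsSimple σ := by
  intro h
  have h1 := h.not_adjacent le_rfl (p := 0) (q := 1) rfl
  have h2 := h.not_adjacent le_rfl (p := 1) (q := 2) rfl
  have e1 := σ.injective.ne (show (0 : Fin 3) ≠ 1 by decide)
  have e2 := σ.injective.ne (show (0 : Fin 3) ≠ 2 by decide)
  have e3 := σ.injective.ne (show (1 : Fin 3) ≠ 2 by decide)
  omega

section Deletion

variable {n : ℕ} (σ : Equiv.Perm (Fin (n + 1))) (i : Fin (n + 1))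

theorem succAbove_deletePoint (x : Fin n) :
    (σ i).succAbove (deletePoint σ i x) = σ (i.succAbove x) := by
  have := congrArg Subtype.val ((finSuccAboveEquiv (σ i)).apply_symm_apply
    (σ.subtypeEquiv (p := fun x => x ≠ i) (q := fun y => y ≠ σ i)
      (fun _ => σ.injective.ne_iff.symm) (finSuccAboveEquiv i x)))
  rw [finSuccAboveEquiv_apply] at this
  exact this

theorem deletePoint_lt_iff (a b : Fin n) :
    deletePoint σ i a < deletePoint σ i b ↔ σ (i.succAbove a) < σ (i.succAbove b) := by
  rw [← succAbove_deletePoint, ← succAbove_deletePoint, Fin.succAbove_lt_succAbove_iff]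

theorem isPattern_deletePoint : IsPattern ⟨n, deletePoint σ i⟩ ⟨n + 1, σ⟩ :=
  ⟨Fin.succAboveOrderEmb i, deletePoint_lt_iff σ i⟩

theorem eq_deletePoint_of_isPattern {π : Equiv.Perm (Fin n)}
    (h : IsPattern ⟨n, π⟩ ⟨n + 1, σ⟩) : ∃ i, deletePoint σ i = π := by
  obtain ⟨f, hf⟩ := h
  change Fin n ↪o Fin (n + 1) at f
  have hcard : (Set.range f)ᶜ.ncard = 1 := by
    rw [Set.ncard_compl, Set.ncard_range_of_injective f.injective]
    simp
  obtain ⟨i, hi⟩ := Set.ncard_eq_one.mp hcard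
  refine ⟨i, perm_eq_of_lt_iff fun a b => ?_⟩
  have : (f : Fin n → Fin (n + 1)) = i.succAbove :=
    (StrictMono.range_inj f.strictMono (Fin.strictMono_succAbove i)).mp
      (by rw [Fin.range_succAbove, ← hi, compl_compl])
  rw [deletePoint_lt_iff, ← this]
  exact (hf a b).symm

variable {σ}

/-- If deleting `i < j` gives the same word, compare the letters at place `i`: they come from `σ (i
+ 1)` and `σ i`, each lowered by at most one. So two neighbouring letters are consecutive values,
which simplicity forbids. -/
theorem IsSimple.deletePoint_injective (hσ : IsSimple σ) (hn : 3 ≤ n + 1) :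
    Function.Injective (deletePoint σ) := by
  have key : ∀ i j : Fin (n + 1), i < j → deletePoint σ i ≠ deletePoint σ j := by
    intro i j hij e
    have hi : (i : ℕ) < n := by omega
    have h1 := succAbove_deletePoint σ i ⟨i, hi⟩
    have h2 := succAbove_deletePoint σ j ⟨i, hi⟩
    rw [← e] at h2
    have e1 : i.succAbove ⟨i, hi⟩ = ⟨i + 1, by omega⟩ := by
      rw [Fin.succAbove_of_le_castSucc _ _ (by simp)]
      rfl
    have e2 : j.succAbove ⟨i, hi⟩ = i := by
      rw [Fin.succAbove_of_castSucc_lt _ _ hij]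
      rfl
    rw [e1] at h1
    rw [e2] at h2
    have hs : ∀ (a : Fin (n + 1)) (b : Fin n),
        (a.succAbove b : ℕ) = b ∨ (a.succAbove b : ℕ) = b + 1 := fun a b => by
      rcases lt_or_ge b.castSucc a with h | h
      · simp [Fin.succAbove_of_castSucc_lt _ _ h]
      · simp [Fin.succAbove_of_le_castSucc _ _ h]
    have h3 := hs (σ i) (deletePoint σ i ⟨i, hi⟩)
    have h4 := hs (σ j) (deletePoint σ i ⟨i, hi⟩)
    rw [h1] at h3
    rw [h2] at h4
    have h5 : σ i ≠ σ ⟨i + 1, by omega⟩ := σ.injective.ne (by simp [Fin.ext_iff])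
    refine hσ.not_adjacent hn (p := i) (q := ⟨i + 1, by omega⟩) rfl ?_
    omega
  intro i j e
  rcases lt_trichotomy i j with h | h | h
  · exact absurd e (key i j h)
  · exact h
  · exact absurd e.symm (key j i h)

end Deletion

theorem size_eq_of_adj {σ π : Vertex} (h : graphG₁.Adj σ π) : σ.1.1 = π.1.1 + 1 := by
  obtain ⟨⟨n, σ⟩, hn, hσ⟩ := σ
  obtain ⟨⟨k, π⟩, hk, hπ⟩ := π
  obtain ⟨⟨hp, hno⟩, hex⟩ := h
  by_contra hne
  have hlt := hp.lt
  simp only at hlt hne hk hno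
  obtain ⟨⟨f, hf⟩, -⟩ := hp
  refine hex (exceptional_of_no_simple_between hσ hπ hk f hf (by omega) ?_)
  rintro ⟨τ, hτ, h1, h2⟩
  exact hno ⟨⟨τ, hk.trans h1.lt.le, hτ⟩, h1, h2⟩

theorem outdegree_eq_ncard (n : ℕ) (σ : Equiv.Perm (Fin (n + 1))) (hn : 4 ≤ n + 1)
    (hσ : IsSimple σ) :
    outdegree ⟨⟨n + 1, σ⟩, hn, hσ⟩ = Set.ncard {i | IsSimple (deletePoint σ i)} := by
  -- There are no simple permutations of size 3, so a simple deletion is always a vertex.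
  have h4 : ∀ i, IsSimple (deletePoint σ i) → 4 ≤ n := by
    intro i hi
    by_contra h
    obtain rfl : n = 3 := by omega
    exact not_isSimple_three _ hi
  symm
  refine Set.ncard_congr (fun i hi => ⟨⟨n, deletePoint σ i⟩, h4 i hi, hi⟩) ?_ ?_ ?_
  · intro i hi
    refine ⟨⟨(isPattern_deletePoint σ i).isStrictPattern (Nat.lt_succ_self n), ?_⟩, ?_⟩
    · rintro ⟨τ, h1, h2⟩
      have := h1.lt
      have := h2.lt
      simp only at *
      omega
    -- Exceptional sizes are even, so sizes differing by one cannot both be exceptional.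
    · rintro ⟨⟨m, -, hm, -⟩, ⟨m', -, hm', -⟩⟩
      simp only at hm hm'
      omega
  · intro i j hi hj e
    refine hσ.deletePoint_injective (by omega) ?_
    have := congrArg Subtype.val e
    simpa using this
  · rintro ⟨⟨k, π⟩, hk, hπ⟩ h
    obtain rfl : n = k := by
      have := size_eq_of_adj h
      simp only at this
      omega
    obtain ⟨i, rfl⟩ := eq_deletePoint_of_isPattern σ h.1.1.1
    exact ⟨i, hπ, rfl⟩

/-! ### Inserting a point into a simple permutation -/

section Insertion

variable {n : ℕ}

/-- Insert a new point with position `i` and value `v`. -/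
def insertPoint (i v : Fin (n + 1)) (τ : Equiv.Perm (Fin n)) : Equiv.Perm (Fin (n + 1)) :=
  (finSuccEquiv' i).trans (τ.optionCongr.trans (finSuccEquiv' v).symm)

theorem insertPoint_apply_self (i v : Fin (n + 1)) (τ : Equiv.Perm (Fin n)) :
    insertPoint i v τ i = v := by
  simp [insertPoint]

theorem insertPoint_apply_succAbove (i v : Fin (n + 1)) (τ : Equiv.Perm (Fin n)) (x : Fin n) :
    insertPoint i v τ (i.succAbove x) = v.succAbove (τ x) := by
  simp [insertPoint]

theorem deletePoint_insertPoint (i v : Fin (n + 1)) (τ : Equiv.Perm (Fin n)) :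
    deletePoint (insertPoint i v τ) i = τ :=
  perm_eq_of_lt_iff fun a b => by
    rw [deletePoint_lt_iff, insertPoint_apply_succAbove, insertPoint_apply_succAbove,
      Fin.succAbove_lt_succAbove_iff]

theorem insertPoint_deletePoint (σ : Equiv.Perm (Fin (n + 1))) (i : Fin (n + 1)) :
    insertPoint i (σ i) (deletePoint σ i) = σ := by
  ext x
  congr 1
  induction x using Fin.succAboveCases i with
  | x => exact insertPoint_apply_self _ _ _
  | p x => rw [insertPoint_apply_succAbove, succAbove_deletePoint]

/-- The index `i` names one of the `n + 1` gaps; the gaps bordering `x` are numbered `x` and `x +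
1`. -/
theorem forall_le_castSucc_iff {i : Fin (n + 1)} {x : Fin n} :
    (∀ y, y ≠ x → (i ≤ y.castSucc ↔ x < y)) ↔ ((i : ℕ) = x ∨ (i : ℕ) = x + 1) := by
  constructor
  · intro h
    by_contra hcon
    rcases lt_or_ge (i : ℕ) x with hlt | hge
    · have := h ⟨i, by omega⟩ (by simp [Fin.ext_iff]; omega)
      simp only [Fin.le_def, Fin.lt_def, Fin.val_castSucc] at this
      omega
    · have := h ⟨i - 1, by omega⟩ (by simp [Fin.ext_iff]; omega)
      simp only [Fin.le_def, Fin.lt_def, Fin.val_castSucc] at this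
      omega
  · intro h y hy
    simp only [Fin.le_def, Fin.lt_def, Fin.val_castSucc]
    omega

theorem forall_castSucc_lt_iff (hn : 0 < n) {i : Fin (n + 1)} :
    (∀ x y : Fin n, x.castSucc < i ↔ y.castSucc < i) ↔ ((i : ℕ) = 0 ∨ (i : ℕ) = n) := by
  constructor
  · intro h
    by_contra hcon
    have := h ⟨0, hn⟩ ⟨n - 1, by omega⟩
    simp only [Fin.lt_def, Fin.val_castSucc] at this
    omega
  · intro h x y
    simp only [Fin.lt_def, Fin.val_castSucc]
    omega

/-- Simplicity fails exactly when the new point is a twin of an old one, i.e. lies in a cell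
touching it, or is a corner. -/
theorem not_isSimple_insertPoint_iff {τ : Equiv.Perm (Fin n)} (hτ : IsSimple τ) (hn : 4 ≤ n)
    (i v : Fin (n + 1)) :
    ¬ IsSimple (insertPoint i v τ) ↔
      (∃ x : Fin n, ((i : ℕ) = x ∨ (i : ℕ) = x + 1) ∧ ((v : ℕ) = τ x ∨ (v : ℕ) = τ x + 1)) ∨
      (((i : ℕ) = 0 ∨ (i : ℕ) = n) ∧ ((v : ℕ) = 0 ∨ (v : ℕ) = n)) := by
  set σ := insertPoint i v τ with hσ
  have hself : σ i = v := insertPoint_apply_self i v τ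
  have hsucc : ∀ x, σ (i.succAbove x) = v.succAbove (τ x) := insertPoint_apply_succAbove i v τ
  have hX : IsPrimitive (color σ) (Set.range i.succAbove) := by
    refine (isSimple_iff_of_pattern (Fin.succAboveOrderEmb i) (fun a b => ?_)).mp hτ
    simp [hsucc]
  have huniv : (Set.univ : Set (Fin (n + 1))) = insert i (Set.range i.succAbove) := by
    rw [Fin.range_succAbove]
    ext x
    by_cases h : x = i <;> simp [h]
  have hi : i ∉ Set.range i.succAbove := by simp
  have h2 : ∀ a, ∃ z ∈ Set.range i.succAbove, z ≠ a := by
    intro a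
    by_contra hcon
    push Not at hcon
    have h0 := hcon _ ⟨⟨0, by omega⟩, rfl⟩
    have h1 := hcon _ ⟨⟨1, by omega⟩, rfl⟩
    have := Fin.succAbove_right_injective (h0.trans h1.symm)
    simp at this
  have hnt : (Set.range i.succAbove).Nontrivial := by
    obtain ⟨a, ha, -⟩ := h2 i
    obtain ⟨b, hb, hba⟩ := h2 a
    exact ⟨b, hb, a, ha, hba⟩
  have htw : ∀ x, IsTwin (color σ) (Set.range i.succAbove) i (i.succAbove x) ↔
      ((i : ℕ) = x ∨ (i : ℕ) = x + 1) ∧ ((v : ℕ) = τ x ∨ (v : ℕ) = τ x + 1) := by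
    intro x
    rw [← forall_le_castSucc_iff, ← forall_le_castSucc_iff, IsTwin, Set.forall_mem_range]
    constructor
    · intro h
      constructor
      · intro y hy
        have := (color_eq_iff.mp (h y (fun e => hy (Fin.succAbove_right_injective e)))).1
        rwa [Fin.lt_succAbove_iff_le_castSucc, Fin.succAbove_lt_succAbove_iff] at this
      · intro y hy
        have := (color_eq_iff.mp (h (τ.symm y) (fun e => hy (by
          rw [← Fin.succAbove_right_injective e, Equiv.apply_symm_apply])))).2
        rwa [hself, hsucc, hsucc, Fin.lt_succAbove_iff_le_castSucc,
          Fin.succAbove_lt_succAbove_iff, Equiv.apply_symm_apply] at this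
    · rintro ⟨h, h'⟩ y hy
      have hyx : y ≠ x := fun e => hy (by rw [e])
      rw [color_eq_iff, hself, hsucc, hsucc, Fin.lt_succAbove_iff_le_castSucc,
        Fin.succAbove_lt_succAbove_iff, Fin.lt_succAbove_iff_le_castSucc,
        Fin.succAbove_lt_succAbove_iff]
      exact ⟨h y hyx, h' (τ y) (τ.injective.ne hyx)⟩
  have hco : IsCorner (color σ) (Set.range i.succAbove) i ↔
      (((i : ℕ) = 0 ∨ (i : ℕ) = n) ∧ ((v : ℕ) = 0 ∨ (v : ℕ) = n)) := by
    rw [← forall_castSucc_lt_iff (by omega), ← forall_castSucc_lt_iff (by omega), IsCorner,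
      Set.forall_mem_range]
    simp only [Set.forall_mem_range, color_eq_iff, hself, hsucc,
      Fin.succAbove_lt_iff_castSucc_lt]
    constructor
    · intro h
      exact ⟨fun x y => (h x y).1, fun x y => by simpa using (h (τ.symm x) (τ.symm y)).2⟩
    · rintro ⟨h, h'⟩ x y
      exact ⟨h x y, h' _ _⟩
  rw [isSimple_iff, huniv, ← hco]
  simp only [← htw]
  constructor
  · intro h
    rcases isTwin_or_isCorner_of_not_isPrimitive hX h with ⟨_, ⟨x, rfl⟩, hx⟩ | h
    · exact Or.inl ⟨x, hx⟩
    · exact Or.inr h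
  · rintro (⟨x, hx⟩ | h)
    · exact not_isPrimitive_insert_of_isTwin h2 hi ⟨x, rfl⟩ hx
    · exact not_isPrimitive_insert_of_isCorner hnt hi h

/-- The cells around the points of `τ`, and the corner cells. -/
def badCell (τ : Equiv.Perm (Fin n)) :
    (Fin n × Bool × Bool) ⊕ (Bool × Bool) → Fin (n + 1) × Fin (n + 1)
  | Sum.inl (x, a, b) => (if a then x.succ else x.castSucc, if b then (τ x).succ else (τ x).castSucc)
  | Sum.inr (a, b) => (if a then Fin.last n else 0, if b then Fin.last n else 0)

/-- Points sharing a cell differ by at most one in position and value, so they coincide or form an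
interval. A point touching a corner cell is extreme in both, so its complement would be an interval.
-/
theorem badCell_injective {τ : Equiv.Perm (Fin n)} (hτ : IsSimple τ) (hn : 4 ≤ n) :
    Function.Injective (badCell τ) := by
  have hcor : ∀ x : Fin n, ((x : ℕ) = 0 ∨ (x : ℕ) + 1 = n) →
      ((τ x : ℕ) = 0 ∨ (τ x : ℕ) + 1 = n) → False := by
    intro x h1 h2
    obtain ⟨a, b, ha, hb, h⟩ := exists_separated_by ((isSimple_iff τ).mp hτ) hn x
    have := τ.injective.ne ha
    have := τ.injective.ne hb
    apply h
    simp only [Fin.lt_def]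
    omega
  have key : ∀ x x' : Fin n, (x : ℕ) + 1 = x' →
      ((τ x : ℕ) + 1 = τ x' ∨ (τ x' : ℕ) + 1 = τ x) → False := fun x x' h h' =>
    hτ.not_adjacent (by omega) h h'
  have key' : ∀ x x' : Fin n, ((x : ℕ) + 1 = x' ∨ (x' : ℕ) + 1 = x ∨ x = x') →
      ((τ x : ℕ) + 1 = τ x' ∨ (τ x' : ℕ) + 1 = τ x ∨ τ x = τ x') → x = x' := by
    rintro x x' (h | h | h) (h' | h' | h')
    · exact (key x x' h (Or.inl h')).elim
    · exact (key x x' h (Or.inr h')).elim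
    · exact τ.injective h'
    · exact (key x' x h (Or.inr h')).elim
    · exact (key x' x h (Or.inl h')).elim
    · exact τ.injective h'
    · exact h
    · exact h
    · exact h
  rintro (⟨x, a, b⟩ | ⟨a, b⟩) (⟨x', a', b'⟩ | ⟨a', b'⟩) h
  · simp only [badCell, Prod.mk.injEq, Fin.ext_iff] at h
    have hx : x = x' := by
      refine key' x x' ?_ ?_
      · have := h.1
        split_ifs at this <;> simp only [Fin.val_succ, Fin.val_castSucc] at this <;> omega
      · have := h.2
        split_ifs at this <;> simp only [Fin.val_succ, Fin.val_castSucc] at this <;> omega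
    subst hx
    cases a <;> cases a' <;> cases b <;> cases b' <;> simp at h ⊢
  · simp only [badCell, Prod.mk.injEq, Fin.ext_iff] at h
    refine (hcor x ?_ ?_).elim
    · have := h.1
      split_ifs at this <;> simp at this <;> omega
    · have := h.2
      split_ifs at this <;> simp at this <;> omega
  · simp only [badCell, Prod.mk.injEq, Fin.ext_iff] at h
    refine (hcor x' ?_ ?_).elim
    · have := h.1
      split_ifs at this <;> simp at this <;> omega
    · have := h.2
      split_ifs at this <;> simp at this <;> omega
  · simp only [badCell, Prod.mk.injEq, Fin.ext_iff] at h
    cases a <;> cases a' <;> cases b <;> cases b' <;> simp at h ⊢ <;> omega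

theorem not_isSimple_insertPoint_iff_mem_range {τ : Equiv.Perm (Fin n)} (hτ : IsSimple τ)
    (hn : 4 ≤ n) (p : Fin (n + 1) × Fin (n + 1)) :
    ¬ IsSimple (insertPoint p.1 p.2 τ) ↔ p ∈ Set.range (badCell τ) := by
  obtain ⟨i, v⟩ := p
  rw [not_isSimple_insertPoint_iff hτ hn]
  constructor
  · rintro (⟨x, h1, h2⟩ | ⟨h1, h2⟩)
    · rcases h1 with h1 | h1 <;> rcases h2 with h2 | h2
      · exact ⟨Sum.inl (x, false, false), by
          simpa [badCell, Fin.ext_iff] using ⟨h1.symm, h2.symm⟩⟩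
      · exact ⟨Sum.inl (x, false, true), by
          simpa [badCell, Fin.ext_iff] using ⟨h1.symm, h2.symm⟩⟩
      · exact ⟨Sum.inl (x, true, false), by
          simpa [badCell, Fin.ext_iff] using ⟨h1.symm, h2.symm⟩⟩
      · exact ⟨Sum.inl (x, true, true), by
          simpa [badCell, Fin.ext_iff] using ⟨h1.symm, h2.symm⟩⟩
    · rcases h1 with h1 | h1 <;> rcases h2 with h2 | h2
      · exact ⟨Sum.inr (false, false), by
          simpa [badCell, Fin.ext_iff] using ⟨h1.symm, h2.symm⟩⟩
      · exact ⟨Sum.inr (false, true), by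
          simpa [badCell, Fin.ext_iff] using ⟨h1.symm, h2.symm⟩⟩
      · exact ⟨Sum.inr (true, false), by
          simpa [badCell, Fin.ext_iff] using ⟨h1.symm, h2.symm⟩⟩
      · exact ⟨Sum.inr (true, true), by
          simpa [badCell, Fin.ext_iff] using ⟨h1.symm, h2.symm⟩⟩
  · rintro ⟨⟨x, a, b⟩ | ⟨a, b⟩, h⟩
    · left
      refine ⟨x, ?_⟩
      simp only [badCell, Prod.mk.injEq] at h
      rw [← h.1, ← h.2]
      cases a <;> cases b <;> simp
    · right
      simp only [badCell, Prod.mk.injEq] at h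
      rw [← h.1, ← h.2]
      cases a <;> cases b <;> simp

theorem ncard_isSimple_insertPoint {τ : Equiv.Perm (Fin n)} (hτ : IsSimple τ) (hn : 4 ≤ n) :
    {p : Fin (n + 1) × Fin (n + 1) | IsSimple (insertPoint p.1 p.2 τ)}.ncard =
      (n + 1) * (n - 3) := by
  have h1 : {p : Fin (n + 1) × Fin (n + 1) | IsSimple (insertPoint p.1 p.2 τ)} =
      (Set.range (badCell τ))ᶜ := by
    ext p
    rw [Set.mem_compl_iff, ← not_isSimple_insertPoint_iff_mem_range hτ hn, not_not]
    rfl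
  rw [h1, Set.ncard_compl, Set.ncard_range_of_injective (badCell_injective hτ hn)]
  simp only [Nat.card_eq_fintype_card, Fintype.card_prod, Fintype.card_fin, Fintype.card_sum,
    Fintype.card_bool]
  obtain ⟨m, rfl⟩ := Nat.exists_eq_add_of_le' hn
  rw [show m + 4 - 3 = m + 1 by omega]
  apply Nat.sub_eq_of_eq_add
  ring

end Insertion

/-! ### Double counting of deletions and insertions -/

/-- The number of simple permutations of size `n`. -/
noncomputable def simpleCount (n : ℕ) : ℕ :=
  {σ : Equiv.Perm (Fin n) | IsSimple σ}.ncard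

-- Both sides count pairs: `(σ, i)` corresponds to `deletePoint σ i` with the cell `(i, σ i)`.
open scoped Classical in
theorem sum_ncard_isSimple_deletePoint {n : ℕ} (hn : 4 ≤ n) :
    ∑ σ : {σ : Equiv.Perm (Fin (n + 1)) // IsSimple σ},
      {i | IsSimple (deletePoint σ.1 i)}.ncard = simpleCount n * ((n + 1) * (n - 3)) := by
  have h1 : ∑ σ : {σ : Equiv.Perm (Fin (n + 1)) // IsSimple σ},
      {i | IsSimple (deletePoint σ.1 i)}.ncard =
      Fintype.card (Σ σ : {σ : Equiv.Perm (Fin (n + 1)) // IsSimple σ},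
        {i // IsSimple (deletePoint σ.1 i)}) := by
    rw [Fintype.card_sigma]
    refine Finset.sum_congr rfl fun σ _ => ?_
    rw [← Nat.card_eq_fintype_card]
    rfl
  have h2 : simpleCount n * ((n + 1) * (n - 3)) =
      Fintype.card (Σ τ : {τ : Equiv.Perm (Fin n) // IsSimple τ},
        {p : Fin (n + 1) × Fin (n + 1) // IsSimple (insertPoint p.1 p.2 τ.1)}) := by
    rw [Fintype.card_sigma]
    rw [Finset.sum_congr rfl fun τ _ => (?_ : _ = (n + 1) * (n - 3))]
    · rw [Finset.sum_const, smul_eq_mul, Finset.card_univ, ← Nat.card_eq_fintype_card]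
      rfl
    · rw [← Nat.card_eq_fintype_card]
      exact ncard_isSimple_insertPoint τ.2 hn
  rw [h1, h2]
  refine Fintype.card_congr
    { toFun := fun x => ⟨⟨deletePoint x.1.1 x.2.1, x.2.2⟩, ⟨(x.2.1, x.1.1 x.2.1), by
        simpa only [insertPoint_deletePoint] using x.1.2⟩⟩
      invFun := fun y => ⟨⟨insertPoint y.2.1.1 y.2.1.2 y.1.1, y.2.2⟩, ⟨y.2.1.1, by
        simpa only [deletePoint_insertPoint] using y.1.2⟩⟩
      left_inv := ?_
      right_inv := ?_ }
  · rintro ⟨⟨σ, hσ⟩, ⟨i, hi⟩⟩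
    refine Sigma.ext (Subtype.ext (insertPoint_deletePoint σ i)) ?_
    simp only
    rw! [insertPoint_deletePoint]
    rfl
  · rintro ⟨⟨τ, hτ⟩, ⟨⟨i, v⟩, hp⟩⟩
    refine Sigma.ext (Subtype.ext (deletePoint_insertPoint i v τ)) ?_
    simp only
    rw! [deletePoint_insertPoint, insertPoint_apply_self]
    rfl

theorem averageOutdegree_succ {n : ℕ} (hn : 4 ≤ n) :
    averageOutdegree (n + 1) =
      ((n : ℝ) + 1) * ((n : ℝ) - 3) * simpleCount n / simpleCount (n + 1) := by
  classical
  let e : {σ : Equiv.Perm (Fin (n + 1)) // IsSimple σ} → Vertex :=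
    fun σ => ⟨⟨n + 1, σ.1⟩, by simp only; omega, σ.2⟩
  have he : Function.Injective e := fun σ τ h => by
    have := congrArg Subtype.val h
    simpa [e, Subtype.ext_iff] using this
  have hb : Set.BijOn e Set.univ (verticesOfSize (n + 1)) := by
    refine ⟨fun σ _ => rfl, he.injOn, ?_⟩
    rintro ⟨⟨m, σ⟩, h4, hσ⟩ (hm : m = n + 1)
    subst hm
    exact ⟨⟨σ, hσ⟩, trivial, rfl⟩
  have hcard : (verticesOfSize (n + 1)).ncard = simpleCount (n + 1) := by
    rw [← hb.image_eq, Set.image_univ, Set.ncard_range_of_injective he]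
    rfl
  have hsum : ∑ᶠ σ ∈ verticesOfSize (n + 1), (outdegree σ : ℝ) =
      (simpleCount n * ((n + 1) * (n - 3)) : ℕ) := by
    rw [← finsum_mem_eq_of_bijOn e hb (f := fun σ =>
      ({i | IsSimple (deletePoint σ.1 i)}.ncard : ℝ)) (fun σ _ => by
        rw [outdegree_eq_ncard n σ.1 (by omega) σ.2]), finsum_mem_univ,
      finsum_eq_sum_of_fintype, ← sum_ncard_isSimple_deletePoint hn]
    push_cast
    rfl
  rw [averageOutdegree, hsum, hcard]
  push_cast [Nat.cast_sub (show 3 ≤ n by omega)]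
  ring

/-! ### Inflations of simple permutations -/

open scoped Nat

/-- `σ` is obtained from `τ` by replacing each point by a block; `b` maps a position of `σ` to the
point of `τ` whose block contains it. -/
structure IsInflation {n k : ℕ} (b : Fin n → Fin k) (τ : Equiv.Perm (Fin k))
    (σ : Equiv.Perm (Fin n)) : Prop where
  monotone : Monotone b
  surjective : Function.Surjective b
  lt_iff : ∀ x y, b x ≠ b y → (σ x < σ y ↔ τ (b x) < τ (b y))

section Inflation

variable {n k : ℕ} {b : Fin n → Fin k} {τ : Equiv.Perm (Fin k)} {σ : Equiv.Perm (Fin n)}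

theorem IsInflation.color_eq (h : IsInflation b τ σ) {x y : Fin n} (hxy : b x ≠ b y) :
    color σ x y = color τ (b x) (b y) := by
  rw [color_eq_iff]
  refine ⟨?_, h.lt_iff y x hxy.symm⟩
  constructor
  · exact fun hlt => lt_of_le_of_ne (h.monotone hlt.le) hxy.symm
  · intro hlt
    by_contra hle
    exact absurd (h.monotone (not_lt.mp hle)) (not_le.mpr hlt)

/-- The image of a module under `b` is a module of `τ`. If the image is everything, an element `e`
outside `I` would make `b e` a point separating nothing in `τ`, against simplicity. -/
theorem IsInflation.constant_or_eq_univ (h : IsInflation b τ σ) (hτ : IsSimple τ) (hk : 4 ≤ k)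
    {I : Set (Fin n)} (hI : IsModule (color σ) Set.univ I) :
    (∀ x ∈ I, ∀ y ∈ I, b x = b y) ∨ I = Set.univ := by
  have hτ' := (isSimple_iff τ).mp hτ
  rcases hτ' (b '' I) ⟨Set.subset_univ _, by
      intro z _ hz
      obtain ⟨y, rfl⟩ := h.surjective z
      rintro _ ⟨x, hx, rfl⟩ _ ⟨x', hx', rfl⟩
      have h1 : b y ≠ b x := fun e => hz ⟨x, hx, e.symm⟩
      have h2 : b y ≠ b x' := fun e => hz ⟨x', hx', e.symm⟩
      rw [← h.color_eq h1, ← h.color_eq h2]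
      exact hI.2 y trivial (fun hy => hz ⟨y, hy, rfl⟩) x hx x' hx'⟩ with hs | hu
  · exact Or.inl fun x hx y hy => hs ⟨x, hx, rfl⟩ ⟨y, hy, rfl⟩
  · right
    rw [Set.eq_univ_iff_forall]
    by_contra hcon
    push Not at hcon
    obtain ⟨e, he⟩ := hcon
    obtain ⟨u, v, hu', hv', hs⟩ := exists_separated_by hτ' hk (b e)
    obtain ⟨x, hx, rfl⟩ : u ∈ b '' I := hu ▸ Set.mem_univ u
    obtain ⟨y, hy, rfl⟩ : v ∈ b '' I := hu ▸ Set.mem_univ v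
    apply hs
    rw [← color_eq_iff, ← h.color_eq hu'.symm, ← h.color_eq hv'.symm]
    exact hI.2 e trivial he x hx y hy

theorem IsInflation.isModule_fiber (h : IsInflation b τ σ) (i : Fin k) :
    IsModule (color σ) Set.univ {x | b x = i} := by
  refine ⟨Set.subset_univ _, fun y _ hy x hx z hz => ?_⟩
  simp only [Set.mem_ofPred_eq] at hy hx hz
  rw [h.color_eq (by rw [hx]; exact hy), h.color_eq (by rw [hz]; exact hy), hx, hz]

theorem IsInflation.eq_of_eq {k' : ℕ} {b' : Fin n → Fin k'} {τ' : Equiv.Perm (Fin k')}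
    (h : IsInflation b τ σ) (h' : IsInflation b' τ' σ) (hτ : IsSimple τ) (hk : 4 ≤ k)
    (hk' : 2 ≤ k') {x y : Fin n} (hxy : b' x = b' y) : b x = b y := by
  rcases h.constant_or_eq_univ hτ hk (h'.isModule_fiber (b' x)) with hc | hu
  · exact hc x rfl y hxy.symm
  · exfalso
    have h1 : ∀ i, i = b' x := fun i => by
      obtain ⟨z, rfl⟩ := h'.surjective i
      have : z ∈ {z | b' z = b' x} := hu ▸ Set.mem_univ z
      exact this
    have := (h1 ⟨0, by omega⟩).trans (h1 ⟨1, by omega⟩).symm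
    simp at this

/-- The fibres of each block map are modules, hence lie inside fibres of the other. The induced map
of quotients is a monotone bijection, so the identity. -/
theorem IsInflation.unique {k' : ℕ} {b' : Fin n → Fin k'} {τ' : Equiv.Perm (Fin k')}
    (h : IsInflation b τ σ) (h' : IsInflation b' τ' σ) (hτ : IsSimple τ) (hτ' : IsSimple τ')
    (hk : 4 ≤ k) (hk' : 4 ≤ k') : k = k' ∧ HEq b b' ∧ HEq τ τ' := by
  choose s hs using h.surjective
  set g : Fin k → Fin k' := fun i => b' (s i) with hg
  have hgb : ∀ x, g (b x) = b' x := fun x =>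
    h'.eq_of_eq h hτ' hk' (by omega) (hs (b x))
  have hinj : Function.Injective g := fun i j e => by
    have := h.eq_of_eq h' hτ hk (by omega) e
    rwa [hs, hs] at this
  have hsurj : Function.Surjective g := fun j => by
    obtain ⟨x, rfl⟩ := h'.surjective j
    exact ⟨b x, hgb x⟩
  obtain rfl : k = k' := by
    simpa using Fintype.card_of_bijective ⟨hinj, hsurj⟩
  have hmono : StrictMono g := by
    refine Monotone.strictMono_of_injective (fun i j hij => ?_) hinj
    rcases hij.eq_or_lt with rfl | hlt
    · exact le_rfl
    · refine h'.monotone (le_of_lt ?_)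
      by_contra hle
      have := h.monotone (not_lt.mp hle)
      rw [hs, hs] at this
      exact absurd this (not_le.mpr hlt)
  have hid : ∀ i, g i = i := fun i => by
    have := Subsingleton.elim (StrictMono.orderIsoOfSurjective _ hmono hsurj) (OrderIso.refl _)
    exact congrArg (fun e : Fin k ≃o Fin k => e i) this
  obtain rfl : b = b' := funext fun x => by rw [← hgb x, hid]
  refine ⟨rfl, HEq.rfl, heq_of_eq (perm_eq_of_lt_iff fun i j => ?_)⟩
  by_cases hij : i = j
  · simp [hij]
  · obtain ⟨x, rfl⟩ := h.surjective i
    obtain ⟨y, rfl⟩ := h.surjective j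
    rw [← h.lt_iff x y hij, ← h'.lt_iff x y hij]

/-- Collapse the interval `[i, j]` to a point. -/
theorem exists_collapse {i j : Fin k} (hij : i < j) (hne : Set.Icc i j ≠ Set.univ) :
    ∃ (k' : ℕ) (q : Fin k → Fin k'), 2 ≤ k' ∧ k' < k ∧ Monotone q ∧ Function.Surjective q ∧
      ∀ x y, q x = q y ↔ x = y ∨ (x ∈ Set.Icc i j ∧ y ∈ Set.Icc i j) := by
  have h2 : 2 ≤ k - (j - i : ℕ) := by
    obtain ⟨z, hz⟩ := (Set.ne_univ_iff_exists_notMem _).mp hne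
    simp only [Set.mem_Icc, Fin.le_def, not_and_or] at hz
    omega
  refine ⟨k - (j - i), fun x => ⟨if (x : ℕ) ≤ i then x else if (x : ℕ) ≤ j then i else x - (j - i),
    by split_ifs <;> omega⟩, h2, by omega, ?_, ?_, ?_⟩
  · intro x y hxy
    simp only [Fin.le_def] at *
    split_ifs <;> omega
  · intro z
    by_cases hz : (z : ℕ) ≤ i
    · exact ⟨⟨z, by omega⟩, by simp [hz]⟩
    · refine ⟨⟨z + (j - i), by omega⟩, ?_⟩
      simp only [Fin.ext_iff]
      split_ifs <;> omega
  · intro x y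
    simp only [Fin.ext_iff, Set.mem_Icc, Fin.le_def]
    split_ifs <;> omega

/-- Collapse a nontrivial interval of `τ`. Iterating from the trivial inflation of `σ` by itself
ends at a simple quotient. -/
theorem IsInflation.exists_smaller (h : IsInflation b τ σ) (hτ : ¬ IsSimple τ) :
    ∃ (k' : ℕ) (b' : Fin n → Fin k') (τ' : Equiv.Perm (Fin k')), 2 ≤ k' ∧ k' < k ∧
      IsInflation b' τ' σ := by
  rw [isSimple_iff] at hτ
  simp only [IsPrimitive, not_forall, not_or] at hτ
  obtain ⟨I, hI, hns, hne⟩ := hτ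
  have hI2 : ∀ y, y ∉ I → ∀ a ∈ I, ∀ c ∈ I, (a < y ↔ c < y) ∧ (τ a < τ y ↔ τ c < τ y) :=
    fun y hy a ha c hc => color_eq_iff.mp (hI.2 y trivial hy a ha c hc)
  rw [Set.not_subsingleton_iff] at hns
  obtain ⟨i, j, -, -, hij, rfl⟩ := Icc_min_max_eq hns.nonempty
    (fun y hy a ha c hc => (hI2 y hy a ha c hc).1)
  have hlt : i < j := lt_of_le_of_ne hij fun e => by
    rw [e, Set.Icc_self] at hns
    exact Set.not_nontrivial_singleton hns
  obtain ⟨k', q, h2, hlt', hqm, hqs, hq⟩ := exists_collapse hlt hne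
  choose r hr using hqs
  have hrinj : Function.Injective r := fun x y e => by rw [← hr x, ← hr y, e]
  obtain ⟨τ', hτ'⟩ := exists_perm_lt_iff (τ.injective.comp hrinj)
  refine ⟨k', q ∘ b, τ', h2, hlt', hqm.comp h.monotone,
    (fun z => by obtain ⟨x, hx⟩ := h.surjective (r z); exact ⟨x, by simp [hx, hr]⟩), ?_⟩
  intro x y hxy
  have hxy' : q (b x) ≠ q (b y) := hxy
  rw [h.lt_iff x y (fun e => hxy' (congrArg q e)), hτ']
  simp only [Function.comp_apply]
  have key : ∀ z w, q z ≠ q w → (τ z < τ w ↔ τ (r (q z)) < τ w) := by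
    intro z w hzw
    rcases (hq z (r (q z))).mp (hr _).symm with e | ⟨h1, h3⟩
    · rw [← e]
    · refine (hI2 w (fun hw => hzw ?_) _ h1 _ h3).2
      exact (hq z w).mpr (Or.inr ⟨h1, hw⟩)
  have h1 := key (b x) (b y) hxy'
  have h2 := key (b y) (r (q (b x))) (by rw [hr]; exact hxy'.symm)
  rw [h1]
  have n1 : τ (r (q (b x))) ≠ τ (b y) := τ.injective.ne fun e => hxy' (by rw [← e, hr])
  have n2 : τ (r (q (b x))) ≠ τ (r (q (b y))) := τ.injective.ne fun e => hxy' (hrinj e)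
  omega

theorem exists_isInflation_isSimple (hn : 2 ≤ n) (σ : Equiv.Perm (Fin n)) :
    ∃ (k : ℕ) (b : Fin n → Fin k) (τ : Equiv.Perm (Fin k)), 2 ≤ k ∧ IsSimple τ ∧
      IsInflation b τ σ := by
  have key : ∀ k, 2 ≤ k → ∀ (b : Fin n → Fin k) (τ : Equiv.Perm (Fin k)), IsInflation b τ σ →
      ∃ (k : ℕ) (b : Fin n → Fin k) (τ : Equiv.Perm (Fin k)), 2 ≤ k ∧ IsSimple τ ∧
        IsInflation b τ σ := by
    intro k
    induction k using Nat.strong_induction_on with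
    | _ k ih =>
      intro hk b τ h
      by_cases hτ : IsSimple τ
      · exact ⟨k, b, τ, hk, hτ, h⟩
      · obtain ⟨k', b', τ', h2, hlt, h'⟩ := h.exists_smaller hτ
        exact ih k' hlt h2 b' τ' h'
  exact key n hn id σ ⟨monotone_id, Function.surjective_id, fun x y _ => Iff.rfl⟩

theorem isInflation_iff (hb : Monotone b) (hs : Function.Surjective b) :
    IsInflation b τ σ ↔ Monotone ((τ ∘ b) ∘ (σ⁻¹ : Equiv.Perm (Fin n))) := by
  constructor
  · intro h x y hxy
    by_contra hlt
    rw [not_le] at hlt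
    simp only [Function.comp_apply] at hlt
    have := (h.lt_iff (σ⁻¹ y) (σ⁻¹ x) (fun e => by rw [e] at hlt; exact lt_irrefl _ hlt)).mpr hlt
    simp only [Equiv.Perm.coe_inv, Equiv.apply_symm_apply] at this
    exact absurd hxy (not_le.mpr this)
  · intro h
    refine ⟨hb, hs, fun x y hxy => ?_⟩
    have h1 := @h (σ x) (σ y)
    have h2 := @h (σ y) (σ x)
    simp only [Function.comp_apply, Equiv.Perm.coe_inv, Equiv.symm_apply_apply] at h1 h2
    have := τ.injective.ne hxy
    constructor
    · exact fun hlt => lt_of_le_of_ne (h1 hlt.le) this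
    · intro hlt
      by_contra hle
      exact absurd (h2 (not_lt.mp hle)) (not_le.mpr hlt)

/-- The admissible `σ⁻¹` are those sorting the labels `τ ∘ b`; they form a coset of the stabilizer
of that labelling. -/
theorem card_isInflation (hb : Monotone b) (hs : Function.Surjective b) (τ : Equiv.Perm (Fin k)) :
    Nat.card {σ : Equiv.Perm (Fin n) // IsInflation b τ σ} =
      ∏ i, (Fintype.card {x // b x = i})! := by
  classical
  rw [← DomMulAct.stabilizer_card, ← Nat.card_eq_fintype_card]
  set ρ := Tuple.sort (τ ∘ b) with hρ
  refine Nat.card_congr (((Equiv.inv _).trans (Equiv.mulRight ρ⁻¹)).subtypeEquiv fun σ => ?_)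
  rw [isInflation_iff hb hs, ← Tuple.comp_sort_eq_comp_iff_monotone, ← hρ]
  constructor
  · intro h
    funext x
    have := congrFun h (ρ⁻¹ x)
    simpa using this
  · intro h
    funext x
    have := congrFun h (ρ x)
    simpa using this

end Inflation

/-! ### Block maps as compositions of `n` -/

section Compositions

variable {n k : ℕ}

theorem eq_of_card_fiber_eq {b b' : Fin n → Fin k} (hb : Monotone b) (hb' : Monotone b')
    (h : ∀ i, Fintype.card {x // b x = i} = Fintype.card {x // b' x = i}) : b = b' := by
  have e : ∀ i, {x // b x = i} ≃ {x // b' x = i} := fun i => Fintype.equivOfCardEq (h i)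
  set g : Equiv.Perm (Fin n) := Equiv.ofFiberEquiv e with hg
  have hbg : b' ∘ g = b := funext fun x => Equiv.ofFiberEquiv_map e x
  have := Tuple.unique_monotone (f := b') (σ := g) (τ := Equiv.refl _) (by rwa [hbg]) hb'
  rw [hbg] at this
  exact this

theorem exists_monotone_card_fiber {l : Fin k → ℕ} (hl : ∑ i, l i = n) :
    ∃ b : Fin n → Fin k, Monotone b ∧ ∀ i, Fintype.card {x // b x = i} = l i := by
  have e : Fin n ≃ Σ i, Fin (l i) := Fintype.equivOfCardEq (by simp [hl])
  refine ⟨(fun x => (e x).1) ∘ Tuple.sort (fun x => (e x).1), Tuple.monotone_sort _, fun i => ?_⟩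
  have e1 : {x // ((fun x => (e x).1) ∘ Tuple.sort (fun x => (e x).1)) x = i} ≃
      {y : Σ i, Fin (l i) // y.1 = i} :=
    ((Tuple.sort (fun x => (e x).1)).trans e).subtypeEquiv fun x => Iff.rfl
  rw [Fintype.card_congr (e1.trans (Equiv.sigmaSubtype i)), Fintype.card_fin]

/-- The generating function of the nonempty permutations. -/
noncomputable def permSeries : PowerSeries ℚ :=
  PowerSeries.mk fun n => if n = 0 then 0 else (n ! : ℚ)

-- A monotone map is determined by its fibre sizes, so monotone surjections are compositions of `n`
-- into `k` positive parts.
open scoped Classical in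
theorem sum_prod_factorial_eq_coeff (n k : ℕ) :
    ∑ b : {b : Fin n → Fin k // Monotone b ∧ Function.Surjective b},
      ∏ i, ((Fintype.card {x // b.1 x = i})! : ℚ) = PowerSeries.coeff n (permSeries ^ k) := by
  have h1 : permSeries ^ k = ∏ _i : Fin k, permSeries := by simp
  rw [h1, PowerSeries.coeff_prod]
  have h2 : ∑ b : {b : Fin n → Fin k // Monotone b ∧ Function.Surjective b},
      ∏ i, ((Fintype.card {x // b.1 x = i})! : ℚ) =
      ∑ b ∈ Finset.univ.filter fun b : Fin n → Fin k => Monotone b ∧ Function.Surjective b,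
        ∏ i, PowerSeries.coeff (Fintype.card {x // b x = i}) permSeries := by
    rw [Finset.sum_subtype (p := fun b : Fin n → Fin k => Monotone b ∧ Function.Surjective b) _
      (by simp)]
    refine Finset.sum_congr rfl fun b _ => Finset.prod_congr rfl fun i _ => ?_
    obtain ⟨x, hx⟩ := b.2.2 i
    have : Fintype.card {x // b.1 x = i} ≠ 0 :=
      (Fintype.card_pos_iff.mpr ⟨⟨x, hx⟩⟩).ne'
    simp [permSeries, this]
  -- A non-surjective map has an empty fibre, whose factor is the constant coefficient `0`.
  have h3 : ∑ b ∈ Finset.univ.filter fun b : Fin n → Fin k => Monotone b ∧ Function.Surjective b,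
        ∏ i, PowerSeries.coeff (Fintype.card {x // b x = i}) permSeries =
      ∑ b ∈ Finset.univ.filter fun b : Fin n → Fin k => Monotone b,
        ∏ i, PowerSeries.coeff (Fintype.card {x // b x = i}) permSeries := by
    refine Finset.sum_subset (fun b hb => ?_) fun b hb hb' => ?_
    · simp only [Finset.mem_filter] at hb ⊢
      exact ⟨hb.1, hb.2.1⟩
    · simp only [Finset.mem_filter, Finset.mem_univ, true_and, not_and] at hb hb'
      have := hb' hb
      simp only [Function.Surjective, not_forall, not_exists] at this
      obtain ⟨i, hi⟩ := this
      refine Finset.prod_eq_zero (Finset.mem_univ i) ?_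
      have : Fintype.card {x // b x = i} = 0 := Fintype.card_eq_zero_iff.mpr ⟨fun x => hi x x.2⟩
      simp [this, permSeries]
  rw [h2, h3]
  refine Finset.sum_bij (fun b _ => Finsupp.equivFunOnFinite.symm
    fun i => Fintype.card {x // b x = i}) ?_ ?_ ?_ ?_
  · intro b _
    rw [Finset.mem_finsuppAntidiag]
    refine ⟨?_, Finset.subset_univ _⟩
    have := Fintype.card_congr (Equiv.sigmaFiberEquiv b)
    rw [Fintype.card_sigma, Fintype.card_fin] at this
    exact this
  · intro b hb b' hb' e
    simp only [Finset.mem_filter, Finset.mem_univ, true_and] at hb hb'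
    exact eq_of_card_fiber_eq hb hb' (congrFun (Finsupp.equivFunOnFinite.symm.injective e))
  · intro l hl
    rw [Finset.mem_finsuppAntidiag] at hl
    obtain ⟨b, hb, hbl⟩ := exists_monotone_card_fiber hl.1
    exact ⟨b, by simpa using hb, Finsupp.ext hbl⟩
  · intro b _
    rfl

end Compositions

/-! ### Sum decomposable, skew decomposable, or inflated -/

/-- The values at the positions below `j` are smaller than the other values. -/
def HasCut {n : ℕ} (σ : Equiv.Perm (Fin n)) (j : ℕ) : Prop :=
  ∀ x y : Fin n, (x : ℕ) < j → j ≤ (y : ℕ) → σ x < σ y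

/-- `σ` is a direct sum of two nonempty permutations. -/
def IsSumDecomposable {n : ℕ} (σ : Equiv.Perm (Fin n)) : Prop :=
  ∃ j, 0 < j ∧ j < n ∧ HasCut σ j

/-- `σ` is an inflation of a simple permutation of size at least `4`. -/
def IsProperInflation {n : ℕ} (σ : Equiv.Perm (Fin n)) : Prop :=
  ∃ (k : ℕ) (b : Fin n → Fin k) (τ : Equiv.Perm (Fin k)), 4 ≤ k ∧ IsSimple τ ∧ IsInflation b τ σ

section Decomposition

variable {n : ℕ} {σ : Equiv.Perm (Fin n)}

/-- Two complementary proper modules would each sit in a single block, leaving at most two blocks.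
-/
theorem IsProperInflation.not_cut (h : IsProperInflation σ) {j : ℕ} (hj : 0 < j) (hjn : j < n)
    (hI : IsModule (color σ) Set.univ {x | (x : ℕ) < j})
    (hJ : IsModule (color σ) Set.univ {x | j ≤ (x : ℕ)}) : False := by
  obtain ⟨k, b, τ, hk, hτ, hb⟩ := h
  have h1 : ∀ x : Fin n, (x : ℕ) < j → b x = b ⟨0, by omega⟩ := by
    rcases hb.constant_or_eq_univ hτ hk hI with h | h
    · exact fun x hx => h x hx _ hj
    · have : (⟨j, hjn⟩ : Fin n) ∈ {x : Fin n | (x : ℕ) < j} := h ▸ Set.mem_univ _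
      exact absurd this (lt_irrefl j)
  have h2 : ∀ x : Fin n, j ≤ (x : ℕ) → b x = b ⟨j, hjn⟩ := by
    rcases hb.constant_or_eq_univ hτ hk hJ with h | h
    · exact fun x hx => h x hx _ (le_refl j)
    · have : (⟨0, by omega⟩ : Fin n) ∈ {x : Fin n | j ≤ (x : ℕ)} := h ▸ Set.mem_univ _
      exact absurd this (not_le.mpr hj)
  have h3 : ∀ i : Fin k, i = b ⟨0, by omega⟩ ∨ i = b ⟨j, hjn⟩ := by
    intro i
    obtain ⟨x, rfl⟩ := hb.surjective i
    rcases lt_or_ge (x : ℕ) j with hx | hx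
    · exact Or.inl (h1 x hx)
    · exact Or.inr (h2 x hx)
  have e0 := h3 ⟨0, by omega⟩
  have e1 := h3 ⟨1, by omega⟩
  have e2 := h3 ⟨2, by omega⟩
  simp only [Fin.ext_iff] at e0 e1 e2
  omega

theorem IsProperInflation.not_isSumDecomposable (h : IsProperInflation σ) :
    ¬ IsSumDecomposable σ := by
  rintro ⟨j, hj, hjn, hc⟩
  refine h.not_cut hj hjn ⟨Set.subset_univ _, fun y _ hy a ha b hb => ?_⟩
    ⟨Set.subset_univ _, fun y _ hy a ha b hb => ?_⟩
  · simp only [Set.mem_ofPred_eq, not_lt] at hy ha hb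
    rw [color_eq_iff]
    have h1 := hc a y ha hy
    have h2 := hc b y hb hy
    constructor <;> omega
  · simp only [Set.mem_ofPred_eq, not_le] at hy ha hb
    rw [color_eq_iff]
    have h1 := hc y a hy ha
    have h2 := hc y b hy hb
    constructor <;> omega

theorem IsProperInflation.not_isSumDecomposable_rev (h : IsProperInflation σ) :
    ¬ IsSumDecomposable (σ.trans Fin.revPerm) := by
  rintro ⟨j, hj, hjn, hc⟩
  have hc' : ∀ x y : Fin n, (x : ℕ) < j → j ≤ (y : ℕ) → σ y < σ x := fun x y h1 h2 => by
    simpa using hc x y h1 h2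
  refine h.not_cut hj hjn ⟨Set.subset_univ _, fun y _ hy a ha b hb => ?_⟩
    ⟨Set.subset_univ _, fun y _ hy a ha b hb => ?_⟩
  · simp only [Set.mem_ofPred_eq, not_lt] at hy ha hb
    rw [color_eq_iff]
    have h1 := hc' a y ha hy
    have h2 := hc' b y hb hy
    constructor <;> omega
  · simp only [Set.mem_ofPred_eq, not_le] at hy ha hb
    rw [color_eq_iff]
    have h1 := hc' y a hy ha
    have h2 := hc' y b hy hb
    constructor <;> omega

theorem not_isSumDecomposable_and_rev (h : IsSumDecomposable σ)
    (h' : IsSumDecomposable (σ.trans Fin.revPerm)) : False := by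
  obtain ⟨j, hj, hjn, hc⟩ := h
  obtain ⟨j', hj', hjn', hc'⟩ := h'
  have h1 := hc ⟨0, by omega⟩ ⟨n - 1, by omega⟩ hj (by simp only; omega)
  have h2 := hc' ⟨0, by omega⟩ ⟨n - 1, by omega⟩ hj' (by simp only; omega)
  simp only [Equiv.trans_apply, Fin.revPerm_apply, Fin.rev_lt_rev] at h2
  exact lt_asymm h1 h2

/-- A simple quotient of size 2 is increasing or decreasing, giving a sum or a skew sum; size 3 does
not occur. -/
theorem decomposition_cases (hn : 2 ≤ n) (σ : Equiv.Perm (Fin n)) :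
    IsSumDecomposable σ ∨ IsSumDecomposable (σ.trans Fin.revPerm) ∨ IsProperInflation σ := by
  obtain ⟨k, b, τ, hk, hτ, h⟩ := exists_isInflation_isSimple hn σ
  by_cases h4 : 4 ≤ k
  · exact Or.inr (Or.inr ⟨k, b, τ, h4, hτ, h⟩)
  · by_cases h3 : k = 3
    · subst h3
      exact absurd hτ (not_isSimple_three τ)
    · obtain rfl : k = 2 := by omega
      obtain ⟨j, hj, hj'⟩ := Set.exists_min_image {x | b x = 1} id (Set.toFinite _)
        (h.surjective 1)
      have hlow : ∀ x : Fin n, (x : ℕ) < j → b x = 0 := by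
        intro x hx
        have : b x ≠ 1 := fun e => absurd (hj' x e) (not_le.mpr hx)
        omega
      have hhigh : ∀ x : Fin n, (j : ℕ) ≤ x → b x = 1 := by
        intro x hx
        have h1 : b j ≤ b x := h.monotone hx
        have h2 : b j = 1 := hj
        omega
      have hj0 : 0 < (j : ℕ) := by
        by_contra h0
        obtain ⟨x, hx⟩ := h.surjective 0
        have := hhigh x (by omega)
        rw [hx] at this
        exact absurd this (by decide)
      have hτ01 : τ 0 ≠ τ 1 := τ.injective.ne (by decide)
      rcases lt_or_gt_of_ne hτ01 with hlt | hlt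
      · refine Or.inl ⟨j, hj0, j.2, fun x y hx hy => ?_⟩
        have h1 := hlow x hx
        have h2 := hhigh y hy
        rw [h.lt_iff x y (by rw [h1, h2]; decide), h1, h2]
        exact hlt
      · refine Or.inr (Or.inl ⟨j, hj0, j.2, fun x y hx hy => ?_⟩)
        have h1 := hlow x hx
        have h2 := hhigh y hy
        simp only [Equiv.trans_apply, Fin.revPerm_apply, Fin.rev_lt_rev]
        rw [h.lt_iff y x (by rw [h1, h2]; decide), h1, h2]
        exact hlt

/-- The number of sum decomposable permutations of size `n`. -/
noncomputable def decomposableCount (n : ℕ) : ℕ :=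
  Nat.card {σ : Equiv.Perm (Fin n) // IsSumDecomposable σ}

/-- The number of simple permutations of size `n`, for `n ≥ 4`. -/
noncomputable def simpleCoeff (n : ℕ) : ℚ :=
  if 4 ≤ n then simpleCount n else 0

open scoped Classical in
theorem card_isProperInflation (n : ℕ) :
    (Nat.card {σ : Equiv.Perm (Fin n) // IsProperInflation σ} : ℚ) =
      ∑ k ∈ Finset.range (n + 1), simpleCoeff k * PowerSeries.coeff n (permSeries ^ k) := by
  let T : Type := Σ k : Fin (n + 1), Σ τ : {τ : Equiv.Perm (Fin k) // 4 ≤ (k : ℕ) ∧ IsSimple τ},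
    Σ b : {b : Fin n → Fin k // Monotone b ∧ Function.Surjective b},
      {σ : Equiv.Perm (Fin n) // IsInflation b.1 τ.1 σ}
  let f : T → {σ : Equiv.Perm (Fin n) // IsProperInflation σ} := fun t =>
    ⟨t.2.2.2.1, ⟨t.1, t.2.2.1.1, t.2.1.1, t.2.1.2.1, t.2.1.2.2, t.2.2.2.2⟩⟩
  have hf : Function.Bijective f := by
    constructor
    · rintro ⟨⟨k, hk⟩, ⟨τ, h4, hτ⟩, ⟨b, hb⟩, ⟨σ, hσ⟩⟩ ⟨⟨k', hk'⟩, ⟨τ', h4', hτ'⟩, ⟨b', hb'⟩, ⟨σ', hσ'⟩⟩ e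
      obtain rfl : σ = σ' := congrArg Subtype.val e
      obtain ⟨e1, e2, e3⟩ := hσ.unique hσ' hτ hτ' h4 h4'
      simp only at e1
      subst e1
      cases e2
      cases e3
      rfl
    · rintro ⟨σ, k, b, τ, hk, hτ, hb⟩
      have hkn : k ≤ n := by simpa using Fintype.card_le_of_surjective b hb.surjective
      exact ⟨⟨⟨k, by omega⟩, ⟨τ, hk, hτ⟩, ⟨b, hb.monotone, hb.surjective⟩, ⟨σ, hb⟩⟩, rfl⟩
  rw [← Nat.card_congr (Equiv.ofBijective f hf), Nat.card_eq_fintype_card]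
  simp only [T, Fintype.card_sigma]
  rw [← Fin.sum_univ_eq_sum_range
    (fun k => simpleCoeff k * PowerSeries.coeff n (permSeries ^ k))]
  push_cast
  refine Finset.sum_congr rfl fun k _ => ?_
  have h1 : ∀ τ : {τ : Equiv.Perm (Fin k) // 4 ≤ (k : ℕ) ∧ IsSimple τ},
      ∑ b : {b : Fin n → Fin k // Monotone b ∧ Function.Surjective b},
        (Fintype.card {σ : Equiv.Perm (Fin n) // IsInflation b.1 τ.1 σ} : ℚ) =
      PowerSeries.coeff n (permSeries ^ (k : ℕ)) := fun τ => by
    rw [← sum_prod_factorial_eq_coeff]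
    refine Finset.sum_congr rfl fun b _ => ?_
    rw [← Nat.card_eq_fintype_card, card_isInflation b.2.1 b.2.2]
    push_cast
    rfl
  simp only [h1, Finset.sum_const, nsmul_eq_mul]
  congr 1
  rw [Finset.card_univ, simpleCoeff]
  split_ifs with h4
  · rw [simpleCount, ← Nat.card_coe_set_eq, ← Nat.card_eq_fintype_card]
    congr 1
    exact Nat.card_congr (Equiv.subtypeEquivRight fun τ => by simp [h4])
  · simp [h4]

/-- The three classes are disjoint, and reversing values matches the first two. -/
theorem card_perm_eq {n : ℕ} (hn : 2 ≤ n) :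
    (n ! : ℚ) = 2 * decomposableCount n +
      ∑ k ∈ Finset.range (n + 1), simpleCoeff k * PowerSeries.coeff n (permSeries ^ k) := by
  classical
  rw [← card_isProperInflation]
  have h1 : decomposableCount n =
      Nat.card {σ : Equiv.Perm (Fin n) // IsSumDecomposable (σ.trans Fin.revPerm)} :=
    Nat.card_congr ((Equiv.mulLeft (Fin.revPerm : Equiv.Perm (Fin n))).subtypeEquiv fun σ => by
      have : (Equiv.mulLeft (Fin.revPerm : Equiv.Perm (Fin n)) σ).trans Fin.revPerm = σ := by
        ext x
        simp
      rw [this])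
  have h2 : n ! = decomposableCount n + decomposableCount n +
      Nat.card {σ : Equiv.Perm (Fin n) // IsProperInflation σ} := by
    nth_rewrite 2 [h1]
    rw [decomposableCount, Nat.card_eq_fintype_card, Nat.card_eq_fintype_card,
      Nat.card_eq_fintype_card, Fintype.card_subtype, Fintype.card_subtype, Fintype.card_subtype,
      Finset.card_filter, Finset.card_filter, Finset.card_filter, ← Finset.sum_add_distrib,
      ← Finset.sum_add_distrib]
    have h3 : ∀ σ : Equiv.Perm (Fin n), ((if IsSumDecomposable σ then 1 else 0) +
        (if IsSumDecomposable (σ.trans Fin.revPerm) then 1 else 0) +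
        if IsProperInflation σ then 1 else 0) = 1 := by
      intro σ
      by_cases hp : IsProperInflation σ
      · simp [hp, hp.not_isSumDecomposable, hp.not_isSumDecomposable_rev]
      · by_cases hs : IsSumDecomposable σ
        · have : ¬ IsSumDecomposable (σ.trans Fin.revPerm) := not_isSumDecomposable_and_rev hs
          simp [hp, hs, this]
        · have := decomposition_cases hn σ
          simp only [hs, hp, false_or, or_false] at this
          simp [hs, hp, this]
    simp only [h3]
    simp [Fintype.card_perm]
  rw [h2]
  push_cast
  ring

end Decomposition

/-! ### Sum decomposable permutations by their first cut -/

section DirectSum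

/-- The number of sum indecomposable permutations of size `n`. -/
noncomputable def indecomposableCount (n : ℕ) : ℕ :=
  Nat.card {σ : Equiv.Perm (Fin n) // ¬ IsSumDecomposable σ}

theorem indecomposableCount_add_decomposableCount (n : ℕ) :
    indecomposableCount n + decomposableCount n = n ! := by
  classical
  rw [indecomposableCount, decomposableCount, Nat.card_eq_fintype_card, Nat.card_eq_fintype_card,
    Fintype.card_subtype_compl, Nat.sub_add_cancel (Fintype.card_subtype_le _), Fintype.card_perm,
    Fintype.card_fin]

/-- `j` is the least nontrivial cut of `σ`. -/
def IsFirstCut {n : ℕ} (σ : Equiv.Perm (Fin n)) (j : ℕ) : Prop :=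
  HasCut σ j ∧ ∀ i, 0 < i → i < j → ¬ HasCut σ i

/-- The direct sum of two permutations. -/
def directSum {j m : ℕ} (α : Equiv.Perm (Fin j)) (β : Equiv.Perm (Fin m)) :
    Equiv.Perm (Fin (j + m)) :=
  finSumFinEquiv.permCongr (Equiv.sumCongr α β)

theorem directSum_castAdd {j m : ℕ} (α : Equiv.Perm (Fin j)) (β : Equiv.Perm (Fin m))
    (x : Fin j) : directSum α β (Fin.castAdd m x) = Fin.castAdd m (α x) := by
  simp [directSum, Equiv.permCongr_apply]

theorem directSum_natAdd {j m : ℕ} (α : Equiv.Perm (Fin j)) (β : Equiv.Perm (Fin m))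
    (x : Fin m) : directSum α β (Fin.natAdd j x) = Fin.natAdd j (β x) := by
  simp [directSum, Equiv.permCongr_apply]

theorem hasCut_directSum {j m : ℕ} (α : Equiv.Perm (Fin j)) (β : Equiv.Perm (Fin m)) :
    HasCut (directSum α β) j := by
  intro x y
  induction x using Fin.addCases with
  | left x =>
    induction y using Fin.addCases with
    | left y =>
      intro _ h
      simp only [Fin.val_castAdd] at h
      omega
    | right y =>
      intro _ _
      rw [directSum_castAdd, directSum_natAdd]
      simp only [Fin.lt_def, Fin.val_castAdd, Fin.val_natAdd]
      omega
  | right x =>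
    intro h
    simp at h

theorem hasCut_directSum_iff {j m : ℕ} (α : Equiv.Perm (Fin j)) (β : Equiv.Perm (Fin m)) {i : ℕ}
    (hi : i < j) : HasCut (directSum α β) i ↔ HasCut α i := by
  constructor
  · intro h x y hx hy
    have := h (Fin.castAdd m x) (Fin.castAdd m y) hx hy
    rw [directSum_castAdd, directSum_castAdd] at this
    exact this
  · intro h x y hx hy
    induction x using Fin.addCases with
    | left x =>
      induction y using Fin.addCases with
      | left y =>
        rw [directSum_castAdd, directSum_castAdd]
        exact h x y hx hy
      | right y => exact hasCut_directSum α β _ _ (by simp) (by simp)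
    | right x =>
      simp only [Fin.val_natAdd] at hx
      omega

theorem exists_directSum_eq {j m : ℕ} {σ : Equiv.Perm (Fin (j + m))} (h : HasCut σ j) :
    ∃ α β, directSum α β = σ := by
  have hlt : ∀ x : Fin (j + m), (x : ℕ) < j → (σ x : ℕ) < j := by
    intro x hx
    rcases Nat.eq_zero_or_pos m with rfl | hm
    · exact (σ x).2
    -- The `m` values at positions from `j` on all exceed `σ x`, so `σ x < j`.
    have hsub : (Finset.Ici (⟨j, by omega⟩ : Fin (j + m))).image σ ⊆ Finset.Ioi (σ x) := by
      intro z hz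
      obtain ⟨y, hy, rfl⟩ := Finset.mem_image.mp hz
      exact Finset.mem_Ioi.mpr (h x y hx (Fin.le_def.mp (Finset.mem_Ici.mp hy)))
    have := Finset.card_le_card hsub
    rw [Finset.card_image_of_injective _ σ.injective, Fin.card_Ici, Fin.card_Ioi] at this
    simp only at this
    omega
  have hmem := Equiv.Perm.mem_sumCongrHom_range_of_perm_mapsTo_inl
    (σ := finSumFinEquiv.symm.permCongr σ) (by
      rintro _ ⟨x, rfl⟩
      refine ⟨⟨σ (Fin.castAdd m x), hlt _ x.2⟩, ?_⟩
      simp only [Equiv.permCongr_apply, Equiv.symm_symm, finSumFinEquiv_apply_left]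
      rw [Equiv.eq_symm_apply, finSumFinEquiv_apply_left]
      rfl)
  obtain ⟨⟨α, β⟩, hαβ⟩ := hmem
  refine ⟨α, β, ?_⟩
  have h2 : Equiv.sumCongr α β = finSumFinEquiv.symm.permCongr σ := hαβ
  rw [directSum, h2]
  ext x
  simp [Equiv.permCongr_apply]

theorem card_isFirstCut {j m : ℕ} :
    Nat.card {σ : Equiv.Perm (Fin (j + m)) // IsFirstCut σ j} = indecomposableCount j * m ! := by
  have h1 : ∀ (α : Equiv.Perm (Fin j)) (β : Equiv.Perm (Fin m)),
      IsFirstCut (directSum α β) j ↔ ¬ IsSumDecomposable α := by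
    intro α β
    simp only [IsFirstCut, hasCut_directSum, true_and, IsSumDecomposable, not_exists, not_and]
    exact forall_congr' fun i => forall_congr' fun h0 => forall_congr' fun hi => by
      rw [hasCut_directSum_iff α β hi]
  let f : {α : Equiv.Perm (Fin j) // ¬ IsSumDecomposable α} × Equiv.Perm (Fin m) →
      {σ : Equiv.Perm (Fin (j + m)) // IsFirstCut σ j} :=
    fun p => ⟨directSum p.1.1 p.2, (h1 _ _).mpr p.1.2⟩
  have hf : Function.Bijective f := by
    constructor
    · rintro ⟨⟨α, hα⟩, β⟩ ⟨⟨α', hα'⟩, β'⟩ e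
      have e' : directSum α β = directSum α' β' := congrArg Subtype.val e
      have ea : α = α' := Equiv.ext fun x => by
        have := DFunLike.congr_fun e' (Fin.castAdd m x)
        rwa [directSum_castAdd, directSum_castAdd, Fin.castAdd_inj] at this
      have eb : β = β' := Equiv.ext fun x => by
        have := DFunLike.congr_fun e' (Fin.natAdd j x)
        rwa [directSum_natAdd, directSum_natAdd, Fin.natAdd_inj] at this
      subst ea eb
      rfl
    · rintro ⟨σ, hσ⟩
      obtain ⟨α, β, rfl⟩ := exists_directSum_eq hσ.1
      exact ⟨⟨⟨α, (h1 α β).mp hσ⟩, β⟩, rfl⟩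
  rw [← Nat.card_congr (Equiv.ofBijective f hf), Nat.card_prod, Nat.card_perm, Nat.card_fin]
  rfl

/-- Cutting at the first cut leaves an indecomposable first summand and an arbitrary second one. -/
theorem decomposableCount_eq (n : ℕ) :
    decomposableCount n = ∑ j ∈ Finset.Ioo 0 n, indecomposableCount j * (n - j)! := by
  classical
  have h1 : ∀ j ∈ Finset.Ioo 0 n, indecomposableCount j * (n - j)! =
      (Finset.univ.filter fun σ : Equiv.Perm (Fin n) => IsFirstCut σ j).card := by
    intro j hj
    obtain ⟨m, rfl⟩ := Nat.exists_eq_add_of_le (Finset.mem_Ioo.mp hj).2.le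
    rw [Nat.add_sub_cancel_left, ← card_isFirstCut, Nat.card_eq_fintype_card, Fintype.card_subtype]
  rw [Finset.sum_congr rfl h1, ← Finset.card_biUnion, decomposableCount, Nat.card_eq_fintype_card,
    Fintype.card_subtype]
  · congr 1
    ext σ
    simp only [Finset.mem_filter, Finset.mem_univ, true_and, Finset.mem_biUnion, Finset.mem_Ioo]
    constructor
    · intro h
      have h' : ∃ j, 0 < j ∧ j < n ∧ HasCut σ j := h
      refine ⟨Nat.find h', ⟨(Nat.find_spec h').1, (Nat.find_spec h').2.1⟩,
        (Nat.find_spec h').2.2, fun i h0 hi hc => ?_⟩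
      exact Nat.find_min h' hi ⟨h0, hi.trans (Nat.find_spec h').2.1, hc⟩
    · rintro ⟨j, ⟨h0, hj⟩, hc, -⟩
      exact ⟨j, h0, hj, hc⟩
  · intro i hi j hj hij
    rw [Function.onFun, Finset.disjoint_left]
    intro σ h h'
    simp only [Finset.mem_filter, Finset.mem_univ, true_and] at h h'
    simp only [Finset.coe_Ioo, Set.mem_Ioo] at hi hj
    rcases lt_or_gt_of_ne hij with hlt | hlt
    · exact h'.2 i hi.1 hlt h.1
    · exact h.2 j hj.1 hlt h'.1

end DirectSum

/-! ### Generating functions and the compositional inverse -/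

open PowerSeries (X coeff constantCoeff HasSubst)

section GeneratingFunctions

theorem permSeries_hasSubst : HasSubst permSeries :=
  HasSubst.of_constantCoeff_zero' (by simp [permSeries])

theorem coeff_permSeries {n : ℕ} (hn : n ≠ 0) : coeff n permSeries = (n ! : ℚ) := by
  simp [permSeries, hn]

/-- This encodes n! = (n-1)! + (n-1)·(n-1)!. -/
theorem permSeries_eq :
    permSeries = X + X * permSeries + X * (X * PowerSeries.derivative ℚ permSeries) := by
  ext n
  rcases n with _ | _ | n
  · simp [permSeries]
  · rw [map_add, map_add, PowerSeries.coeff_succ_X_mul, PowerSeries.coeff_succ_X_mul]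
    simp [permSeries]
  · rw [map_add, map_add, PowerSeries.coeff_succ_X_mul, PowerSeries.coeff_succ_X_mul,
      PowerSeries.coeff_succ_X_mul, PowerSeries.coeff_derivative, PowerSeries.coeff_X,
      coeff_permSeries (by omega), coeff_permSeries (by omega), if_neg (by omega),
      Nat.factorial_succ (n + 1)]
    push_cast
    ring

/-- The generating function of the sum decomposable permutations. -/
noncomputable def decomposableSeries : PowerSeries ℚ :=
  PowerSeries.mk fun n => (decomposableCount n : ℚ)

theorem decomposableCount_of_le_one {n : ℕ} (hn : n ≤ 1) : decomposableCount n = 0 := by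
  rw [decomposableCount_eq]
  refine Finset.sum_eq_zero fun j hj => ?_
  rw [Finset.mem_Ioo] at hj
  omega

theorem decomposableSeries_eq :
    decomposableSeries = (permSeries - decomposableSeries) * permSeries := by
  ext n
  rw [PowerSeries.coeff_mul, Finset.Nat.sum_antidiagonal_eq_sum_range_succ
    (fun i j => coeff i (permSeries - decomposableSeries) * coeff j permSeries)]
  have h1 : coeff n decomposableSeries =
      ∑ j ∈ Finset.Ioo 0 n, (indecomposableCount j * (n - j)! : ℚ) := by
    simp [decomposableSeries, decomposableCount_eq]
  rw [h1]
  symm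
  refine (Finset.sum_subset (fun j hj => ?_) fun j hj hj' => ?_).symm.trans
    (Finset.sum_congr rfl fun j hj => ?_)
  · rw [Finset.mem_Ioo] at hj
    rw [Finset.mem_range]
    omega
  · rw [Finset.mem_range] at hj
    rw [Finset.mem_Ioo] at hj'
    rcases Nat.eq_zero_or_pos j with rfl | h0
    · simp [decomposableSeries, permSeries, decomposableCount_of_le_one]
    · obtain rfl : j = n := by omega
      simp [permSeries]
  · rw [Finset.mem_Ioo] at hj
    rw [map_sub, coeff_permSeries (by omega), coeff_permSeries (by omega)]
    simp [decomposableSeries, ← indecomposableCount_add_decomposableCount j]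

/-- The generating function of the simple permutations of size at least `4`. -/
noncomputable def simpleSeries : PowerSeries ℚ :=
  PowerSeries.mk simpleCoeff

theorem coeff_subst_permSeries (f : PowerSeries ℚ) (n : ℕ) :
    coeff n (f.subst permSeries) =
      ∑ k ∈ Finset.range (n + 1), coeff k f * coeff n (permSeries ^ k) := by
  rw [PowerSeries.coeff_subst' permSeries_hasSubst]
  rw [finsum_eq_sum_of_support_subset]
  · rfl
  · intro k hk
    rw [Finset.coe_range, Set.mem_Iio]
    by_contra hlt
    apply hk
    have hdvd : X ^ k ∣ permSeries ^ k := pow_dvd_pow_of_dvd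
      (PowerSeries.X_dvd_iff.mpr (by simp [permSeries])) k
    simp [PowerSeries.X_pow_dvd_iff.mp hdvd n (by omega)]

theorem permSeries_eq_subst :
    permSeries = X + 2 * decomposableSeries + simpleSeries.subst permSeries := by
  ext n
  have h2 : (2 : PowerSeries ℚ) = PowerSeries.C 2 := (map_ofNat PowerSeries.C 2).symm
  rw [map_add, map_add, h2, PowerSeries.coeff_C_mul, coeff_subst_permSeries]
  simp only [simpleSeries, decomposableSeries, PowerSeries.coeff_mk]
  rcases n with _ | _ | n
  · simp [permSeries, simpleCoeff, decomposableCount_of_le_one]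
  · simp [permSeries, simpleCoeff, decomposableCount_of_le_one, Finset.sum_range_succ]
  · rw [coeff_permSeries (by omega), card_perm_eq (by omega), PowerSeries.coeff_X,
      if_neg (by omega), zero_add]

/-- `X ^ 2 / (1 + X)` -/
noncomputable def altSeries : PowerSeries ℚ :=
  PowerSeries.mk fun n => if n < 2 then 0 else (-1) ^ n

theorem altSeries_mul : altSeries * (1 + X) = X ^ 2 := by
  ext n
  rw [mul_add, mul_one, map_add]
  rcases n with _ | _ | _ | n
  · simp [altSeries]
  · rw [PowerSeries.coeff_succ_mul_X]
    simp [altSeries, PowerSeries.coeff_X_pow]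
  · rw [PowerSeries.coeff_succ_mul_X]
    simp [altSeries, PowerSeries.coeff_X_pow]
  · rw [PowerSeries.coeff_succ_mul_X]
    simp [altSeries, PowerSeries.coeff_X, pow_succ]

/-- The compositional inverse of `permSeries`. -/
noncomputable def permSeriesInv : PowerSeries ℚ :=
  X - 2 * altSeries - simpleSeries

/-- `decomposableSeries_eq` solves to F²/(1+F), which is `altSeries` evaluated at F; the rest is
`permSeries_eq_subst`. -/
theorem permSeriesInv_subst : permSeriesInv.subst permSeries = X := by
  have hF := permSeries_hasSubst
  let θ : PowerSeries ℚ →ₐ[ℚ] PowerSeries ℚ := PowerSeries.substAlgHom hF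
  have hθ : ∀ f, θ f = f.subst permSeries := fun f =>
    congrFun (PowerSeries.coe_substAlgHom hF) f
  have hX : θ X = permSeries := PowerSeries.substAlgHom_X hF
  have h1 : θ altSeries * (1 + permSeries) = permSeries ^ 2 := by
    rw [← hX, ← map_pow, ← altSeries_mul, map_mul, map_add, map_one]
  have h2 : decomposableSeries * (1 + permSeries) = permSeries ^ 2 := by
    linear_combination decomposableSeries_eq
  have h3 : (1 + permSeries : PowerSeries ℚ) ≠ 0 := by
    intro h
    have := congrArg (coeff 0) h
    simp [permSeries] at this
  have h4 : θ altSeries = decomposableSeries := mul_right_cancel₀ h3 (h1.trans h2.symm)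
  have h5 := permSeries_eq_subst
  rw [← hθ] at h5 ⊢
  rw [permSeriesInv, map_sub, map_sub, map_mul, map_ofNat, hX, h4]
  linear_combination h5

theorem permSeries_subst_inv : ∃ Q : PowerSeries ℚ, HasSubst Q ∧ permSeries.subst Q = X := by
  have h0 : constantCoeff permSeries = 0 := by simp [permSeries]
  have h1 : IsUnit (coeff 1 permSeries) := by simp [permSeries]
  exact ⟨permSeries.substInvOfIsUnit h1, HasSubst.substInvOfIsUnit _ h1,
    PowerSeries.subst_substInvOfIsUnit_right _ h0 h1⟩

theorem subst_permSeries_injective {f : PowerSeries ℚ} (h : f.subst permSeries = 0) : f = 0 := by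
  obtain ⟨Q, hQ, hFQ⟩ := permSeries_subst_inv
  have h1 := PowerSeries.subst_comp_subst_apply permSeries_hasSubst hQ f
  have h2 : (permSeries.subst Q : PowerSeries ℚ) = X := hFQ
  have h3 : PowerSeries.subst Q (0 : PowerSeries ℚ) = 0 := by
    rw [← PowerSeries.coe_substAlgHom hQ, map_zero]
  rw [h, h3] at h1
  have h4 : PowerSeries.subst (PowerSeries.subst Q permSeries : PowerSeries ℚ) f = f := by
    rw [h2, PowerSeries.X_subst]
  rw [← h4]
  exact h1.symm

/-- It suffices to check the identity after substituting F = `permSeries` and multiplying by F'.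
Since G(F) = X and G'(F)·F' = 1, it becomes `permSeries_eq`. -/
theorem permSeriesInv_ode :
    X * PowerSeries.derivative ℚ permSeriesInv =
      (1 + X) * (permSeriesInv * PowerSeries.derivative ℚ permSeriesInv) + permSeriesInv ^ 2 := by
  have hF := permSeries_hasSubst
  let θ : PowerSeries ℚ →ₐ[ℚ] PowerSeries ℚ := PowerSeries.substAlgHom hF
  have hθ : ∀ f, θ f = f.subst permSeries := fun f =>
    congrFun (PowerSeries.coe_substAlgHom hF) f
  have hX : θ X = permSeries := PowerSeries.substAlgHom_X hF
  have hG : θ permSeriesInv = X := (hθ _).trans permSeriesInv_subst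
  have hd : θ (PowerSeries.derivative ℚ permSeriesInv) * PowerSeries.derivative ℚ permSeries = 1 := by
    rw [hθ, ← PowerSeries.derivative_subst hF, permSeriesInv_subst, PowerSeries.derivative_X]
  have hne : PowerSeries.derivative ℚ permSeries ≠ 0 := by
    intro h
    rw [h, mul_zero] at hd
    exact zero_ne_one hd
  rw [← sub_eq_zero]
  apply subst_permSeries_injective
  rw [← hθ]
  apply mul_right_cancel₀ hne
  rw [map_sub, map_add, map_mul, map_mul, map_mul, map_pow, map_add, map_one, hX, hG, zero_mul]
  linear_combination (permSeries - (1 + permSeries) * X) * hd + permSeries_eq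

end GeneratingFunctions

/-! ### A quadratic recurrence for the coefficients -/

section Recurrence

/-- The coefficients of the compositional inverse of `permSeries`, up to sign. -/
noncomputable def invCoeff (n : ℕ) : ℚ :=
  -coeff n permSeriesInv

theorem invCoeff_zero : invCoeff 0 = 0 := by
  simp [invCoeff, permSeriesInv, altSeries, simpleSeries, simpleCoeff]

theorem invCoeff_one : invCoeff 1 = -1 := by
  have h2 : (2 : PowerSeries ℚ) = PowerSeries.C 2 := (map_ofNat PowerSeries.C 2).symm
  simp only [invCoeff, permSeriesInv, map_sub]
  rw [h2, PowerSeries.coeff_C_mul]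
  simp [altSeries, simpleSeries, simpleCoeff]

theorem invCoeff_of_two_le {n : ℕ} (hn : 2 ≤ n) :
    invCoeff n = simpleCoeff n + 2 * (-1) ^ n := by
  have h2 : (2 : PowerSeries ℚ) = PowerSeries.C 2 := (map_ofNat PowerSeries.C 2).symm
  simp only [invCoeff, permSeriesInv, map_sub]
  rw [h2, PowerSeries.coeff_C_mul, PowerSeries.coeff_X, if_neg (by omega)]
  simp only [altSeries, simpleSeries, PowerSeries.coeff_mk]
  rw [if_neg (by omega)]
  ring

theorem invCoeff_recurrence {n : ℕ} (hn : 1 ≤ n) :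
    -2 * n * invCoeff n =
      (n + 1) * ∑ i ∈ Finset.range (n + 2), invCoeff i * invCoeff (n + 1 - i) +
      (n + 2) * ∑ i ∈ Finset.range (n + 1), invCoeff i * invCoeff (n - i) := by
  have hq : ∀ m, coeff m (permSeriesInv ^ 2) =
      ∑ i ∈ Finset.range (m + 1), invCoeff i * invCoeff (m - i) := fun m => by
    rw [sq, PowerSeries.coeff_mul, Finset.Nat.sum_antidiagonal_eq_sum_range_succ
      (fun i j => coeff i permSeriesInv * coeff j permSeriesInv)]
    simp [invCoeff]
  -- Doubling turns G·G' into half-free (G²)', so only coefficients of G² and G occur.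
  have hode : 2 * (X * PowerSeries.derivative ℚ permSeriesInv) =
      PowerSeries.derivative ℚ (permSeriesInv ^ 2) +
      X * PowerSeries.derivative ℚ (permSeriesInv ^ 2) + 2 * permSeriesInv ^ 2 := by
    rw [PowerSeries.derivative_pow]
    push_cast
    linear_combination 2 * permSeriesInv_ode
  obtain ⟨m, rfl⟩ := Nat.exists_eq_add_of_le' hn
  have h2 : (2 : PowerSeries ℚ) = PowerSeries.C 2 := (map_ofNat PowerSeries.C 2).symm
  have := congrArg (coeff (m + 1)) hode
  rw [map_add, map_add, h2, PowerSeries.coeff_C_mul, PowerSeries.coeff_C_mul,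
    PowerSeries.coeff_succ_X_mul, PowerSeries.coeff_succ_X_mul, PowerSeries.coeff_derivative,
    PowerSeries.coeff_derivative, PowerSeries.coeff_derivative, hq, hq] at this
  have hc : coeff (m + 1) permSeriesInv = -invCoeff (m + 1) := by simp [invCoeff]
  rw [hc] at this
  push_cast at this ⊢
  linear_combination this

end Recurrence

/-! ### Convolutions of factorially growing sequences -/

section Convolution

theorem sum_conv_eq (u : ℕ → ℚ) {m d : ℕ} (h : 2 * d ≤ m + 1) :
    ∑ i ∈ Finset.range (m + 1), u i * u (m - i) =
      2 * ∑ i ∈ Finset.range d, u i * u (m - i) +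
        ∑ i ∈ Finset.Ico d (m + 1 - d), u i * u (m - i) := by
  have h1 : ∑ i ∈ Finset.Ico (m + 1 - d) (m + 1), u i * u (m - i) =
      ∑ i ∈ Finset.range d, u i * u (m - i) := by
    rw [Finset.range_eq_Ico]
    refine Finset.sum_nbij' (fun i => m - i) (fun i => m - i) ?_ ?_ ?_ ?_ ?_
    · intro i hi
      simp only [Finset.mem_Ico] at hi ⊢
      omega
    · intro i hi
      simp only [Finset.mem_Ico] at hi ⊢
      omega
    · intro i hi
      simp only [Finset.mem_Ico] at hi
      omega
    · intro i hi
      simp only [Finset.mem_Ico] at hi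
      omega
    · intro i hi
      simp only [Finset.mem_Ico] at hi
      rw [show m - (m - i) = i by omega, mul_comm]
  rw [Finset.range_eq_Ico, ← Finset.sum_Ico_consecutive _ (Nat.zero_le d) (by omega : d ≤ m + 1),
    ← Finset.sum_Ico_consecutive _ (by omega : d ≤ m + 1 - d) (by omega : m + 1 - d ≤ m + 1), h1,
    Finset.range_eq_Ico]
  ring

theorem factorial_mul_factorial_le {e i j : ℕ} (hi : e ≤ i) (hj : e ≤ j) :
    i ! * j ! ≤ e ! * (i + j - e)! := by
  obtain ⟨t, rfl⟩ := Nat.exists_eq_add_of_le hi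
  rw [show e + t + j - e = j + t by omega]
  induction t with
  | zero => simp
  | succ t ih =>
    rw [← add_assoc, ← add_assoc, Nat.factorial_succ, Nat.factorial_succ]
    calc (e + t + 1) * (e + t)! * j ! = (e + t + 1) * ((e + t)! * j !) := by ring
      _ ≤ (j + t + 1) * (e ! * (j + t)!) := Nat.mul_le_mul (by omega) (ih (by omega))
      _ = e ! * ((j + t + 1) * (j + t)!) := by ring

/-- The two end terms equal `d ! * (m - d)!`. The others are at most `(d + 1)! * (m - d - 1)!`, and
there are at most `m - d` of them. -/
theorem sum_factorial_mul_factorial_le {m d : ℕ} (hd : 1 ≤ d) (h : 2 * d < m + 1) :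
    ∑ i ∈ Finset.Ico d (m + 1 - d), i ! * (m - i)! ≤ (2 * d ! + (d + 1)!) * (m - d)! := by
  have h1 : ∀ i ∈ Finset.Ico d (m + 1 - d), i ! * (m - i)! ≤
      (if i = d then d ! * (m - d)! else 0) + (if i = m - d then d ! * (m - d)! else 0) +
        (d + 1)! * (m - d - 1)! := by
    intro i hi
    rw [Finset.mem_Ico] at hi
    by_cases h2 : i = d
    · subst h2
      simp only [if_true]
      omega
    · by_cases h3 : i = m - d
      · rw [h3, show m - (m - d) = d by omega, mul_comm]
        simp only [if_true]
        omega
      · rw [if_neg h2, if_neg h3, zero_add, zero_add]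
        have := factorial_mul_factorial_le (e := d + 1) (i := i) (j := m - i) (by omega) (by omega)
        rwa [show i + (m - i) - (d + 1) = m - d - 1 by omega] at this
  refine (Finset.sum_le_sum h1).trans ?_
  rw [Finset.sum_add_distrib, Finset.sum_add_distrib, Finset.sum_ite_eq', Finset.sum_ite_eq',
    if_pos (Finset.mem_Ico.mpr ⟨le_rfl, by omega⟩),
    if_pos (Finset.mem_Ico.mpr ⟨by omega, by omega⟩), Finset.sum_const, Nat.card_Ico, smul_eq_mul]
  have h4 : (m + 1 - d - d) * (m - d - 1)! ≤ (m - d)! := by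
    rw [← Nat.mul_factorial_pred (by omega : m - d ≠ 0)]
    exact Nat.mul_le_mul_right _ (by omega)
  calc d ! * (m - d)! + d ! * (m - d)! + (m + 1 - d - d) * ((d + 1)! * (m - d - 1)!)
      = 2 * d ! * (m - d)! + (d + 1)! * ((m + 1 - d - d) * (m - d - 1)!) := by ring
    _ ≤ 2 * d ! * (m - d)! + (d + 1)! * (m - d)! :=
        Nat.add_le_add_left (Nat.mul_le_mul_left _ h4) _
    _ = (2 * d ! + (d + 1)!) * (m - d)! := by ring

end Convolution

/-! ### Positivity and factorial growth -/

section Growth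

theorem invCoeff_two : invCoeff 2 = 2 := by
  rw [invCoeff_of_two_le le_rfl, simpleCoeff, if_neg (by omega)]
  norm_num

theorem invCoeff_three : invCoeff 3 = -2 := by
  rw [invCoeff_of_two_le (by omega), simpleCoeff, if_neg (by omega)]
  norm_num

theorem invCoeff_four : invCoeff 4 = 4 := by
  have := invCoeff_recurrence (n := 4) (by omega)
  simp [Finset.sum_range_succ, invCoeff_zero, invCoeff_one, invCoeff_two, invCoeff_three] at this
  linarith

theorem invCoeff_five : invCoeff 5 = 4 := by
  have := invCoeff_recurrence (n := 5) (by omega)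
  simp [Finset.sum_range_succ, invCoeff_zero, invCoeff_one, invCoeff_two, invCoeff_three,
    invCoeff_four] at this
  linarith

theorem invCoeff_six : invCoeff 6 = 48 := by
  have := invCoeff_recurrence (n := 6) (by omega)
  simp [Finset.sum_range_succ, invCoeff_zero, invCoeff_one, invCoeff_two, invCoeff_three,
    invCoeff_four, invCoeff_five] at this
  linarith

theorem invCoeff_seven : invCoeff 7 = 336 := by
  have := invCoeff_recurrence (n := 7) (by omega)
  simp [Finset.sum_range_succ, invCoeff_zero, invCoeff_one, invCoeff_two, invCoeff_three,
    invCoeff_four, invCoeff_five, invCoeff_six] at this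
  linarith

/-- The terms of lower order in the recurrence for `invCoeff`. -/
noncomputable def remainder (n : ℕ) : ℚ :=
  ((n + 1) * ∑ i ∈ Finset.Ico 5 (n - 3), invCoeff i * invCoeff (n + 1 - i) +
    (n + 2) * ∑ i ∈ Finset.Ico 4 (n - 3), invCoeff i * invCoeff (n - i)) / 2

/-- Split off the outer terms of both convolutions. The contribution of `invCoeff 1 = -1` leaves
`invCoeff n` with total coefficient 2. The cutoffs 5 and 4 keep all indices in `remainder` at least
4, where the sequence is positive, and make both sums of order `(n - 4)!`. -/
theorem invCoeff_eq {n : ℕ} (hn : 8 ≤ n) :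
    invCoeff n = n * invCoeff (n - 1) + 2 * invCoeff (n - 2) + 2 * n * invCoeff (n - 3) +
      remainder n := by
  have h := invCoeff_recurrence (n := n) (by omega)
  rw [sum_conv_eq invCoeff (m := n + 1) (d := 5) (by omega),
    sum_conv_eq invCoeff (m := n) (d := 4) (by omega)] at h
  simp only [Finset.sum_range_succ, Finset.sum_range_zero, invCoeff_zero, invCoeff_one,
    invCoeff_two, invCoeff_three, invCoeff_four, zero_mul, zero_add] at h
  rw [show n + 1 - 1 = n by omega, show n + 1 - 2 = n - 1 by omega,
    show n + 1 - 3 = n - 2 by omega, show n + 1 - 4 = n - 3 by omega,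
    show n + 1 + 1 - 5 = n - 3 by omega] at h
  rw [remainder]
  linear_combination h / 2

theorem invCoeff_pos {n : ℕ} (hn : 4 ≤ n) : 0 < invCoeff n := by
  induction n using Nat.strong_induction_on with
  | _ n ih =>
    rcases lt_or_ge n 8 with h | h
    · interval_cases n
      · rw [invCoeff_four]; norm_num
      · rw [invCoeff_five]; norm_num
      · rw [invCoeff_six]; norm_num
      · rw [invCoeff_seven]; norm_num
    · have hR : 0 ≤ remainder n := by
        have h1 : 0 ≤ ∑ i ∈ Finset.Ico 5 (n - 3), invCoeff i * invCoeff (n + 1 - i) :=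
          Finset.sum_nonneg fun i hi => by
            rw [Finset.mem_Ico] at hi
            exact (mul_pos (ih i (by omega) (by omega)) (ih _ (by omega) (by omega))).le
        have h2 : 0 ≤ ∑ i ∈ Finset.Ico 4 (n - 3), invCoeff i * invCoeff (n - i) :=
          Finset.sum_nonneg fun i hi => by
            rw [Finset.mem_Ico] at hi
            exact (mul_pos (ih i (by omega) (by omega)) (ih _ (by omega) (by omega))).le
        rw [remainder]
        positivity
      have h1 := ih (n - 1) (by omega) (by omega)
      have h2 := ih (n - 2) (by omega) (by omega)
      have h3 := ih (n - 3) (by omega) (by omega)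
      have h0 : (0 : ℚ) < n := by exact_mod_cast (by omega : 0 < n)
      rw [invCoeff_eq h]
      positivity

theorem remainder_nonneg (n : ℕ) : 0 ≤ remainder n := by
  have h1 : 0 ≤ ∑ i ∈ Finset.Ico 5 (n - 3), invCoeff i * invCoeff (n + 1 - i) :=
    Finset.sum_nonneg fun i hi => by
      rw [Finset.mem_Ico] at hi
      exact (mul_pos (invCoeff_pos (by omega)) (invCoeff_pos (by omega))).le
  have h2 : 0 ≤ ∑ i ∈ Finset.Ico 4 (n - 3), invCoeff i * invCoeff (n - i) :=
    Finset.sum_nonneg fun i hi => by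
      rw [Finset.mem_Ico] at hi
      exact (mul_pos (invCoeff_pos (by omega)) (invCoeff_pos (by omega))).le
  rw [remainder]
  positivity

theorem invCoeff_le {n : ℕ} (hn : 4 ≤ n) : invCoeff n ≤ 2 * n ! := by
  rw [invCoeff_of_two_le (by omega), simpleCoeff, if_pos hn]
  have h1 : (simpleCount n : ℚ) ≤ n ! := by
    have : simpleCount n ≤ n ! := by
      rw [simpleCount, ← Nat.card_coe_set_eq]
      refine (Finite.card_subtype_le _).trans ?_
      rw [Nat.card_perm, Nat.card_fin]
    exact_mod_cast this
  have h2 : (2 : ℚ) ≤ n ! := by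
    have := Nat.factorial_le (by omega : 2 ≤ n)
    exact_mod_cast this
  have h3 : (-1 : ℚ) ^ n ≤ 1 := by
    rcases neg_one_pow_eq_or ℚ n with h | h <;> norm_num [h]
  linarith

/-- The constant makes `n = 7` an equality, 5040 = 15 · 336; afterwards the recurrence multiplies by
at least `n`. -/
theorem le_invCoeff {n : ℕ} (hn : 7 ≤ n) : (n ! : ℚ) ≤ 15 * invCoeff n := by
  induction n, hn using Nat.le_induction with
  | base =>
    rw [invCoeff_seven]
    norm_num [Nat.factorial]
  | succ n hn ih =>
    have h := invCoeff_eq (n := n + 1) (by omega)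
    have h1 := invCoeff_pos (n := n + 1 - 2) (by omega)
    have h2 := invCoeff_pos (n := n + 1 - 3) (by omega)
    have h3 := remainder_nonneg (n + 1)
    rw [Nat.add_sub_cancel] at h
    have h4 : 0 ≤ 2 * ((n + 1 : ℕ) : ℚ) * invCoeff (n + 1 - 3) := by positivity
    rw [Nat.factorial_succ]
    have h5 : ((n + 1 : ℕ) : ℚ) * n ! ≤ ((n + 1 : ℕ) : ℚ) * (15 * invCoeff n) :=
      mul_le_mul_of_nonneg_left ih (by positivity)
    push_cast at *
    linarith

/-- 4512 = 4(2·5! + 6!) + 4(2·4! + 5!); the halving in `remainder` absorbs the shifts `n + 1` and `n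
+ 2`. -/
theorem remainder_le {n : ℕ} (hn : 9 ≤ n) : remainder n ≤ 4512 * n * (n - 4)! := by
  have key : ∀ d m, 4 ≤ d → 2 * d < m + 1 →
      ∑ i ∈ Finset.Ico d (m + 1 - d), invCoeff i * invCoeff (m - i) ≤
        4 * (2 * d ! + (d + 1)! : ℕ) * (m - d)! := by
    intro d m hd hdm
    have h1 : ∀ i ∈ Finset.Ico d (m + 1 - d), invCoeff i * invCoeff (m - i) ≤
        4 * ((i ! * (m - i)! : ℕ) : ℚ) := fun i hi => by
      rw [Finset.mem_Ico] at hi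
      have := mul_le_mul (invCoeff_le (n := i) (by omega)) (invCoeff_le (n := m - i) (by omega))
        (invCoeff_pos (by omega)).le (by positivity)
      push_cast
      linarith
    refine (Finset.sum_le_sum h1).trans ?_
    rw [← Finset.mul_sum, mul_assoc]
    refine mul_le_mul_of_nonneg_left ?_ (by norm_num)
    exact_mod_cast sum_factorial_mul_factorial_le (by omega) hdm
  have h1 := key 5 (n + 1) (by omega) (by omega)
  have h2 := key 4 n (by omega) (by omega)
  rw [show n + 1 + 1 - 5 = n - 3 by omega, show n + 1 - 5 = n - 4 by omega] at h1
  rw [show n + 1 - 4 = n - 3 by omega] at h2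
  norm_num [Nat.factorial] at h1 h2
  have hn' : (9 : ℚ) ≤ n := by exact_mod_cast hn
  have hf : (0 : ℚ) < (n - 4)! := by positivity
  rw [remainder]
  have h3 := mul_le_mul_of_nonneg_left h1 (by positivity : (0 : ℚ) ≤ n + 1)
  have h4 := mul_le_mul_of_nonneg_left h2 (by positivity : (0 : ℚ) ≤ n + 2)
  nlinarith

end Growth

/-! ### Asymptotics of the ratio and of the average -/

section Ratio

/-- The ratio `n u (n - 1) / u n` for the sequence `u = invCoeff`. -/
noncomputable def invRatio (n : ℕ) : ℚ :=
  n * invCoeff (n - 1) / invCoeff n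

theorem invRatio_pos {n : ℕ} (hn : 5 ≤ n) : 0 < invRatio n := by
  have h1 := invCoeff_pos (n := n) (by omega)
  have h2 := invCoeff_pos (n := n - 1) (by omega)
  have h3 : (0 : ℚ) < n := by exact_mod_cast (by omega : 0 < n)
  rw [invRatio]
  positivity

/-- Divide the recurrence by `invCoeff n` and write the quotients as products of ratios. -/
theorem one_sub_invRatio_eq {n : ℕ} (hn : 8 ≤ n) :
    1 - invRatio n = 2 / (n * (n - 1)) * (invRatio (n - 1) * invRatio n) +
      2 / ((n - 1) * (n - 2)) * (invRatio (n - 2) * invRatio (n - 1) * invRatio n) +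
      remainder n / invCoeff n := by
  have h0 := (invCoeff_pos (n := n) (by omega)).ne'
  have h1 := (invCoeff_pos (n := n - 1) (by omega)).ne'
  have h2 := (invCoeff_pos (n := n - 2) (by omega)).ne'
  have hn' : (8 : ℚ) ≤ n := by exact_mod_cast hn
  have e0 : (n : ℚ) ≠ 0 := by linarith
  have e1 : (n : ℚ) - 1 ≠ 0 := by linarith
  have e2 : (n : ℚ) - 2 ≠ 0 := by linarith
  have h := invCoeff_eq hn
  simp only [invRatio]
  rw [show n - 1 - 1 = n - 2 by omega, show n - 2 - 1 = n - 3 by omega,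
    Nat.cast_sub (by omega : 1 ≤ n), Nat.cast_sub (by omega : 2 ≤ n)]
  push_cast
  field_simp
  linear_combination h

theorem cube_le_mul {n : ℕ} (hn : 6 ≤ n) :
    (n : ℚ) ^ 3 ≤ 8 * ((n - 1) * (n - 2) * (n - 3)) := by
  have hn' : (6 : ℚ) ≤ n := by exact_mod_cast hn
  have h3 : (n : ℚ) ≤ 2 * (n - 3) := by linarith
  have h2 : (n : ℚ) ≤ 2 * (n - 2) := by linarith
  have h1 : (n : ℚ) ≤ 2 * (n - 1) := by linarith
  have e1 : (0 : ℚ) < n - 1 := by linarith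
  have e2 : (0 : ℚ) < n - 2 := by linarith
  calc (n : ℚ) ^ 3 = n * n * n := by ring
    _ ≤ (2 * (n - 1)) * (2 * (n - 2)) * (2 * (n - 3)) := by gcongr
    _ = _ := by ring

theorem factorial_eq_mul {n : ℕ} (hn : 4 ≤ n) :
    (n ! : ℚ) = n * ((n - 1) * (n - 2) * (n - 3)) * (n - 4)! := by
  obtain ⟨m, rfl⟩ := Nat.exists_eq_add_of_le' hn
  rw [Nat.add_sub_cancel, Nat.factorial_succ, Nat.factorial_succ, Nat.factorial_succ,
    Nat.factorial_succ]
  push_cast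
  ring

/-- 541440 = 4512 · 8 · 15, from `remainder_le`, `cube_le_mul` and `le_invCoeff`. -/
theorem remainder_div_le {n : ℕ} (hn : 9 ≤ n) :
    remainder n / invCoeff n ≤ 541440 / (n : ℚ) ^ 3 := by
  have h0 := invCoeff_pos (n := n) (by omega)
  have h1 := remainder_le hn
  have h2 := le_invCoeff (n := n) (by omega)
  have hn' : (9 : ℚ) ≤ n := by exact_mod_cast hn
  have hf : (0 : ℚ) < (n - 4)! := by positivity
  have h3 := cube_le_mul (n := n) (by omega)
  rw [factorial_eq_mul (by omega)] at h2
  rw [div_le_div_iff₀ h0 (by positivity)]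
  calc remainder n * (n : ℚ) ^ 3
      ≤ 4512 * n * (n - 4)! * (8 * ((n - 1) * (n - 2) * (n - 3))) := by
        gcongr
    _ = 4512 * 8 * (n * ((n - 1) * (n - 2) * (n - 3)) * (n - 4)!) := by ring
    _ ≤ 4512 * 8 * (15 * invCoeff n) := by gcongr
    _ = 541440 * invCoeff n := by ring

theorem invRatio_le_one {n : ℕ} (hn : 8 ≤ n) : invRatio n ≤ 1 := by
  have h0 := invRatio_pos (n := n) (by omega)
  have h1 := invRatio_pos (n := n - 1) (by omega)
  have h2 := invRatio_pos (n := n - 2) (by omega)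
  have h3 := invCoeff_pos (n := n) (by omega)
  have h4 := remainder_nonneg n
  have hn' : (8 : ℚ) ≤ n := by exact_mod_cast hn
  have e1 : (0 : ℚ) < n - 1 := by linarith
  have e2 : (0 : ℚ) < n - 2 := by linarith
  have h := one_sub_invRatio_eq hn
  have : 0 ≤ 1 - invRatio n := by
    rw [h]
    positivity
  linarith

theorem one_sub_invRatio_le {n : ℕ} (hn : 10 ≤ n) :
    1 - invRatio n ≤ 4 / (n : ℚ) ^ 2 + 541472 / (n : ℚ) ^ 3 := by
  have h0 := invRatio_pos (n := n) (by omega)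
  have h1 := invRatio_pos (n := n - 1) (by omega)
  have h2 := invRatio_pos (n := n - 2) (by omega)
  have k0 := invRatio_le_one (n := n) (by omega)
  have k1 := invRatio_le_one (n := n - 1) (by omega)
  have k2 := invRatio_le_one (n := n - 2) (by omega)
  have hn' : (10 : ℚ) ≤ n := by exact_mod_cast hn
  have e0 : (0 : ℚ) < n := by linarith
  have e1 : (0 : ℚ) < n - 1 := by linarith
  have e2 : (0 : ℚ) < n - 2 := by linarith
  have hr := remainder_div_le (n := n) (by omega)
  have p1 : invRatio (n - 1) * invRatio n ≤ 1 := mul_le_one₀ k1 h0.le k0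
  have p2 : invRatio (n - 2) * invRatio (n - 1) * invRatio n ≤ 1 :=
    mul_le_one₀ (mul_le_one₀ k2 h1.le k1) h0.le k0
  have q1 := mul_le_mul_of_nonneg_left p1 (by positivity : 0 ≤ 2 / ((n : ℚ) * (n - 1)))
  have q2 := mul_le_mul_of_nonneg_left p2 (by positivity : 0 ≤ 2 / (((n : ℚ) - 1) * (n - 2)))
  have key : 2 / ((n : ℚ) * (n - 1)) * 1 + 2 / (((n : ℚ) - 1) * (n - 2)) * 1 ≤
      4 / (n : ℚ) ^ 2 + 32 / (n : ℚ) ^ 3 := by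
    have h : 2 / ((n : ℚ) * (n - 1)) * 1 + 2 / (((n : ℚ) - 1) * (n - 2)) * 1 =
        4 / (n * (n - 2)) := by
      field_simp
      ring
    have h' : 4 / (n : ℚ) ^ 2 + 32 / (n : ℚ) ^ 3 = (4 * n + 32) / (n : ℚ) ^ 3 := by
      field_simp
    rw [h, h', div_le_div_iff₀ (by positivity) (by positivity)]
    nlinarith
  have e : 541472 / (n : ℚ) ^ 3 = 32 / (n : ℚ) ^ 3 + 541440 / (n : ℚ) ^ 3 := by ring
  rw [one_sub_invRatio_eq (by omega), e]
  linarith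

theorem one_sub_invRatio_le' {n : ℕ} (hn : 10 ≤ n) : 1 - invRatio n ≤ 541476 / (n : ℚ) := by
  have hn' : (10 : ℚ) ≤ n := by exact_mod_cast hn
  refine (one_sub_invRatio_le hn).trans ?_
  have h1 : 4 / (n : ℚ) ^ 2 ≤ 4 / n := by
    gcongr
    nlinarith
  have h2 : 541472 / (n : ℚ) ^ 3 ≤ 541472 / n := by
    gcongr
    nlinarith [sq_nonneg (n : ℚ)]
  have e : 541476 / (n : ℚ) = 4 / n + 541472 / n := by ring
  linarith

/-- A first bound of order 1/n on `1 - invRatio` is fed back into the identity. Replacing `n - 1`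
and `n - 2` by `n` costs a factor 2, giving `c`; then 12995424 = 12 · 1082952. -/
theorem le_one_sub_invRatio {n : ℕ} (hn : 12 ≤ n) :
    4 / (n : ℚ) ^ 2 - 12995424 / (n : ℚ) ^ 3 ≤ 1 - invRatio n := by
  have h0 := invRatio_pos (n := n) (by omega)
  have h1 := invRatio_pos (n := n - 1) (by omega)
  have h2 := invRatio_pos (n := n - 2) (by omega)
  have k0 := invRatio_le_one (n := n) (by omega)
  have k1 := invRatio_le_one (n := n - 1) (by omega)
  have k2 := invRatio_le_one (n := n - 2) (by omega)
  have l0 := one_sub_invRatio_le' (n := n) (by omega)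
  have l1 := one_sub_invRatio_le' (n := n - 1) (by omega)
  have l2 := one_sub_invRatio_le' (n := n - 2) (by omega)
  have hn' : (12 : ℚ) ≤ n := by exact_mod_cast hn
  have e0 : (0 : ℚ) < n := by linarith
  have e1 : (0 : ℚ) < n - 1 := by linarith
  have e2 : (0 : ℚ) < n - 2 := by linarith
  rw [Nat.cast_sub (by omega)] at l1 l2
  push_cast at l1 l2
  have m1 : 541476 / ((n : ℚ) - 1) ≤ 1082952 / n := by
    rw [div_le_div_iff₀ e1 e0]
    linarith
  have m2 : 541476 / ((n : ℚ) - 2) ≤ 1082952 / n := by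
    rw [div_le_div_iff₀ e2 e0]
    linarith
  have m0 : 541476 / (n : ℚ) ≤ 1082952 / n := by
    gcongr
    norm_num
  set c := 1082952 / (n : ℚ) with hc
  set x := invRatio n
  set y := invRatio (n - 1)
  set z := invRatio (n - 2)
  -- A product of three numbers in `[0, 1]`, each at least `1 - c`, is at least `1 - 3c`.
  have p1 : 1 - 3 * c ≤ z * y * x := by
    have a1 : 0 ≤ (1 - z) * (1 - y) := mul_nonneg (by linarith) (by linarith)
    have a2 : 0 ≤ (1 - z * y) * (1 - x) :=
      mul_nonneg (by linarith [mul_le_one₀ k2 h1.le k1]) (by linarith)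
    nlinarith
  have p2 : 1 - 3 * c ≤ y * x := by
    have a0 : 0 ≤ (1 - z) * (y * x) := mul_nonneg (by linarith) (by positivity)
    nlinarith
  have hr : 0 ≤ remainder n / invCoeff n :=
    div_nonneg (remainder_nonneg n) (invCoeff_pos (by omega)).le
  have q1 : 2 / (n : ℚ) ^ 2 * (y * x) ≤ 2 / ((n : ℚ) * (n - 1)) * (y * x) := by
    gcongr
    nlinarith
  have q2 : 2 / (n : ℚ) ^ 2 * (z * y * x) ≤ 2 / (((n : ℚ) - 1) * (n - 2)) * (z * y * x) := by
    gcongr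
    nlinarith
  have r1 := mul_le_mul_of_nonneg_left p1 (by positivity : 0 ≤ 2 / (n : ℚ) ^ 2)
  have r2 := mul_le_mul_of_nonneg_left p2 (by positivity : 0 ≤ 2 / (n : ℚ) ^ 2)
  have e : 4 / (n : ℚ) ^ 2 - 12995424 / (n : ℚ) ^ 3 =
      2 / (n : ℚ) ^ 2 * (1 - 3 * c) + 2 / (n : ℚ) ^ 2 * (1 - 3 * c) := by
    rw [hc]
    field_simp
    ring
  rw [one_sub_invRatio_eq (by omega), e]
  linarith

/-- `simpleCount` and `invCoeff` differ by 2 in absolute value, which is negligible against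
factorial growth. -/
theorem abs_simpleCount_ratio_le {n : ℕ} (hn : 12 ≤ n) :
    |(n : ℚ) * simpleCount (n - 1) / simpleCount n - 1 + 4 / (n : ℚ) ^ 2| ≤
      13000000 / (n : ℚ) ^ 3 := by
  have hu := invCoeff_pos (n := n) (by omega)
  have hu1 := invCoeff_pos (n := n - 1) (by omega)
  have hx1 := invRatio_le_one (n := n) (by omega)
  have hn' : (12 : ℚ) ≤ n := by exact_mod_cast hn
  have e0 : (0 : ℚ) < n := by linarith
  have s0 := invCoeff_of_two_le (n := n) (by omega)
  have s1 := invCoeff_of_two_le (n := n - 1) (by omega)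
  rw [simpleCoeff, if_pos (by omega)] at s0 s1
  have hpow : (-1 : ℚ) ^ n = -(-1) ^ (n - 1) := by
    conv_lhs => rw [show n = n - 1 + 1 by omega]
    rw [pow_succ]
    ring
  rw [hpow] at s0
  have hε := neg_one_pow_eq_or ℚ (n - 1)
  set ε := (-1 : ℚ) ^ (n - 1)
  have hε' : |ε| = 1 := by rcases hε with h | h <;> simp [h]
  have hle := le_invCoeff (n := n) (by omega)
  have hfac : (n : ℚ) ^ 4 ≤ 8 * n ! := by
    rw [factorial_eq_mul (by omega)]
    have h3 := cube_le_mul (n := n) (by omega)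
    have h4 : (1 : ℚ) ≤ (n - 4)! := by exact_mod_cast Nat.factorial_pos _
    have h5 : (0 : ℚ) ≤ n * ((n - 1) * (n - 2) * (n - 3)) := by
      have : (0 : ℚ) ≤ n ^ 3 := by positivity
      refine mul_nonneg e0.le ?_
      linarith
    calc (n : ℚ) ^ 4 = (n : ℚ) * (n : ℚ) ^ 3 := by ring
      _ ≤ (n : ℚ) * (8 * (((n : ℚ) - 1) * (n - 2) * (n - 3))) := by gcongr
      _ = 8 * ((n : ℚ) * (((n : ℚ) - 1) * (n - 2) * (n - 3)) * 1) := by ring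
      _ ≤ 8 * ((n : ℚ) * (((n : ℚ) - 1) * (n - 2) * (n - 3)) * ((n - 4)! : ℕ)) := by gcongr
  have hbig : (n : ℚ) ^ 4 ≤ 120 * invCoeff n := by linarith
  have h12 : (20736 : ℚ) ≤ n ^ 4 := by
    calc (20736 : ℚ) = 12 ^ 4 := by norm_num
      _ ≤ n ^ 4 := by gcongr
  have hs : (simpleCount n : ℚ) = invCoeff n + 2 * ε := by linarith
  have hs1 : (simpleCount (n - 1) : ℚ) = invCoeff (n - 1) - 2 * ε := by linarith
  have hεle : -1 ≤ ε ∧ ε ≤ 1 := abs_le.mp hε'.le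
  have hspos : invCoeff n / 2 ≤ simpleCount n := by
    rw [hs]
    linarith [hεle.1]
  have hspos' : (0 : ℚ) < simpleCount n := by linarith
  have hnu : n * invCoeff (n - 1) ≤ invCoeff n := by
    rwa [invRatio, div_le_one hu] at hx1
  -- 960 = 4 · 120 · 2, from the bound n⁴ ≤ 120 `invCoeff n` and from `simpleCount n` being at least
  -- half of `invCoeff n`.
  have hdiff : |(n : ℚ) * simpleCount (n - 1) / simpleCount n - invRatio n| ≤
      960 / (n : ℚ) ^ 3 := by
    have h1 : (n : ℚ) * simpleCount (n - 1) / simpleCount n - invRatio n =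
        -(2 * ε * (n * invCoeff n + n * invCoeff (n - 1))) / (simpleCount n * invCoeff n) := by
      rw [invRatio, div_sub_div _ _ hspos'.ne' hu.ne', hs1]
      congr 1
      rw [hs]
      ring
    have h2 : 0 ≤ n * invCoeff n + n * invCoeff (n - 1) := by positivity
    rw [h1, abs_div, abs_neg, abs_mul, abs_mul, hε', abs_of_nonneg h2,
      abs_of_pos (mul_pos hspos' hu), abs_of_pos (by norm_num : (0 : ℚ) < 2),
      div_le_div_iff₀ (mul_pos hspos' hu) (by positivity)]
    have h3 : n * invCoeff n + n * invCoeff (n - 1) ≤ 2 * (n * invCoeff n) := by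
      nlinarith
    calc 2 * 1 * (n * invCoeff n + n * invCoeff (n - 1)) * (n : ℚ) ^ 3
        ≤ 2 * 1 * (2 * (n * invCoeff n)) * (n : ℚ) ^ 3 := by gcongr
      _ = 4 * invCoeff n * (n : ℚ) ^ 4 := by ring
      _ ≤ 4 * invCoeff n * (120 * invCoeff n) := by gcongr
      _ = 960 * (invCoeff n / 2 * invCoeff n) := by ring
      _ ≤ 960 * (simpleCount n * invCoeff n) := by gcongr
  have hup := one_sub_invRatio_le (n := n) (by omega)
  have hlo := le_one_sub_invRatio hn
  have g1 : 541472 / (n : ℚ) ^ 3 + 960 / (n : ℚ) ^ 3 ≤ 13000000 / (n : ℚ) ^ 3 := by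
    rw [← add_div]
    gcongr
    norm_num
  have g2 : 12995424 / (n : ℚ) ^ 3 + 960 / (n : ℚ) ^ 3 ≤ 13000000 / (n : ℚ) ^ 3 := by
    rw [← add_div]
    gcongr
    norm_num
  rw [abs_le] at hdiff ⊢
  constructor <;> linarith [hdiff.1, hdiff.2]

theorem averageOutdegree_isBigO :
    (fun n : ℕ => averageOutdegree n - ((n : ℝ) - 4 - 4 / (n : ℝ)))
      =O[atTop] (fun n : ℕ => 1 / (n : ℝ) ^ 2) := by
  refine IsBigO.of_bound 13000016 (eventually_atTop.mpr ⟨12, fun n hn => ?_⟩)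
  have hn' : (12 : ℝ) ≤ n := by exact_mod_cast hn
  have e0 : (0 : ℝ) < n := by linarith
  have h : |(n : ℝ) * simpleCount (n - 1) / simpleCount n - 1 + 4 / (n : ℝ) ^ 2| ≤
      13000000 / (n : ℝ) ^ 3 := by
    have := (Rat.cast_le (K := ℝ)).mpr (abs_simpleCount_ratio_le hn)
    push_cast at this
    exact this
  have h1 : averageOutdegree n =
      ((n : ℝ) - 4) * ((n : ℝ) * simpleCount (n - 1) / simpleCount n) := by
    have := averageOutdegree_succ (n := n - 1) (by omega)
    rw [show n - 1 + 1 = n by omega, Nat.cast_sub (by omega : 1 ≤ n)] at this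
    rw [this]
    push_cast
    ring
  rw [h1, Real.norm_eq_abs, Real.norm_eq_abs, abs_of_pos (by positivity : 0 < 1 / (n : ℝ) ^ 2)]
  set y := (n : ℝ) * simpleCount (n - 1) / simpleCount n
  -- The term 16/n² is left over from (n - 4)(1 - 4/n²) = n - 4 - 4/n + 16/n².
  have h2 : ((n : ℝ) - 4) * y - (n - 4 - 4 / n) =
      (n - 4) * (y - 1 + 4 / (n : ℝ) ^ 2) + 16 / (n : ℝ) ^ 2 := by
    field_simp
    ring
  rw [h2]
  calc |((n : ℝ) - 4) * (y - 1 + 4 / (n : ℝ) ^ 2) + 16 / (n : ℝ) ^ 2|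
      ≤ |((n : ℝ) - 4) * (y - 1 + 4 / (n : ℝ) ^ 2)| + |16 / (n : ℝ) ^ 2| := abs_add_le _ _
    _ = (n - 4) * |y - 1 + 4 / (n : ℝ) ^ 2| + 16 / (n : ℝ) ^ 2 := by
        rw [abs_mul, abs_of_nonneg (by linarith : (0 : ℝ) ≤ n - 4),
          abs_of_pos (by positivity : 0 < 16 / (n : ℝ) ^ 2)]
    _ ≤ n * (13000000 / (n : ℝ) ^ 3) + 16 / (n : ℝ) ^ 2 := by
        gcongr
        linarith
    _ = 13000016 * (1 / (n : ℝ) ^ 2) := by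
        field_simp
        ring

end Ratio

end SimplePoset

theorem mainTheorem7 :
    (∀ (n : ℕ) (σ : Equiv.Perm (Fin (n + 1))) (hn : 4 ≤ n + 1) (hσ : SimplePoset.IsSimple σ),
      SimplePoset.outdegree ⟨⟨n + 1, σ⟩, hn, hσ⟩ =
        Set.ncard {i : Fin (n + 1) | SimplePoset.IsSimple (SimplePoset.deletePoint σ i)}) ∧
    (fun n : ℕ => SimplePoset.averageOutdegree n - ((n : ℝ) - 4 - 4 / (n : ℝ)))
      =O[atTop] (fun n : ℕ => 1 / (n : ℝ) ^ 2) :=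
  ⟨SimplePoset.outdegree_eq_ncard, SimplePoset.averageOutdegree_isBigO⟩
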